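/- **Proposition (Auslander–Reiten quiver of $M_{14}^{\perp_1}$ in $\mathcal C_{2,6}$).** Let $Q$ be the quiver with vertex set $\mathbb Z/6=\{1,\dots,6\}$, clockwise arrows $x_a\colon a-1\to a$ and anticlockwise arrows $y_a\colon a\to a-1$ ($a\in\mathbb Z/6$). Let $C=C_{2,6}$ be the completion, at the two-sided ideal generated by the arrows, of the complex path algebra of $Q$ modulo the relations $xy=yx$ and $y^2=x^4$ starting at each vertex (each $x$, $y$ standing for the appropriate arrow $x_a$, $y_a$). Let $\mathcal C_{2,6}=\operatorname{CM}(C)$ be the category of maximal Cohen–Macaulay $C$-modules, that is, of $C$-modules that are free of finite rank over the centre $Z=\mathbb C[[t]]$ of $C$, $t=xy$. For a $2$-subset $I=\{i,j\}$ of $\mathbb Z/6$ let $M_{ij}=M_I$ be the $C$-module with a copy of $\mathbb C[[t]]$ at each vertex, $x_a$ acting as $t$ if $a\in I$ and as $1$ if $a\notin I$, and $y_a$ acting as $1$ if $a\in I$ and as $t$ if $a\notin I$. Let $$M_{14}^{\perp_1}=\{Y\in\mathcal C_{2,6} : \operatorname{Ext}^1_C(X,Y)=0 \text{ for all } X\in\operatorname{add}(M_{14})\},$$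 a full subcategory of $\mathcal C_{2,6}$ with the exact structure whose conflations are the short exact sequences of $C$-modules with all terms in $M_{14}^{\perp_1}$. Then the Auslander–Reiten quiver of $M_{14}^{\perp_1}$ is the following quiver $\Gamma$ with translation $\tau$. * The vertices are the $11$ modules $M_{12},M_{13},M_{14},M_{15},M_{16},M_{23},M_{24},M_{34},M_{45},M_{46},M_{56}$: these are objects of $M_{14}^{\perp_1}$, they are indecomposable and pairwise non-isomorphic, and every indecomposable object of $M_{14}^{\perp_1}$ is isomorphic to one of them. * There are $18$ arrows, one for each of $15\to56$, $15\to14$, $24\to14$, $24\to23$, $56\to46$, $14\to46$, $14\to13$, $23\to13$, $46\to16$, $46\to45$, $13\to12$, $13\to34$, $16\to15$, $45\to15$, $12\to24$, $34\to24$, $45\to34$, $12\to16$ (where $ij$ stands for $M_{ij}$). That is, $\operatorname{rad}(M_I,M_J)/\operatorname{rad}^2(M_I,M_J)$, formed in $M_{14}^{\perp_1}$, has dimension $1$ over $\mathbb C$ if $I\to J$ is in this list and is $0$ otherwise; and there is an irreducible map $M_I\to M_J$ in $M_{14}^{\perp_1}$ if and only if $I\to J$ is in this list. * The translation is $\tau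 M_{46}=M_{15}$, $\tau M_{15}=M_{46}$, $\tau M_{13}=M_{24}$, $\tau M_{24}=M_{13}$, and is undefined at the other vertices: there is an Auslander–Reiten sequence $0\to A\to B\to M_I\to 0$ in $M_{14}^{\perp_1}$ with $A\cong M_J$ if and only if $(I,J)$ is one of the four pairs $(46,15)$, $(15,46)$, $(13,24)$, $(24,13)$. In particular $M_{14}^{\perp_1}$ has exactly $11$ indecomposable objects up to isomorphism. Exactly seven of these are projective-injective, namely $M_{12},M_{14},M_{16},M_{23},M_{34},M_{45},M_{56}$, and none of the other four is projective or injective. Between projective-injective indecomposables $P,P'$ in this list there is an irreducible map $P\to P'$ in $M_{14}^{\perp_1}$ if and only if $(P,P')$ is $(M_{45},M_{34})$ or $(M_{12},M_{16})$. -/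

import Mathlib

open CategoryTheory CategoryTheory.Limits PowerSeries

noncomputable section

namespace GrassmannianCluster

/-! ### Completion of a (noncommutative) algebra at a two-sided ideal -/

/-- The completion `lim R / J ^ m` of a `ℂ`-algebra `R` at the two-sided ideal `J`: compatible
families in `∏ m, R ⧸ J ^ m`. -/
def completion {R : Type} [Ring R] [Algebra ℂ R] (J : Ideal R) [J.IsTwoSided] :
    Subalgebra ℂ (∀ m : ℕ, R ⧸ J ^ m) where
  carrier := {c | ∀ m, Ideal.Quotient.factor (Ideal.pow_le_pow_right m.le_succ) (c (m + 1)) = c m}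
  mul_mem' {a b} ha hb m := by simp only [Pi.mul_apply, map_mul, ha m, hb m]
  add_mem' {a b} ha hb m := by simp only [Pi.add_apply, map_add, ha m, hb m]
  algebraMap_mem' z m := by
    simp only [Pi.algebraMap_apply]
    rfl

/-! ### The algebra `C_{k,n}` -/

/-- Generators of the path algebra of the cyclic quiver with vertices `ZMod n`: the trivial path
`e j` at each vertex `j`, the clockwise arrow `x a : a - 1 ⟶ a` and the anticlockwise arrow
`y a : a ⟶ a - 1`. -/
inductive Gen (n : ℕ) : Type
  | e (j : ZMod n) : Gen n
  | x (a : ZMod n) : Gen n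
  | y (a : ZMod n) : Gen n

/-- The trivial path at `j` in the free algebra on `Gen n`. -/
def fe {n : ℕ} (j : ZMod n) : FreeAlgebra ℂ (Gen n) := FreeAlgebra.ι ℂ (Gen.e j)
/-- The arrow `x a : a - 1 ⟶ a` in the free algebra on `Gen n`. -/
def fx {n : ℕ} (a : ZMod n) : FreeAlgebra ℂ (Gen n) := FreeAlgebra.ι ℂ (Gen.x a)
/-- The arrow `y a : a ⟶ a - 1` in the free algebra on `Gen n`. -/
def fy {n : ℕ} (a : ZMod n) : FreeAlgebra ℂ (Gen n) := FreeAlgebra.ι ℂ (Gen.y a)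

/-- The defining relations. The first group presents the path algebra of the quiver (paths are
composed from right to left, so that left modules are representations of the quiver); the last two
are the relations `xy = yx` and `y ^ k = x ^ (n - k)` for paths starting at the vertex `j`, where
`x` and `y` stand for the sums of all the `x a`, respectively all the `y a`. -/
inductive Rel (k n : ℕ) [NeZero n] : FreeAlgebra ℂ (Gen n) → FreeAlgebra ℂ (Gen n) → Prop
  | idem (j : ZMod n) : Rel k n (fe j * fe j) (fe j)
  | orth (i j : ZMod n) (h : i ≠ j) : Rel k n (fe i * fe j) 0
  | unit : Rel k n (∑ j, fe j) 1
  | x_source (a : ZMod n) : Rel k n (fx a * fe (a - 1)) (fx a)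
  | x_target (a : ZMod n) : Rel k n (fe a * fx a) (fx a)
  | y_source (a : ZMod n) : Rel k n (fy a * fe a) (fy a)
  | y_target (a : ZMod n) : Rel k n (fe (a - 1) * fy a) (fy a)
  | comm (j : ZMod n) :
      Rel k n ((∑ a, fx a) * (∑ a, fy a) * fe j) ((∑ a, fy a) * (∑ a, fx a) * fe j)
  | pow (j : ZMod n) : Rel k n ((∑ a, fy a) ^ k * fe j) ((∑ a, fx a) ^ (n - k) * fe j)

/-- The path algebra of the cyclic quiver modulo the relations, before completion. -/
abbrev PreAlg (k n : ℕ) [NeZero n] : Type := RingQuot (Rel k n)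

/-- The two-sided ideal generated by the arrows. -/
def arrowIdeal (k n : ℕ) [NeZero n] : Ideal (PreAlg k n) :=
  (TwoSidedIdeal.span (Set.range (fun a => RingQuot.mkAlgHom ℂ (Rel k n) (fx a)) ∪
    Set.range (fun a => RingQuot.mkAlgHom ℂ (Rel k n) (fy a)))).asIdeal

instance (k n : ℕ) [NeZero n] : (arrowIdeal k n).IsTwoSided := by
  unfold arrowIdeal; infer_instance

/-- The algebra `C_{k,n}`: the completion of `PreAlg k n` at the ideal generated by the arrows. -/
def CAlg (k n : ℕ) [NeZero n] : Type := completion (arrowIdeal k n)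

instance (k n : ℕ) [NeZero n] : Ring (CAlg k n) :=
  inferInstanceAs (Ring (completion (arrowIdeal k n)))

instance (k n : ℕ) [NeZero n] : Algebra ℂ (CAlg k n) :=
  inferInstanceAs (Algebra ℂ (completion (arrowIdeal k n)))

/-! ### The modules `M_I` -/

section RankOne

set_option linter.unusedSectionVars false

variable {n : ℕ} [NeZero n]

/-- The action of the generators on `⨁_j V_j`, `V_j = ℂ⟦t⟧`: `e j` is the projection to `V_j`, the
arrow `x a : V_{a-1} → V_a` is `t` if `a ∈ I` and `1` otherwise, and the arrow `y a : V_a → V_{a-1}`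
is `1` if `a ∈ I` and `t` otherwise. -/
def genAct (I : Finset (ZMod n)) : Gen n → Module.End ℂ⟦X⟧ (ZMod n → ℂ⟦X⟧)
  | .e j => LinearMap.single _ _ j ∘ₗ LinearMap.proj j
  | .x a => (if a ∈ I then (X : ℂ⟦X⟧) else 1) • (LinearMap.single _ _ a ∘ₗ LinearMap.proj (a - 1))
  | .y a => (if a ∈ I then 1 else (X : ℂ⟦X⟧)) • (LinearMap.single _ _ (a - 1) ∘ₗ LinearMap.proj a)

/-- The induced action of the free algebra. -/
def freeAct (I : Finset (ZMod n)) :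
    FreeAlgebra ℂ (Gen n) →ₐ[ℂ] Module.End ℂ⟦X⟧ (ZMod n → ℂ⟦X⟧) :=
  FreeAlgebra.lift ℂ (genAct I)

lemma freeAct_e (I : Finset (ZMod n)) (j : ZMod n) (v : ZMod n → ℂ⟦X⟧) :
    freeAct I (fe j) v = Pi.single j (v j) := by
  simp [freeAct, fe, genAct]

lemma freeAct_x (I : Finset (ZMod n)) (a : ZMod n) (v : ZMod n → ℂ⟦X⟧) :
    freeAct I (fx a) v = Pi.single a ((if a ∈ I then X else 1) * v (a - 1)) := by
  split_ifs with h <;> simp [freeAct, fx, genAct, h, ← Pi.single_smul]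

lemma freeAct_y (I : Finset (ZMod n)) (a : ZMod n) (v : ZMod n → ℂ⟦X⟧) :
    freeAct I (fy a) v = Pi.single (a - 1) ((if a ∈ I then 1 else X) * v a) := by
  split_ifs with h <;> simp [freeAct, fy, genAct, h, ← Pi.single_smul]

lemma freeAct_sum_x (I : Finset (ZMod n)) (v : ZMod n → ℂ⟦X⟧) (a : ZMod n) :
    freeAct I (∑ a, fx a) v a = (if a ∈ I then X else 1) * v (a - 1) := by
  rw [map_sum, LinearMap.sum_apply, Finset.sum_apply, Finset.sum_eq_single a]
  · rw [freeAct_x, Pi.single_eq_same]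
  · intro b _ hb
    rw [freeAct_x, Pi.single_eq_of_ne hb.symm]
  · simp

lemma freeAct_sum_y (I : Finset (ZMod n)) (v : ZMod n → ℂ⟦X⟧) (a : ZMod n) :
    freeAct I (∑ a, fy a) v a = (if a + 1 ∈ I then 1 else X) * v (a + 1) := by
  rw [map_sum, LinearMap.sum_apply, Finset.sum_apply, Finset.sum_eq_single (a + 1)]
  · rw [freeAct_y]
    simp only [add_sub_cancel_right, Pi.single_eq_same]
  · intro b _ hb
    rw [freeAct_y, Pi.single_eq_of_ne]
    rintro rfl
    simp at hb
  · simp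

lemma freeAct_xy (I : Finset (ZMod n)) (v : ZMod n → ℂ⟦X⟧) :
    freeAct I (∑ a, fx a) (freeAct I (∑ a, fy a) v) = (X : ℂ⟦X⟧) • v := by
  funext a
  rw [freeAct_sum_x, freeAct_sum_y]
  by_cases h : a ∈ I <;> simp [h]

lemma freeAct_yx (I : Finset (ZMod n)) (v : ZMod n → ℂ⟦X⟧) :
    freeAct I (∑ a, fy a) (freeAct I (∑ a, fx a) v) = (X : ℂ⟦X⟧) • v := by
  funext a
  rw [freeAct_sum_y, freeAct_sum_x]
  by_cases h : a + 1 ∈ I <;> simp [h]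

lemma freeAct_pow_x (I : Finset (ZMod n)) (m : ℕ) (v : ZMod n → ℂ⟦X⟧) (a : ZMod n) :
    freeAct I ((∑ a, fx a) ^ m) v a =
      (∏ i ∈ Finset.range m, (if a - (i : ZMod n) ∈ I then (X : ℂ⟦X⟧) else 1)) * v (a - m) := by
  induction m generalizing a with
  | zero => simp
  | succ m ih =>
    rw [pow_succ', map_mul, Module.End.mul_apply, freeAct_sum_x, ih, Finset.prod_range_succ']
    have h1 : ∀ i : ℕ, a - 1 - (i : ZMod n) = a - ((i + 1 : ℕ) : ZMod n) := by
      intro i; push_cast; ring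
    simp only [h1]
    simp only [Nat.cast_zero, sub_zero]
    ring

lemma freeAct_pow_x_self (I : Finset (ZMod n)) (v : ZMod n → ℂ⟦X⟧) :
    freeAct I ((∑ a, fx a) ^ n) v = (X : ℂ⟦X⟧) ^ I.card • v := by
  funext a
  rw [freeAct_pow_x]
  have h : (∏ i ∈ Finset.range n, (if a - (i : ZMod n) ∈ I then (X : ℂ⟦X⟧) else 1))
      = ∏ b : ZMod n, (if b ∈ I then (X : ℂ⟦X⟧) else 1) := by
    refine Finset.prod_bij' (fun i _ => a - (i : ZMod n)) (fun b _ => (a - b).val) ?_ ?_ ?_ ?_ ?_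
    · simp
    · intro b _; simpa using ZMod.val_lt _
    · intro i hi
      simp only [sub_sub_cancel]
      exact ZMod.val_cast_of_lt (by simpa using hi)
    · intro b _; simp
    · simp
  rw [h, Finset.prod_ite_mem]
  simp

lemma freeAct_pow_eq (I : Finset (ZMod n)) (v : ZMod n → ℂ⟦X⟧) :
    freeAct I ((∑ a, fy a) ^ I.card) v = freeAct I ((∑ a, fx a) ^ (n - I.card)) v := by
  have hle : I.card ≤ n := by simpa [ZMod.card] using Finset.card_le_univ I
  have key : ∀ m (u : ZMod n → ℂ⟦X⟧), freeAct I ((∑ a, fx a) ^ m)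
      (freeAct I ((∑ a, fy a) ^ m) u) = (X : ℂ⟦X⟧) ^ m • u := by
    intro m
    induction m with
    | zero => simp
    | succ m ih =>
      intro u
      rw [pow_succ, pow_succ', map_mul, map_mul, Module.End.mul_apply, Module.End.mul_apply,
        freeAct_xy, LinearMap.map_smul, ih, smul_smul, ← pow_succ']
  have h1 : freeAct I ((∑ a, fx a) ^ n) (freeAct I ((∑ a, fy a) ^ I.card) v)
      = (X : ℂ⟦X⟧) ^ I.card • freeAct I ((∑ a, fx a) ^ (n - I.card)) v := by
    have h0 : (∑ a, fx a : FreeAlgebra ℂ (Gen n)) ^ n =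
        (∑ a, fx a) ^ (n - I.card) * (∑ a, fx a) ^ I.card := by
      rw [← pow_add, Nat.sub_add_cancel hle]
    rw [h0, map_mul, Module.End.mul_apply, key, LinearMap.map_smul]
  rw [freeAct_pow_x_self] at h1
  funext a
  have h2 := congrFun h1 a
  simp only [Pi.smul_apply, smul_eq_mul] at h2
  exact mul_left_cancel₀ (pow_ne_zero _ X_ne_zero) h2

lemma freeAct_rel (I : Finset (ZMod n)) {k : ℕ} (hI : I.card = k)
    ⦃r s : FreeAlgebra ℂ (Gen n)⦄ (h : Rel k n r s) : freeAct I r = freeAct I s := by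
  subst hI
  refine LinearMap.ext fun v => ?_
  cases h with
  | idem j => simp only [map_mul, Module.End.mul_apply, freeAct_e, Pi.single_eq_same]
  | orth i j h =>
    simp only [map_mul, Module.End.mul_apply, freeAct_e, Pi.single_eq_of_ne h, Pi.single_zero,
      map_zero, LinearMap.zero_apply]
  | unit =>
    simp only [map_sum, LinearMap.sum_apply, freeAct_e, map_one, Module.End.one_apply]
    exact Finset.univ_sum_single v
  | x_source a =>
    simp only [map_mul, Module.End.mul_apply, freeAct_e, freeAct_x, Pi.single_eq_same]
  | x_target a =>
    simp only [map_mul, Module.End.mul_apply, freeAct_e, freeAct_x, Pi.single_eq_same]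
  | y_source a =>
    simp only [map_mul, Module.End.mul_apply, freeAct_e, freeAct_y, Pi.single_eq_same]
  | y_target a =>
    simp only [map_mul, Module.End.mul_apply, freeAct_e, freeAct_y, Pi.single_eq_same]
  | comm j =>
    rw [map_mul, map_mul, map_mul, map_mul]
    simp only [Module.End.mul_apply]
    rw [freeAct_xy, freeAct_yx]
  | pow j =>
    rw [map_mul, map_mul, Module.End.mul_apply, Module.End.mul_apply, freeAct_pow_eq]

/-- The action of the uncompleted algebra on `⨁_j ℂ⟦t⟧`, for a `k`-subset `I`. -/
def preAct (I : Finset (ZMod n)) {k : ℕ} (hI : I.card = k) :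
    PreAlg k n →ₐ[ℂ] Module.End ℂ⟦X⟧ (ZMod n → ℂ⟦X⟧) :=
  RingQuot.liftAlgHom ℂ ⟨freeAct I, freeAct_rel I hI⟩

lemma preAct_mk (I : Finset (ZMod n)) {k : ℕ} (hI : I.card = k) (r : FreeAlgebra ℂ (Gen n)) :
    preAct I hI (RingQuot.mkAlgHom ℂ (Rel k n) r) = freeAct I r := by
  simp [preAct]

/-- An auxiliary integer weight of the basis vector at the vertex `a`. -/
def weight (I : Finset (ZMod n)) (a : ZMod n) : ℤ :=
  -∑ i ∈ Finset.range n, (i : ℤ) * (n * (if a - (i : ZMod n) ∈ I then 1 else 0) - I.card)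

lemma weight_sub (I : Finset (ZMod n)) (a : ZMod n) :
    weight I a - weight I (a - 1) = n * (n * (if a ∈ I then 1 else 0) - I.card) := by
  set g : ZMod n → ℤ := fun b => n * (if b ∈ I then 1 else 0) - I.card with hg
  have hsum : ∑ i ∈ Finset.range n, g (a - (i : ZMod n)) = 0 := by
    have : ∑ i ∈ Finset.range n, g (a - (i : ZMod n)) = ∑ b : ZMod n, g b := by
      refine Finset.sum_bij' (fun i _ => a - (i : ZMod n)) (fun b _ => (a - b).val) ?_ ?_ ?_ ?_ ?_
      · simp
      · intro b _; simpa using ZMod.val_lt _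
      · intro i hi
        simp only [sub_sub_cancel]
        exact ZMod.val_cast_of_lt (by simpa using hi)
      · intro b _; simp
      · simp
    rw [this]
    simp [hg, Finset.sum_sub_distrib, ZMod.card, mul_comm]
  have h1 : ∀ m : ℕ, ∑ i ∈ Finset.range m, (i : ℤ) * g (a - 1 - (i : ZMod n)) =
      (∑ i ∈ Finset.range m, (i : ℤ) * g (a - (i : ZMod n)))
        - ∑ i ∈ Finset.range m, g (a - (i : ZMod n)) + g a
        + (m - 1) * g (a - (m : ZMod n)) := by
    intro m
    induction m with
    | zero => simp
    | succ m ih =>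
      rw [Finset.sum_range_succ, ih, Finset.sum_range_succ, Finset.sum_range_succ]
      have : a - 1 - (m : ZMod n) = a - ((m + 1 : ℕ) : ZMod n) := by push_cast; ring
      rw [this]
      push_cast
      ring
  have h2 := h1 n
  rw [hsum] at h2
  simp only [CharP.cast_eq_zero, sub_zero] at h2
  change -(∑ i ∈ Finset.range n, (i : ℤ) * g (a - (i : ZMod n)))
    - -(∑ i ∈ Finset.range n, (i : ℤ) * g (a - 1 - (i : ZMod n))) = n * g a
  rw [h2]
  ring

/-- The auxiliary filtration of `⨁_j ℂ⟦t⟧` by weight. -/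
def Fil (I : Finset (ZMod n)) (N : ℤ) (v : ZMod n → ℂ⟦X⟧) : Prop :=
  ∀ (j : ZMod n) (d : ℕ), (n : ℤ) * n * d - weight I j < N → coeff d (v j) = 0

lemma Fil.zero (I : Finset (ZMod n)) (N : ℤ) : Fil I N 0 := fun j d _ => by simp

lemma Fil.add {I : Finset (ZMod n)} {N : ℤ} {v w : ZMod n → ℂ⟦X⟧} (hv : Fil I N v)
    (hw : Fil I N w) : Fil I N (v + w) := fun j d h => by
  simp [hv j d h, hw j d h]

lemma Fil.mono {I : Finset (ZMod n)} {N N' : ℤ} (h : N' ≤ N) {v : ZMod n → ℂ⟦X⟧}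
    (hv : Fil I N v) : Fil I N' v := fun j d hd => hv j d (hd.trans_le h)

lemma Fil.single {I : Finset (ZMod n)} {N : ℤ} {j : ZMod n} {u : ℂ⟦X⟧}
    (h : ∀ d : ℕ, (n : ℤ) * n * d - weight I j < N → coeff d u = 0) :
    Fil I N (Pi.single j u) := by
  intro i d hd
  by_cases hij : i = j
  · subst hij
    simpa using h d hd
  · simp [Pi.single_eq_of_ne hij]

lemma coeff_ite_mul (p : Prop) [Decidable p] (u : ℂ⟦X⟧) (d : ℕ)
    (h : ∀ d' : ℕ, d' + (if p then 1 else 0) = d → coeff d' u = 0) :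
    coeff d ((if p then X else 1) * u) = 0 := by
  split_ifs with hp
  · cases d with
    | zero => simp
    | succ d => rw [coeff_succ_X_mul]; exact h d (by simp [hp])
  · rw [one_mul]; exact h d (by simp [hp])

lemma Fil.x {I : Finset (ZMod n)} (hI : 0 < I.card) {N : ℤ} {v : ZMod n → ℂ⟦X⟧}
    (hv : Fil I N v) (a : ZMod n) : Fil I (N + 1) (freeAct I (fx a) v) := by
  rw [freeAct_x]
  refine Fil.single fun d hd => coeff_ite_mul _ _ _ fun d' hd' => hv _ _ ?_
  have hw := weight_sub I a
  have hn : 0 < n := Nat.pos_of_ne_zero (NeZero.ne n)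
  have h1 : (1 : ℤ) ≤ n * I.card := by exact_mod_cast Nat.mul_pos hn hI
  have h2 : (d : ℤ) = d' + (if a ∈ I then 1 else 0) := by rw [← hd']; push_cast; rfl
  rw [h2] at hd
  linarith

lemma Fil.y {I : Finset (ZMod n)} (hI : I.card < n) {N : ℤ} {v : ZMod n → ℂ⟦X⟧}
    (hv : Fil I N v) (a : ZMod n) : Fil I (N + 1) (freeAct I (fy a) v) := by
  rw [freeAct_y, ← ite_not]
  refine Fil.single fun d hd => coeff_ite_mul _ _ _ fun d' hd' => hv _ _ ?_
  have hw := weight_sub I a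
  have hn : 0 < n := Nat.pos_of_ne_zero (NeZero.ne n)
  have h1 : (1 : ℤ) ≤ n * (n - I.card) := by
    have : (1 : ℤ) ≤ n - I.card := by omega
    have : (1 : ℤ) ≤ n := by omega
    nlinarith
  have h2 : (d : ℤ) = d' + (1 - (if a ∈ I then 1 else 0)) := by
    rw [← hd']; by_cases h : a ∈ I <;> simp [h]
  rw [h2] at hd
  linarith

lemma Fil.pre (I : Finset (ZMod n)) {k : ℕ} (hI : I.card = k) (hk : 0 < k)
    (hkn : k < n) {N : ℤ} {v : ZMod n → ℂ⟦X⟧} (hv : Fil I N v) (r : PreAlg k n) :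
    Fil I N (preAct I hI r v) := by
  obtain ⟨s, rfl⟩ := RingQuot.mkAlgHom_surjective ℂ (Rel k n) r
  rw [preAct_mk]
  induction s using FreeAlgebra.induction generalizing v with
  | grade0 z =>
    intro j d hd
    rw [AlgHom.commutes, Module.algebraMap_end_apply, Pi.smul_apply, coeff_smul, hv j d hd,
      smul_zero]
  | grade1 g =>
    cases g with
    | e j =>
      change Fil I N (freeAct I (fe j) v)
      rw [freeAct_e]
      exact Fil.single fun d hd => hv j d hd
    | x a => exact (Fil.x (hI ▸ hk) hv a).mono (by omega)
    | y a => exact (Fil.y (hI ▸ hkn) hv a).mono (by omega)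
  | mul a b ha hb =>
    rw [map_mul]
    exact ha (hb hv)
  | add a b ha hb =>
    rw [map_add]
    exact (ha hv).add (hb hv)

lemma Fil.arrow (I : Finset (ZMod n)) {k : ℕ} (hI : I.card = k) (hk : 0 < k)
    (hkn : k < n) {r : PreAlg k n} (hr : r ∈ arrowIdeal k n) {N : ℤ} {v : ZMod n → ℂ⟦X⟧}
    (hv : Fil I N v) : Fil I (N + 1) (preAct I hI r v) := by
  rw [arrowIdeal, TwoSidedIdeal.mem_asIdeal] at hr
  induction hr using TwoSidedIdeal.span_induction generalizing v with
  | mem r hr =>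
    rcases hr with ⟨a, rfl⟩ | ⟨a, rfl⟩
    · simp only [preAct_mk]
      exact Fil.x (hI ▸ hk) hv a
    · simp only [preAct_mk]
      exact Fil.y (hI ▸ hkn) hv a
  | zero => simpa using Fil.zero I _
  | add a b _ _ ha hb => rw [map_add]; exact (ha hv).add (hb hv)
  | neg a _ ha =>
    intro j d hd
    simpa using ha hv j d hd
  | left_absorb a b _ hb =>
    rw [map_mul]
    exact Fil.pre I hI hk hkn (hb hv) a
  | right_absorb a b _ hb =>
    rw [map_mul]
    exact hb (Fil.pre I hI hk hkn hv a)

lemma Fil.arrow_pow (I : Finset (ZMod n)) {k : ℕ} (hI : I.card = k) (hk : 0 < k)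
    (hkn : k < n) (m : ℕ) {r : PreAlg k n} (hr : r ∈ arrowIdeal k n ^ m) {N : ℤ}
    {v : ZMod n → ℂ⟦X⟧} (hv : Fil I N v) : Fil I (N + m) (preAct I hI r v) := by
  induction m generalizing r N v with
  | zero => simpa using Fil.pre I hI hk hkn hv r
  | succ m ih =>
    rw [Ideal.IsTwoSided.pow_succ] at hr
    refine Submodule.mul_induction_on hr ?_ ?_
    · intro a ha b hb
      rw [map_mul]
      have := Fil.arrow I hI hk hkn ha (ih hb hv)
      rw [add_assoc] at this
      exact_mod_cast this
    · intro a b ha hb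
      rw [map_add]
      exact ha.add hb

/-- A bound for the absolute values of the weights. -/
def weightBound (I : Finset (ZMod n)) : ℕ := ∑ j, (weight I j).natAbs

/-- A power of the arrow ideal that does not contribute to the coefficients of degree `≤ d`. -/
def level (I : Finset (ZMod n)) (d : ℕ) : ℕ := n * n * d + 2 * weightBound I + 1

lemma coeff_preAct_eq_zero (I : Finset (ZMod n)) {k : ℕ} (hI : I.card = k) (hk : 0 < k)
    (hkn : k < n) (d m : ℕ) (hm : level I d ≤ m) {r : PreAlg k n} (hr : r ∈ arrowIdeal k n ^ m)
    (v : ZMod n → ℂ⟦X⟧) (j : ZMod n) : coeff d (preAct I hI r v j) = 0 := by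
  have hb : ∀ j, |weight I j| ≤ weightBound I := by
    intro j
    rw [Int.abs_eq_natAbs, weightBound]
    exact_mod_cast Finset.single_le_sum (f := fun j => (weight I j).natAbs)
      (fun _ _ => Nat.zero_le _) (Finset.mem_univ j)
  have h0 : Fil I (-(weightBound I : ℤ)) v := by
    intro i e he
    have := (abs_le.mp (hb i)).2
    have : (0 : ℤ) ≤ n * n * e := by positivity
    omega
  refine Fil.arrow_pow I hI hk hkn m hr h0 j d ?_
  have h1 := (abs_le.mp (hb j)).1
  have h2 : ((level I d : ℕ) : ℤ) ≤ m := by exact_mod_cast hm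
  rw [level] at h2
  push_cast at h2
  linarith

/-- The action of the completed algebra on `⨁_j ℂ⟦t⟧`: the coefficient of degree `d` is computed
with a representative modulo a large power of the arrow ideal. -/
def act (I : Finset (ZMod n)) {k : ℕ} (hI : I.card = k) (c : CAlg k n) (v : ZMod n → ℂ⟦X⟧) :
    ZMod n → ℂ⟦X⟧ :=
  fun j => PowerSeries.mk fun d => coeff d (preAct I hI (Quotient.out (c.1 (level I d))) v j)

lemma CAlg.compat {k : ℕ} (c : CAlg k n) {m m' : ℕ} (h : m ≤ m') :
    Ideal.Quotient.factor (Ideal.pow_le_pow_right h) (c.1 m') = c.1 m := by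
  induction m', h using Nat.le_induction with
  | base =>
    obtain ⟨r, hr⟩ := Ideal.Quotient.mk_surjective (c.1 m)
    rw [← hr]
    rfl
  | succ m' h ih =>
    rw [← ih, ← c.2 m']
    obtain ⟨r, hr⟩ := Ideal.Quotient.mk_surjective (c.1 (m' + 1))
    rw [← hr]
    rfl

lemma coeff_act (I : Finset (ZMod n)) {k : ℕ} (hI : I.card = k) (hk : 0 < k) (hkn : k < n)
    (c : CAlg k n) (v : ZMod n → ℂ⟦X⟧) (j : ZMod n) (d m : ℕ) (hm : level I d ≤ m)
    (r : PreAlg k n) (hr : Ideal.Quotient.mk (arrowIdeal k n ^ m) r = c.1 m) :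
    coeff d (act I hI c v j) = coeff d (preAct I hI r v j) := by
  rw [act, coeff_mk, ← sub_eq_zero]
  have h1 : Ideal.Quotient.mk (arrowIdeal k n ^ level I d) (Quotient.out (c.1 (level I d)))
      = c.1 (level I d) := Quotient.out_eq _
  have h2 : Ideal.Quotient.mk (arrowIdeal k n ^ level I d) r = c.1 (level I d) := by
    rw [← CAlg.compat c hm, ← hr]
    rfl
  have h3 := coeff_preAct_eq_zero I hI hk hkn d _ le_rfl
    (Ideal.Quotient.eq.mp (h1.trans h2.symm)) v j
  simpa using h3

lemma level_mono (I : Finset (ZMod n)) {d d' : ℕ} (h : d ≤ d') : level I d ≤ level I d' := by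
  unfold level
  gcongr

lemma coeff_preAct_congr (I : Finset (ZMod n)) {k : ℕ} (hI : I.card = k) (r : PreAlg k n)
    (d : ℕ) (v w : ZMod n → ℂ⟦X⟧) (h : ∀ i, ∀ e ≤ d, coeff e (v i) = coeff e (w i))
    (j : ZMod n) : coeff d (preAct I hI r v j) = coeff d (preAct I hI r w j) := by
  have h1 : ∀ i, ∃ u, v i - w i = (X : ℂ⟦X⟧) ^ (d + 1) * u := by
    intro i
    refine X_pow_dvd_iff.mpr fun e he => ?_
    rw [map_sub, h i e (by omega), sub_self]
  choose u hu using h1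
  have h2 : v - w = (X : ℂ⟦X⟧) ^ (d + 1) • u := funext hu
  rw [← sub_eq_zero, ← map_sub, ← Pi.sub_apply, ← map_sub, h2, map_smul, Pi.smul_apply,
    smul_eq_mul, coeff_X_pow_mul', if_neg (by omega)]

/-- The underlying space `⨁_j V_j`, `V_j = ℂ⟦t⟧`, of the module `M_I` for a `k`-subset `I`. -/
def RankOne (k : ℕ) (I : Finset (ZMod n)) (_ : I.card = k) (_ : 0 < k ∧ k < n) : Type :=
  ZMod n → ℂ⟦X⟧

variable {k : ℕ} {I : Finset (ZMod n)} {hI : I.card = k} {hk : 0 < k ∧ k < n}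

instance : AddCommGroup (RankOne k I hI hk) :=
  inferInstanceAs (AddCommGroup (ZMod n → ℂ⟦X⟧))

/-- The `C_{k,n}`-module structure of `M_I`. -/
instance : Module (CAlg k n) (RankOne k I hI hk) where
  smul c v := act I hI c v
  one_smul v := funext fun j => PowerSeries.ext fun d => by
    refine (coeff_act I hI hk.1 hk.2 1 v j d _ le_rfl 1 rfl).trans ?_
    rw [map_one]; rfl
  mul_smul c c' v := funext fun j => PowerSeries.ext fun d => by
    obtain ⟨r, hr⟩ := Ideal.Quotient.mk_surjective (c.1 (level I d))
    obtain ⟨r', hr'⟩ := Ideal.Quotient.mk_surjective (c'.1 (level I d))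
    refine (coeff_act I hI hk.1 hk.2 (c * c') v j d _ le_rfl (r * r') ?_).trans ?_
    · rw [map_mul, hr, hr']; rfl
    refine Eq.trans ?_ (coeff_act I hI hk.1 hk.2 c (act I hI c' v) j d _ le_rfl r hr).symm
    rw [map_mul]
    refine coeff_preAct_congr I hI r d _ _ (fun i e he => ?_) j
    exact (coeff_act I hI hk.1 hk.2 c' v i e _ (level_mono I he) r' hr').symm
  smul_zero c := funext fun j => PowerSeries.ext fun d => by
    obtain ⟨r, hr⟩ := Ideal.Quotient.mk_surjective (c.1 (level I d))
    refine (coeff_act I hI hk.1 hk.2 c 0 j d _ le_rfl r hr).trans ?_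
    rw [map_zero]; rfl
  smul_add c v w := funext fun j => PowerSeries.ext fun d => by
    obtain ⟨r, hr⟩ := Ideal.Quotient.mk_surjective (c.1 (level I d))
    refine (coeff_act I hI hk.1 hk.2 c (v + w) j d _ le_rfl r hr).trans ?_
    refine Eq.trans ?_ (map_add (coeff d) (act I hI c v j) (act I hI c w j)).symm
    rw [coeff_act I hI hk.1 hk.2 c v j d _ le_rfl r hr,
      coeff_act I hI hk.1 hk.2 c w j d _ le_rfl r hr, ← map_add]
    exact congrArg (fun u : ZMod n → ℂ⟦X⟧ => coeff d (u j)) (map_add (preAct I hI r) v w)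
  add_smul c c' v := funext fun j => PowerSeries.ext fun d => by
    obtain ⟨r, hr⟩ := Ideal.Quotient.mk_surjective (c.1 (level I d))
    obtain ⟨r', hr'⟩ := Ideal.Quotient.mk_surjective (c'.1 (level I d))
    refine (coeff_act I hI hk.1 hk.2 (c + c') v j d _ le_rfl (r + r') ?_).trans ?_
    · rw [map_add, hr, hr']; rfl
    refine Eq.trans ?_ (map_add (coeff d) (act I hI c v j) (act I hI c' v j)).symm
    rw [coeff_act I hI hk.1 hk.2 c v j d _ le_rfl r hr,
      coeff_act I hI hk.1 hk.2 c' v j d _ le_rfl r' hr', ← map_add, map_add (preAct I hI)]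
    rfl
  zero_smul v := funext fun j => PowerSeries.ext fun d => by
    refine (coeff_act I hI hk.1 hk.2 0 v j d _ le_rfl 0 rfl).trans ?_
    rw [map_zero]; rfl

end RankOne

/-- The image of an element of the uncompleted algebra in `C_{k,n}`. -/
def toCAlg (k n : ℕ) [NeZero n] (r : PreAlg k n) : CAlg k n :=
  ⟨fun m => Ideal.Quotient.mk (arrowIdeal k n ^ m) r, fun _ => rfl⟩

/-- On elements of the uncompleted algebra the action on `M_I` is the one prescribed on the
generators. -/
lemma toCAlg_smul {k n : ℕ} [NeZero n] {I : Finset (ZMod n)} {hI : I.card = k}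
    {hk : 0 < k ∧ k < n} (r : PreAlg k n) (v : RankOne k I hI hk) :
    toCAlg k n r • v = (preAct I hI r v : ZMod n → ℂ⟦X⟧) :=
  funext fun j => PowerSeries.ext fun d =>
    coeff_act I hI hk.1 hk.2 (toCAlg k n r) v j d _ le_rfl r rfl

/-- The `C_{k,n}`-module `M_I`, for a `k`-subset `I` of `ZMod n`. -/
def rankOne (k n : ℕ) [NeZero n] (hk : 0 < k ∧ k < n) (I : Finset (ZMod n)) (hI : I.card = k) :
    ModuleCat.{0} (CAlg k n) :=
  ModuleCat.of (CAlg k n) (RankOne k I hI hk)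

end GrassmannianCluster

/-! ### Auslander–Reiten theory of an extension-closed subcategory

Below `P` is a property of objects of a `𝕜`-linear abelian category `A`, regarded as the full
subcategory of the objects satisfying it, with the conflations (admissible exact sequences) of
`IsConflation`. -/

namespace ARTheory

universe u v w

section

variable {A : Type u} [Category.{v} A] [Abelian A] (P : ObjectProperty A)

/-- The conflations of `P`: short exact sequences with all three terms in `P`. -/
def IsConflation (S : ShortComplex A) : Prop :=
  S.ShortExact ∧ P S.X₁ ∧ P S.X₂ ∧ P S.X₃

/-- Inflations: first maps of conflations. -/
def IsInflation {X Y : A} (f : X ⟶ Y) : Prop :=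
  ∃ (Z : A) (g : Y ⟶ Z) (h : f ≫ g = 0), IsConflation P (ShortComplex.mk f g h)

/-- Deflations: second maps of conflations. -/
def IsDeflation {Y Z : A} (g : Y ⟶ Z) : Prop :=
  ∃ (X : A) (f : X ⟶ Y) (h : f ≫ g = 0), IsConflation P (ShortComplex.mk f g h)

/-- The projective objects of the exact category `P`. -/
def projectives : ObjectProperty A := fun X =>
  P X ∧ ∀ ⦃Y Z : A⦄ (p : Y ⟶ Z), IsDeflation P p → ∀ f : X ⟶ Z, ∃ g : X ⟶ Y, g ≫ p = f

/-- The injective objects of the exact category `P`. -/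
def injectives : ObjectProperty A := fun X =>
  P X ∧ ∀ ⦃Y Z : A⦄ (i : Y ⟶ Z), IsInflation P i → ∀ f : Y ⟶ X, ∃ g : Z ⟶ X, i ≫ g = f

/-- The indecomposable objects of `P`. -/
def indecomposables : ObjectProperty A := fun X =>
  P X ∧ ¬ IsZero X ∧ ∀ Y Z : A, P Y → P Z → (X ≅ Y ⊞ Z) → IsZero Y ∨ IsZero Z

/-- Isomorphism classes of the objects satisfying `P`. -/
def IsoClasses : Type u := Quotient (isIsomorphicSetoid P.FullSubcategory)

/-- Irreducible morphisms of `P`: neither split mono nor split epi, and in every factorization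
through an object of `P` the first factor is split mono or the second is split epi. -/
def IsIrreducible {X Y : A} (f : X ⟶ Y) : Prop :=
  P X ∧ P Y ∧ ¬ IsSplitMono f ∧ ¬ IsSplitEpi f ∧
    ∀ (W : A) (g : X ⟶ W) (h : W ⟶ Y), P W → g ≫ h = f → IsSplitMono g ∨ IsSplitEpi h

/-- Auslander–Reiten sequences in `P`: non-split conflations with indecomposable end terms whose
first map is left almost split and whose second map is right almost split. -/
structure IsARSequence (S : ShortComplex A) : Prop where
  conflation : IsConflation P S
  indec_left : indecomposables P S.X₁
  indec_right : indecomposables P S.X₃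
  not_split : IsEmpty S.Splitting
  left_almost_split : ∀ (W : A) (h : S.X₁ ⟶ W), P W → ¬ IsSplitMono h → ∃ h' : S.X₂ ⟶ W, S.f ≫ h' = h
  right_almost_split : ∀ (W : A) (h : W ⟶ S.X₃), P W → ¬ IsSplitEpi h → ∃ h' : W ⟶ S.X₂, h' ≫ S.g = h

attribute [local instance] Abelian.hasFiniteBiproducts

/-- The objects of `add M`: direct summands of finite direct sums of copies of `M`. -/
def addClosure (M : A) : ObjectProperty A := fun X =>
  ∃ m : ℕ, Nonempty (Retract X (⨁ fun _ : Fin m => M))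

/-- `M^{⊥₁}`, formed in the full subcategory `P`: the objects `Y` of `P` with `Ext¹(X, Y) = 0` for
all `X` in `add M`. (When `P` is closed under extensions, `Ext¹` of the exact category `P` is `Ext¹`
of the ambient abelian category.) -/
def rightPerp [HasExt.{w} A] (M : A) : ObjectProperty A := fun Y =>
  P Y ∧ ∀ X : A, addClosure M X → Subsingleton (Abelian.Ext.{w} X Y 1)

end

section

variable (𝕜 : Type w) [Field 𝕜] {A : Type u} [Category.{v} A] [Abelian A] [Linear 𝕜 A]
  (P : ObjectProperty A)

/-- The Jacobson radical `rad(X, Y)` of a linear category. -/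
def radical (X Y : A) : Submodule 𝕜 (X ⟶ Y) where
  carrier := {f | ∀ g : Y ⟶ X, IsIso (𝟙 X - f ≫ g)}
  zero_mem' g := by
    rw [zero_comp, sub_zero]; infer_instance
  add_mem' {f f'} hf hf' g := by
    have := hf g
    have := hf' (g ≫ inv (𝟙 X - f ≫ g))
    have h : 𝟙 X - (f + f') ≫ g =
        (𝟙 X - f' ≫ g ≫ inv (𝟙 X - f ≫ g)) ≫ (𝟙 X - f ≫ g) := by
      rw [Preadditive.sub_comp, Category.assoc, Category.assoc, IsIso.inv_hom_id,
        Category.comp_id, Category.id_comp, Preadditive.add_comp]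
      abel
    rw [h]
    infer_instance
  smul_mem' c f hf g := by
    rw [Linear.smul_comp, ← Linear.comp_smul]
    exact hf _

/-- The square of the radical of the full subcategory `P`: sums of composites of two radical
morphisms through objects of `P`. -/
def radicalSq (X Y : A) : Submodule 𝕜 (X ⟶ Y) :=
  Submodule.span 𝕜 {h | ∃ (W : A) (f : X ⟶ W) (g : W ⟶ Y),
    P W ∧ f ∈ radical 𝕜 X W ∧ g ∈ radical 𝕜 W Y ∧ f ≫ g = h}

/-- The space `Irr(X, Y) = rad(X, Y) / rad²(X, Y)` of irreducible maps in `P`. -/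
abbrev Irr (X Y : A) : Type v :=
  radical 𝕜 X Y ⧸ (radicalSq 𝕜 P X Y).submoduleOf (radical 𝕜 X Y)

/-- The quiver `V`, with the relation `τ` (`τ i j` meaning that `j` is the translate of `i`), is the
Auslander–Reiten quiver of `P`, the vertex `i` being the isomorphism class of `rep i`: the `rep i`
represent each isomorphism class of indecomposables exactly once, the number of arrows from `i` to
`j` is the dimension of the space of irreducible maps, and the translate of `i` is `j` if and only if
there is an Auslander–Reiten sequence in `P` that starts in `rep j` and ends in `rep i`. -/
structure IsARQuiver (V : Type*) [Quiver V] (τ : V → V → Prop) (rep : V → A) : Prop where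
  indec : ∀ i, indecomposables P (rep i)
  complete : ∀ X, indecomposables P X → ∃! i, Nonempty (X ≅ rep i)
  arrows : ∀ i j, Nonempty (Module.Basis (i ⟶ j) 𝕜 (Irr 𝕜 P (rep i) (rep j)))
  translate : ∀ i j, τ i j ↔
    ∃ S : ShortComplex A, IsARSequence P S ∧ Nonempty (S.X₁ ≅ rep j) ∧ Nonempty (S.X₃ ≅ rep i)

end

end ARTheory

namespace GrassmannianCluster

open ARTheory

/-- The category `𝒞_{k,n} = CM(C_{k,n})` of maximal Cohen–Macaulay modules: the `C_{k,n}`-modules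
that are free of finite rank over the centre `Z` of `C_{k,n}`. -/
def CM (k n : ℕ) [NeZero n] : ObjectProperty (ModuleCat.{0} (CAlg k n)) := fun M =>
  Module.Finite (Subalgebra.center ℂ (CAlg k n)) M ∧
    Module.Free (Subalgebra.center ℂ (CAlg k n)) M

/-- The module `M_{ij}` over `C_{2,6}`, for `i ≠ j` in `{1, …, 6} = ZMod 6`. -/
def M26 (i j : ZMod 6) (h : i ≠ j) : ModuleCat.{0} (CAlg 2 6) :=
  rankOne 2 6 ⟨by decide, by decide⟩ {i, j} (Finset.card_pair h)

/-- The reduction `M_{14}^{⊥₁} ⊆ 𝒞_{2,6}`. -/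
def M14Perp : ObjectProperty (ModuleCat.{0} (CAlg 2 6)) :=
  rightPerp (CM 2 6) (M26 1 4 (by decide))

/-! ### The quiver `Γ` -/

/-- The vertices of the quiver `Γ`. -/
inductive Vertex : Type
  | m12 | m13 | m14 | m15 | m16 | m23 | m24 | m34 | m45 | m46 | m56

open Vertex

/-- The arrows of the quiver `Γ`. -/
inductive Arrow : Vertex → Vertex → Type
  | a15_56 : Arrow m15 m56
  | a15_14 : Arrow m15 m14
  | a24_14 : Arrow m24 m14
  | a24_23 : Arrow m24 m23
  | a56_46 : Arrow m56 m46
  | a14_46 : Arrow m14 m46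
  | a14_13 : Arrow m14 m13
  | a23_13 : Arrow m23 m13
  | a46_16 : Arrow m46 m16
  | a46_45 : Arrow m46 m45
  | a13_12 : Arrow m13 m12
  | a13_34 : Arrow m13 m34
  | a16_15 : Arrow m16 m15
  | a45_15 : Arrow m45 m15
  | a12_24 : Arrow m12 m24
  | a34_24 : Arrow m34 m24
  | a45_34 : Arrow m45 m34
  | a12_16 : Arrow m12 m16

instance : Quiver Vertex := ⟨Arrow⟩

/-- The Auslander–Reiten translation of the quiver `Γ`. -/
inductive Translate : Vertex → Vertex → Prop
  | t46 : Translate m46 m15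
  | t15 : Translate m15 m46
  | t13 : Translate m13 m24
  | t24 : Translate m24 m13

/-- The boxed vertices of the quiver `Γ`. -/
inductive Boxed : Vertex → Prop
  | b12 : Boxed m12
  | b14 : Boxed m14
  | b16 : Boxed m16
  | b23 : Boxed m23
  | b34 : Boxed m34
  | b45 : Boxed m45
  | b56 : Boxed m56

/-- The module attached to a vertex of the quiver `Γ`. -/
def Vertex.module : Vertex → ModuleCat.{0} (CAlg 2 6)
  | m12 => M26 1 2 (by decide)
  | m13 => M26 1 3 (by decide)
  | m14 => M26 1 4 (by decide)
  | m15 => M26 1 5 (by decide)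
  | m16 => M26 1 6 (by decide)
  | m23 => M26 2 3 (by decide)
  | m24 => M26 2 4 (by decide)
  | m34 => M26 3 4 (by decide)
  | m45 => M26 4 5 (by decide)
  | m46 => M26 4 6 (by decide)
  | m56 => M26 5 6 (by decide)

end GrassmannianCluster

end

/-!
The proof makes everything explicit through the power series ring `ℂ⟦t⟧`, `t = xy`. Every path
from `i` to `j` is a power of `t` times the shortest one, so that `C_{2,6}` is generated by
`ℂ⟦t⟧`, the idempotents, `x` and `y`, its centre is `ℂ⟦t⟧` (`exists_ofPowerSeries_eq`), and a
module is maximal Cohen–Macaulay if and only if it is finite and torsion-free over `ℂ⟦t⟧`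
(`CM_iff`).

*Homomorphisms.* `Hom(M_I, M_J)` is free of rank one over `ℂ⟦t⟧`, generated by the minimal
homomorphism `minHom I J 1`, and the composite of the minimal homomorphisms `M_I → M_J → M_K` is
`t ^ defect I J K` times the minimal one (`minHom_surjective`, `minHom_comp`). In particular
`End(M_I) = ℂ⟦t⟧` is local. Questions about homomorphisms between the `M_I` thereby become finite
questions about exponents, which are decided by evaluation.

*Objects.* Let `M` be a nonzero maximal Cohen–Macaulay module and `k` the largest exponent for which
`x ^ k` does not map `M` to `tM`. Then `2 ≤ k ≤ 4`, because `x ^ 6 = t ^ 2` and `x ^ 5 = ty`. A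
vector `u` at a vertex `i` with `x ^ k u` outside `tM` generates a copy of `M_{i,i+k+1}`, and a
functional that is `1` on `x ^ k u` yields a projection onto it (`exists_retract_rankOneModule`).
Hence every maximal Cohen–Macaulay module is a direct sum of modules `M_I`. The modules
`M_{i-1,i} = C e_i` are projective, so `Ext¹(M_I, M_J)` can be computed from the presentation
`0 → M_{i-1,j-1} → M_{i-1,i} ⊕ M_{j-1,j} → M_{ij} → 0`; it vanishes for all pairs of vertices other
than the four with `I` and `J` crossing (`subsingleton_ext_of_not_translate`). The four subsets
that cross `{1, 4}` admit non-split extensions of `M_{14}`, which leaves eleven modules in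
`M_{14}^{⊥₁}`. Every object being a finite direct sum of these, statements that are additive in an
object need to be checked for the eleven modules only (`M14Perp_induction`).

*Irreducible maps.* The homomorphism `p` times the minimal one is in the radical if and only if
`I ≠ J` or `t` divides `p` (`minHom_mem_radical_iff`). If there is an arrow `I → J`, then all
composites of two radical homomorphisms are divisible by `t`; otherwise every radical homomorphism
is such a composite through one of the eleven modules. This determines the spaces of irreducible
maps (`nonempty_basis_irr`).

*Auslander–Reiten sequences.* The four sequences are given by exact squares of minimal
homomorphisms; that radical homomorphisms lift or extend along them is again a comparison of
exponents (`isARSequence_squareComplex`). A short exact sequence between other end terms splits,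
since `Ext¹` vanishes. The vertices without translate have no extensions in either direction with
any object, so that they are projective and injective; the ends of an Auslander–Reiten sequence are
not.
-/

namespace GrassmannianCluster

noncomputable section

/-! ### The structure of the algebra `C_{2,6}` -/

/-- The quotient map from the free algebra to the uncompleted algebra. -/
abbrev preMk : FreeAlgebra ℂ (Gen 6) →ₐ[ℂ] PreAlg 2 6 := RingQuot.mkAlgHom ℂ (Rel 2 6)

/-- The trivial path at `j`. -/
def preE (j : ZMod 6) : PreAlg 2 6 := preMk (fe j)

/-- The sum of the clockwise arrows. -/
def preX : PreAlg 2 6 := preMk (∑ a, fx a)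

/-- The sum of the anticlockwise arrows. -/
def preY : PreAlg 2 6 := preMk (∑ a, fy a)

/-- The central element `t = xy`. -/
def preT : PreAlg 2 6 := preX * preY

lemma preMk_rel {r s : FreeAlgebra ℂ (Gen 6)} (h : Rel 2 6 r s) : preMk r = preMk s :=
  RingQuot.mkAlgHom_rel ℂ h

lemma preE_mul_self (j : ZMod 6) : preE j * preE j = preE j := by
  rw [preE, ← map_mul]; exact preMk_rel (.idem j)

lemma preE_mul_of_ne {i j : ZMod 6} (h : i ≠ j) : preE i * preE j = 0 := by
  rw [preE, preE, ← map_mul, preMk_rel (.orth i j h), map_zero]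

lemma sum_preE : ∑ j, preE j = 1 := by
  rw [← map_one preMk, ← preMk_rel .unit, map_sum]; rfl

lemma preMk_fx_mul (a : ZMod 6) : preMk (fx a) * preE (a - 1) = preMk (fx a) := by
  rw [preE, ← map_mul, preMk_rel (.x_source a)]

lemma preE_mul_fx (a : ZMod 6) : preE a * preMk (fx a) = preMk (fx a) := by
  rw [preE, ← map_mul, preMk_rel (.x_target a)]

lemma preMk_fy_mul (a : ZMod 6) : preMk (fy a) * preE a = preMk (fy a) := by
  rw [preE, ← map_mul, preMk_rel (.y_source a)]

lemma preE_mul_fy (a : ZMod 6) : preE (a - 1) * preMk (fy a) = preMk (fy a) := by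
  rw [preE, ← map_mul, preMk_rel (.y_target a)]

lemma preE_mul_preX (a : ZMod 6) : preE a * preX = preMk (fx a) := by
  rw [preX, map_sum, Finset.mul_sum, Finset.sum_eq_single a]
  · exact preE_mul_fx a
  · intro b _ hb
    rw [← preE_mul_fx b, ← mul_assoc, preE_mul_of_ne hb.symm, zero_mul]
  · simp

lemma preX_mul_preE (a : ZMod 6) : preX * preE a = preE (a + 1) * preX := by
  rw [preE_mul_preX, preX, map_sum, Finset.sum_mul, Finset.sum_eq_single (a + 1)]
  · simpa using preMk_fx_mul (a + 1)
  · intro b _ hb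
    rw [← preMk_fx_mul b, mul_assoc, preE_mul_of_ne, mul_zero]
    rintro rfl
    simp at hb
  · simp

lemma preE_mul_preY (a : ZMod 6) : preE a * preY = preMk (fy (a + 1)) := by
  rw [preY, map_sum, Finset.mul_sum, Finset.sum_eq_single (a + 1)]
  · simpa using preE_mul_fy (a + 1)
  · intro b _ hb
    rw [← preE_mul_fy b, ← mul_assoc, preE_mul_of_ne, zero_mul]
    rintro rfl
    simp at hb
  · simp

lemma preY_mul_preE (a : ZMod 6) : preY * preE a = preE (a - 1) * preY := by
  rw [preE_mul_preY, preY, map_sum, Finset.sum_mul, Finset.sum_eq_single a]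
  · simpa using preMk_fy_mul a
  · intro b _ hb
    rw [← preMk_fy_mul b, mul_assoc, preE_mul_of_ne hb, mul_zero]
  · simp

lemma preX_mul_preY : preX * preY = preY * preX := by
  rw [← mul_one (preX * preY), ← mul_one (preY * preX), ← sum_preE, Finset.mul_sum,
    Finset.mul_sum]
  refine Finset.sum_congr rfl fun j _ => ?_
  simp only [preX, preY, preE, ← map_mul]
  exact preMk_rel (.comm j)

lemma preY_sq : preY ^ 2 = preX ^ 4 := by
  rw [← mul_one (preY ^ 2), ← mul_one (preX ^ 4), ← sum_preE, Finset.mul_sum, Finset.mul_sum]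
  refine Finset.sum_congr rfl fun j _ => ?_
  simp only [preX, preY, preE, ← map_mul, ← map_pow]
  exact preMk_rel (.pow j)

lemma preX_pow_five : preX ^ 5 = preT * preY := by
  rw [pow_succ', ← preY_sq, preT, sq, mul_assoc]

lemma commute_preX_preY : Commute preX preY := preX_mul_preY

/-- The element `t = xy` is central in the uncompleted algebra. -/
lemma commute_preT (r : PreAlg 2 6) : Commute preT r := by
  have hE : ∀ j, Commute preT (preE j) := fun j => by
    change preX * preY * preE j = preE j * (preX * preY)
    rw [mul_assoc, preY_mul_preE, ← mul_assoc, preX_mul_preE, sub_add_cancel, mul_assoc]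
  have hX : Commute preT preX := (Commute.refl preX).mul_left commute_preX_preY.symm
  have hY : Commute preT preY := commute_preX_preY.mul_left (Commute.refl preY)
  obtain ⟨s, rfl⟩ := RingQuot.mkAlgHom_surjective ℂ (Rel 2 6) r
  induction s using FreeAlgebra.induction with
  | grade0 z => rw [AlgHom.commutes]; exact (Algebra.commutes z preT).symm
  | grade1 g =>
    cases g with
    | e j => exact hE j
    | x a =>
      have h := (hE a).mul_right hX
      rwa [preE_mul_preX] at h
    | y a =>
      have h := (hE (a - 1)).mul_right hY
      rwa [preE_mul_preY, sub_add_cancel] at h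
  | mul a b ha hb => rw [map_mul]; exact ha.mul_right hb
  | add a b ha hb => rw [map_add]; exact ha.add_right hb

/-- Evaluation of polynomials at `t`. -/
abbrev preAeval : Polynomial ℂ →ₐ[ℂ] PreAlg 2 6 := Polynomial.aeval preT

lemma commute_preAeval (q : Polynomial ℂ) (r : PreAlg 2 6) : Commute (preAeval q) r := by
  induction q using Polynomial.induction_on' with
  | add p q hp hq => rw [map_add]; exact hp.add_left hq
  | monomial n a =>
    rw [Polynomial.aeval_monomial]
    exact Commute.mul_left (Algebra.commutes a r) ((commute_preT r).pow_left n)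

/-- The shortest path of length `c` modulo `6`, summed over all starting vertices: `x ^ c` for
`c ≤ 4`, and `y` for `c = 5`. -/
def preW (c : ZMod 6) : PreAlg 2 6 := if c = 5 then preY else preX ^ c.val

lemma preX_pow_mul_preE (m : ℕ) (a : ZMod 6) : preX ^ m * preE a = preE (a + m) * preX ^ m := by
  induction m with
  | zero => simp
  | succ m ih =>
    rw [pow_succ', mul_assoc, ih, ← mul_assoc, preX_mul_preE, mul_assoc]
    push_cast
    rw [add_assoc]

lemma preW_mul_preE (c a : ZMod 6) : preW c * preE a = preE (a + c) * preW c := by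
  unfold preW
  split_ifs with h
  · subst h
    rw [preY_mul_preE]
    congr 2
    revert a; decide
  · rw [preX_pow_mul_preE, ZMod.natCast_zmod_val]

lemma preX_mul_preW (c : ZMod 6) :
    preX * preW c = if c = 4 ∨ c = 5 then preT * preW (c + 1) else preW (c + 1) := by
  fin_cases c
  · change preX * preX ^ 0 = preX ^ 1; simp
  · change preX * preX ^ 1 = preX ^ 2; simp [sq]
  · exact (pow_succ' preX 2).symm
  · exact (pow_succ' preX 3).symm
  · exact (pow_succ' preX 4).symm.trans preX_pow_five
  · change preX * preY = preT * preX ^ 0; simp [preT]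

lemma preY_mul_preW (c : ZMod 6) :
    preY * preW c = if c = 5 ∨ c = 0 then preW (c - 1) else preT * preW (c - 1) := by
  have h : ∀ m : ℕ, preY * preX ^ (m + 1) = preT * preX ^ m := fun m => by
    rw [pow_succ', ← mul_assoc, ← preX_mul_preY, preT]
  fin_cases c
  · change preY * preX ^ 0 = preY; simp
  · exact h 0
  · exact h 1
  · exact h 2
  · exact h 3
  · exact (sq preY).symm.trans preY_sq

/-- Over `ℂ`, the uncompleted algebra is spanned by the products of powers of `t` with shortest
paths. -/
lemma mem_span_paths (r : PreAlg 2 6) :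
    r ∈ Submodule.span ℂ
      (Set.range fun i : ℕ × ZMod 6 × ZMod 6 => preT ^ i.1 * (preE i.2.1 * preW i.2.2)) := by
  set S := Submodule.span ℂ
    (Set.range fun i : ℕ × ZMod 6 × ZMod 6 => preT ^ i.1 * (preE i.2.1 * preW i.2.2)) with hS
  have hgen : ∀ m j c, preT ^ m * (preE j * preW c) ∈ S := fun m j c =>
    Submodule.subset_span ⟨(m, j, c), rfl⟩
  have hstep : ∀ u : PreAlg 2 6, (∀ m j c, u * (preT ^ m * (preE j * preW c)) ∈ S) →
      ∀ s ∈ S, u * s ∈ S := fun u hu s hs => by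
    induction hs using Submodule.span_induction with
    | mem s hs => obtain ⟨i, rfl⟩ := hs; exact hu _ _ _
    | zero => simp
    | add a b _ _ ha hb => rw [mul_add]; exact S.add_mem ha hb
    | smul z a _ ha => rw [mul_smul_comm]; exact S.smul_mem z ha
  have hE : ∀ i, ∀ s ∈ S, preE i * s ∈ S := fun i => hstep _ fun m j c => by
    rw [← mul_assoc, ← ((commute_preT (preE i)).pow_left m).eq, mul_assoc, ← mul_assoc (preE i)]
    by_cases h : i = j
    · rw [h, preE_mul_self]; exact hgen _ _ _
    · rw [preE_mul_of_ne h]; simp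
  have hX : ∀ s ∈ S, preX * s ∈ S := hstep _ fun m j c => by
    rw [← mul_assoc, ← ((commute_preT preX).pow_left m).eq, mul_assoc, ← mul_assoc preX,
      preX_mul_preE, mul_assoc]
    rw [preX_mul_preW]
    split_ifs
    · rw [← mul_assoc (preE _), ← (commute_preT _).eq, mul_assoc, ← mul_assoc, ← pow_succ]
      exact hgen _ _ _
    · exact hgen _ _ _
  have hY : ∀ s ∈ S, preY * s ∈ S := hstep _ fun m j c => by
    rw [← mul_assoc, ← ((commute_preT preY).pow_left m).eq, mul_assoc, ← mul_assoc preY,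
      preY_mul_preE, mul_assoc]
    rw [preY_mul_preW]
    split_ifs
    · exact hgen _ _ _
    · rw [← mul_assoc (preE _), ← (commute_preT _).eq, mul_assoc, ← mul_assoc, ← pow_succ]
      exact hgen _ _ _
  have hmul : ∀ s ∈ S, r * s ∈ S := by
    obtain ⟨f, rfl⟩ := RingQuot.mkAlgHom_surjective ℂ (Rel 2 6) r
    induction f using FreeAlgebra.induction with
    | grade0 z =>
      intro s hs
      rw [AlgHom.commutes, ← Algebra.smul_def]
      exact S.smul_mem z hs
    | grade1 g =>
      intro s hs
      cases g with
      | e j => exact hE j s hs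
      | x a =>
        have h := hE a _ (hX s hs)
        rwa [← mul_assoc, preE_mul_preX] at h
      | y a =>
        have h := hE (a - 1) _ (hY s hs)
        rwa [← mul_assoc, preE_mul_preY, sub_add_cancel] at h
    | mul a b ha hb => intro s hs; rw [map_mul, mul_assoc]; exact ha _ (hb _ hs)
    | add a b ha hb => intro s hs; rw [map_add, add_mul]; exact S.add_mem (ha _ hs) (hb _ hs)
  have h1 : (1 : PreAlg 2 6) ∈ S := by
    rw [← sum_preE]
    refine S.sum_mem fun j _ => ?_
    have := hgen 0 j 0
    have h0 : preW 0 = 1 := pow_zero preX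
    rwa [pow_zero, one_mul, h0, mul_one] at this
  simpa using hmul 1 h1

/-- Every path from `i` to `j` is a polynomial in `t` times the shortest one. -/
lemma exists_preE_mul_mul_preE (r : PreAlg 2 6) (i j : ZMod 6) :
    ∃ q : Polynomial ℂ, preE j * r * preE i = preAeval q * (preE j * preW (j - i)) := by
  induction mem_span_paths r using Submodule.span_induction with
  | mem s hs =>
    obtain ⟨⟨m, l, c⟩, rfl⟩ := hs
    dsimp only
    have h1 : preE j * (preT ^ m * (preE l * preW c)) * preE i =
        preT ^ m * (preE j * preE l * preE (i + c) * preW c) := by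
      rw [← mul_assoc (preE j), ← ((commute_preT (preE j)).pow_left m).eq]
      simp only [mul_assoc]
      rw [preW_mul_preE]
    rw [h1]
    by_cases h : j = l ∧ l = i + c
    · obtain ⟨rfl, rfl⟩ := h
      refine ⟨Polynomial.X ^ m, ?_⟩
      rw [preE_mul_self, preE_mul_self, map_pow, Polynomial.aeval_X, add_sub_cancel_left]
    · refine ⟨0, ?_⟩
      by_cases h2 : j = l
      · rw [mul_assoc (preE j), preE_mul_of_ne fun h3 => h ⟨h2, h3⟩]; simp
      · rw [preE_mul_of_ne h2]; simp
  | zero => exact ⟨0, by simp⟩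
  | add a b _ _ ha hb =>
    obtain ⟨p, hp⟩ := ha
    obtain ⟨q, hq⟩ := hb
    exact ⟨p + q, by rw [mul_add, add_mul, hp, hq, map_add, add_mul]⟩
  | smul z a _ ha =>
    obtain ⟨p, hp⟩ := ha
    exact ⟨z • p, by rw [mul_smul_comm, smul_mul_assoc, hp, map_smul, smul_mul_assoc]⟩

lemma preX_mem_arrowIdeal : preX ∈ arrowIdeal 2 6 := by
  rw [preX, map_sum]
  refine Ideal.sum_mem _ fun a _ => ?_
  rw [arrowIdeal, TwoSidedIdeal.mem_asIdeal]
  exact TwoSidedIdeal.subset_span (Or.inl ⟨a, rfl⟩)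

lemma preT_mem_arrowIdeal : preT ∈ arrowIdeal 2 6 := by
  rw [preT, preX_mul_preY]
  exact Ideal.mul_mem_left _ _ preX_mem_arrowIdeal

lemma preAeval_mem_arrowIdeal_pow {m : ℕ} {f : Polynomial ℂ} (h : ∀ d < m, f.coeff d = 0) :
    preAeval f ∈ arrowIdeal 2 6 ^ m := by
  obtain ⟨g, rfl⟩ := Polynomial.X_pow_dvd_iff.mpr h
  rw [mul_comm, map_mul, map_pow, Polynomial.aeval_X]
  exact Ideal.mul_mem_left _ _ (Ideal.pow_mem_pow preT_mem_arrowIdeal m)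

lemma mk_preAeval_congr {m : ℕ} {f g : Polynomial ℂ} (h : ∀ d < m, f.coeff d = g.coeff d) :
    Ideal.Quotient.mk (arrowIdeal 2 6 ^ m) (preAeval f) =
      Ideal.Quotient.mk (arrowIdeal 2 6 ^ m) (preAeval g) := by
  rw [Ideal.Quotient.eq, ← map_sub]
  exact preAeval_mem_arrowIdeal_pow fun d hd => by rw [Polynomial.coeff_sub, h d hd, sub_self]

/-- A power series in `t`, as an element of `C_{2,6}`. -/
def powerSeriesFun (p : ℂ⟦X⟧) : CAlg 2 6 :=
  ⟨fun m => Ideal.Quotient.mk (arrowIdeal 2 6 ^ m) (preAeval (trunc m p)), fun m => by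
    change Ideal.Quotient.mk (arrowIdeal 2 6 ^ m) (preAeval (trunc (m + 1) p)) = _
    refine mk_preAeval_congr fun d hd => ?_
    rw [coeff_trunc, coeff_trunc, if_pos (by omega), if_pos hd]⟩

lemma powerSeriesFun_apply {p : ℂ⟦X⟧} {m : ℕ} {f : Polynomial ℂ}
    (h : ∀ d < m, f.coeff d = coeff d p) :
    (powerSeriesFun p).1 m = Ideal.Quotient.mk (arrowIdeal 2 6 ^ m) (preAeval f) :=
  mk_preAeval_congr fun d hd => by rw [coeff_trunc, if_pos hd, h d hd]

lemma CAlg.ext {a b : CAlg 2 6} (h : ∀ m, a.1 m = b.1 m) : a = b := Subtype.ext (funext h)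

/-- The embedding of `ℂ⟦t⟧`, `t = xy`, in `C_{2,6}`. -/
def ofPowerSeries : ℂ⟦X⟧ →+* CAlg 2 6 where
  toFun := powerSeriesFun
  map_one' := CAlg.ext fun m => by
    rw [powerSeriesFun_apply (f := 1), map_one, map_one]
    · rfl
    · intro d _
      rw [Polynomial.coeff_one, coeff_one]
  map_zero' := CAlg.ext fun m => by
    rw [powerSeriesFun_apply (f := 0), map_zero, map_zero]
    · rfl
    · simp
  map_add' p q := CAlg.ext fun m => by
    rw [powerSeriesFun_apply (f := trunc m p + trunc m q), map_add, map_add]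
    · rfl
    · intro d hd
      rw [Polynomial.coeff_add, coeff_trunc, coeff_trunc, if_pos hd, if_pos hd, map_add]
  map_mul' p q := CAlg.ext fun m => by
    rw [powerSeriesFun_apply (f := trunc m p * trunc m q), map_mul, map_mul]
    · rfl
    · intro d hd
      rw [Polynomial.coeff_mul, coeff_mul]
      refine Finset.sum_congr rfl fun x hx => ?_
      have hx' := Finset.HasAntidiagonal.mem_antidiagonal.mp hx
      rw [coeff_trunc, coeff_trunc, if_pos (by omega), if_pos (by omega)]

lemma ofPowerSeries_apply {p : ℂ⟦X⟧} {m : ℕ} {f : Polynomial ℂ}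
    (h : ∀ d < m, f.coeff d = coeff d p) :
    (ofPowerSeries p).1 m = Ideal.Quotient.mk (arrowIdeal 2 6 ^ m) (preAeval f) :=
  powerSeriesFun_apply h

/-- The map from the uncompleted algebra to `C_{2,6}`, as a ring homomorphism. -/
def toCAlgHom : PreAlg 2 6 →+* CAlg 2 6 where
  toFun := toCAlg 2 6
  map_one' := rfl
  map_zero' := rfl
  map_add' _ _ := rfl
  map_mul' _ _ := rfl

/-- The idempotent of `C_{2,6}` at the vertex `j`. -/
def cE (j : ZMod 6) : CAlg 2 6 := toCAlgHom (preE j)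

/-- The element `x` of `C_{2,6}`. -/
def cX : CAlg 2 6 := toCAlgHom preX

/-- The element `y` of `C_{2,6}`. -/
def cY : CAlg 2 6 := toCAlgHom preY

/-- The image of `preW c` in `C_{2,6}`. -/
def cW (c : ZMod 6) : CAlg 2 6 := toCAlgHom (preW c)

lemma cE_mul_self (j : ZMod 6) : cE j * cE j = cE j := by
  rw [cE, ← map_mul, preE_mul_self]

lemma cE_mul_of_ne {i j : ZMod 6} (h : i ≠ j) : cE i * cE j = 0 := by
  rw [cE, cE, ← map_mul, preE_mul_of_ne h, map_zero]

lemma sum_cE : ∑ j, cE j = 1 := by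
  simp only [cE]
  rw [← map_sum, sum_preE, map_one]

lemma cX_mul_cE (a : ZMod 6) : cX * cE a = cE (a + 1) * cX := by
  rw [cE, cE, cX, ← map_mul, ← map_mul, preX_mul_preE]

lemma ofPowerSeries_X : ofPowerSeries X = cX * cY := CAlg.ext fun m => by
  rw [ofPowerSeries_apply (f := Polynomial.X), Polynomial.aeval_X]
  · rfl
  · intro d _
    rw [coeff_X, Polynomial.coeff_X]
    simp only [eq_comm]

lemma cX_mul_cY : cX * cY = cY * cX := by
  rw [cX, cY, ← map_mul, ← map_mul, preX_mul_preY]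

lemma cY_sq : cY ^ 2 = cX ^ 4 := by
  rw [cX, cY, ← map_pow, ← map_pow, preY_sq]

lemma cX_mul_cW (c : ZMod 6) :
    cX * cW c = if c = 4 ∨ c = 5 then ofPowerSeries X * cW (c + 1) else cW (c + 1) := by
  rw [ofPowerSeries_X, cX, cY, cW, cW, ← map_mul, preX_mul_preW]
  split_ifs
  · rw [preT, map_mul, map_mul]
  · rfl

lemma cY_mul_cW (c : ZMod 6) :
    cY * cW c = if c = 5 ∨ c = 0 then cW (c - 1) else ofPowerSeries X * cW (c - 1) := by
  rw [ofPowerSeries_X, cX, cY, cW, cW, ← map_mul, preY_mul_preW]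
  split_ifs
  · rfl
  · rw [preT, map_mul, map_mul]

lemma cW_mul_cE (c a : ZMod 6) : cW c * cE a = cE (a + c) * cW c := by
  rw [cW, cE, cE, ← map_mul, ← map_mul, preW_mul_preE]

/-- Power series in `t` are central in `C_{2,6}`. -/
lemma commute_ofPowerSeries (p : ℂ⟦X⟧) (c : CAlg 2 6) : Commute (ofPowerSeries p) c :=
  CAlg.ext fun m => by
    obtain ⟨r, hr⟩ := Ideal.Quotient.mk_surjective (c.1 m)
    change (ofPowerSeries p).1 m * c.1 m = c.1 m * (ofPowerSeries p).1 m
    rw [ofPowerSeries_apply (f := trunc m p)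
      (fun d hd => by rw [coeff_trunc, if_pos hd]), ← hr, ← map_mul, ← map_mul,
      (commute_preAeval _ r).eq]

/-! ### The action on the modules `M_I` -/

section Action

variable {I : Finset (ZMod 6)} {hI : I.card = 2} {hk : 0 < 2 ∧ 2 < 6}

lemma preAct_preAeval (q : Polynomial ℂ) (v : ZMod 6 → ℂ⟦X⟧) :
    preAct I hI (preAeval q) v = (q : ℂ⟦X⟧) • v := by
  have hT : ∀ v, preAct I hI preT v = (X : ℂ⟦X⟧) • v := fun v => by
    rw [preT, preX, preY, ← map_mul, preAct_mk, map_mul]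
    exact freeAct_xy I v
  have hT' : preAct I hI preT = (X : ℂ⟦X⟧) • (1 : Module.End ℂ⟦X⟧ (ZMod 6 → ℂ⟦X⟧)) :=
    LinearMap.ext hT
  induction q using Polynomial.induction_on' with
  | add p q hp hq => rw [map_add, map_add, LinearMap.add_apply, hp, hq, Polynomial.coe_add,
      add_smul]
  | monomial n a =>
    have h1 : ((Polynomial.monomial n a : Polynomial ℂ) : ℂ⟦X⟧) = a • X ^ n := by
      rw [Polynomial.coe_monomial]
      ext d
      rw [coeff_monomial, coeff_smul, coeff_X_pow]
      simp
    rw [Polynomial.aeval_monomial, ← Algebra.smul_def, map_smul, map_pow, hT', smul_pow, one_pow,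
      h1, LinearMap.smul_apply, LinearMap.smul_apply, Module.End.one_apply, smul_assoc]

/-- The coordinates of an element of `M_I` at the six vertices. -/
def coords : RankOne 2 I hI hk ≃+ (ZMod 6 → ℂ⟦X⟧) := AddEquiv.refl _

lemma coords_ofPowerSeries_smul (p : ℂ⟦X⟧) (v : RankOne 2 I hI hk) (a : ZMod 6) :
    coords (ofPowerSeries p • v) a = p * coords v a := PowerSeries.ext fun d => by
  refine (coeff_act I hI hk.1 hk.2 (ofPowerSeries p) v a d _ le_rfl
    (preAeval (trunc (level I d) p)) rfl).trans ?_
  change coeff d (preAct I hI (preAeval (trunc (level I d) p)) (coords v) a) = _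
  rw [preAct_preAeval, Pi.smul_apply, smul_eq_mul, coeff_mul, coeff_mul]
  refine Finset.sum_congr rfl fun x hx => ?_
  have hx' := Finset.HasAntidiagonal.mem_antidiagonal.mp hx
  have hl : d < level I d := by unfold level; omega
  rw [Polynomial.coeff_coe, coeff_trunc, if_pos (by omega)]

lemma coords_toCAlgHom_smul (r : PreAlg 2 6) (v : RankOne 2 I hI hk) :
    coords (toCAlgHom r • v) = preAct I hI r (coords v) := toCAlg_smul r v

lemma coords_cE_smul (j : ZMod 6) (v : RankOne 2 I hI hk) :
    coords (cE j • v) = Pi.single j (coords v j) := by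
  rw [cE, coords_toCAlgHom_smul, preE, preAct_mk, freeAct_e]

lemma coords_cX_smul (v : RankOne 2 I hI hk) (a : ZMod 6) :
    coords (cX • v) a = (if a ∈ I then X else 1) * coords v (a - 1) := by
  rw [cX, coords_toCAlgHom_smul, preX, preAct_mk, freeAct_sum_x]

lemma coords_cY_smul (v : RankOne 2 I hI hk) (a : ZMod 6) :
    coords (cY • v) a = (if a + 1 ∈ I then 1 else X) * coords v (a + 1) := by
  rw [cY, coords_toCAlgHom_smul, preY, preAct_mk, freeAct_sum_y]

end Action

/-- Shortest paths act by powers of `t` on the generators of `M_I`. -/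
lemma preAct_preE_mul_preW (I : Finset (ZMod 6)) (hI : I.card = 2) (i j : ZMod 6) :
    ∃ k ≤ 5, preAct I hI (preE j * preW (j - i)) (Pi.single i 1) j = X ^ k := by
  rw [map_mul, Module.End.mul_apply, preE, preAct_mk, freeAct_e, Pi.single_eq_same, preW]
  split_ifs with h
  · rw [preY, preAct_mk, freeAct_sum_y]
    have h1 : j + 1 = i := by rw [← sub_eq_zero, add_sub_right_comm, h]; rfl
    rw [h1, Pi.single_eq_same, mul_one]
    split_ifs
    · exact ⟨0, by omega, by simp⟩
    · exact ⟨1, by omega, by simp⟩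
  · rw [map_pow, preX, preAct_mk, ← map_pow, freeAct_pow_x, ZMod.natCast_zmod_val, sub_sub_cancel,
      Pi.single_eq_same, mul_one, Finset.prod_ite, Finset.prod_const, Finset.prod_const_one,
      mul_one]
    refine ⟨_, (Finset.card_filter_le _ _).trans ?_, rfl⟩
    have := ZMod.val_lt (j - i)
    rw [Finset.card_range]
    omega

/-- Elements of high powers of the arrow ideal have vanishing coefficients of low degree. The shift
by `5` bounds the exponent by which a shortest path acts. -/
lemma coeff_eq_zero_of_mem_arrowIdeal_pow {I : Finset (ZMod 6)} (hI : I.card = 2) {i j : ZMod 6}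
    {q : Polynomial ℂ} {m : ℕ}
    (h : preAeval q * (preE j * preW (j - i)) ∈ arrowIdeal 2 6 ^ m) {d : ℕ}
    (hd : level I (d + 5) ≤ m) : q.coeff d = 0 := by
  obtain ⟨k, hk, hk'⟩ := preAct_preE_mul_preW I hI i j
  have h1 := coeff_preAct_eq_zero I hI (by omega) (by omega) (d + k) m
    ((level_mono I (by omega)).trans hd) h (Pi.single i 1) j
  rwa [map_mul, Module.End.mul_apply, preAct_preAeval, Pi.smul_apply, hk', smul_eq_mul,
    coeff_mul_X_pow, Polynomial.coeff_coe] at h1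

/-- In `C_{2,6}`, every path from `i` to `j` is a power series in `t` times the shortest one. -/
lemma exists_cE_mul_mul_cE (c : CAlg 2 6) (i j : ZMod 6) :
    ∃ p : ℂ⟦X⟧, cE j * c * cE i = ofPowerSeries p * (cE j * cW (j - i)) := by
  have hI : ({0, 1} : Finset (ZMod 6)).card = 2 := by decide
  set I : Finset (ZMod 6) := {0, 1}
  choose r hr using fun m => Ideal.Quotient.mk_surjective (c.1 m)
  choose q hq using fun m => exists_preE_mul_mul_preE (r m) i j
  have hr' : ∀ {m m'}, m ≤ m' → r m' - r m ∈ arrowIdeal 2 6 ^ m := fun {m m'} h => by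
    rw [← Ideal.Quotient.eq, hr, ← CAlg.compat c h, ← hr]
    rfl
  -- The coefficient of degree `d` of the polynomial `q m` does not depend on `m` if `m` is large.
  have hstable : ∀ {d m m'}, level I (d + 5) ≤ m → m ≤ m' → (q m').coeff d = (q m).coeff d :=
    fun {d m m'} h h' => by
      rw [← sub_eq_zero, ← Polynomial.coeff_sub]
      refine coeff_eq_zero_of_mem_arrowIdeal_pow hI (i := i) (j := j) ?_ h
      rw [map_sub, sub_mul, ← hq, ← hq, ← sub_mul, ← mul_sub]
      exact Ideal.mul_mem_right _ _ (Ideal.mul_mem_left _ _ (hr' h'))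
  refine ⟨PowerSeries.mk fun d => (q (level I (d + 5))).coeff d, CAlg.ext fun m => ?_⟩
  have hm : m ≤ level I (m + 5) := by unfold level; omega
  change Ideal.Quotient.mk (arrowIdeal 2 6 ^ m) (preE j) * c.1 m *
    Ideal.Quotient.mk (arrowIdeal 2 6 ^ m) (preE i) = (ofPowerSeries _).1 m *
    Ideal.Quotient.mk (arrowIdeal 2 6 ^ m) (preE j * preW (j - i))
  rw [ofPowerSeries_apply (f := q (level I (m + 5))), ← map_mul, ← hq,
    map_mul, map_mul, ← CAlg.compat c hm, ← hr (level I (m + 5))]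
  · rfl
  · intro d hd
    rw [coeff_mk]
    exact hstable le_rfl (level_mono I (by omega))

/-- The algebra `C_{2,6}` is generated by power series in `t`, the idempotents, `x` and `y`. -/
lemma subring_eq_top {S : Subring (CAlg 2 6)} (hp : ∀ p, ofPowerSeries p ∈ S)
    (hE : ∀ j, cE j ∈ S) (hX : cX ∈ S) (hY : cY ∈ S) (c : CAlg 2 6) : c ∈ S := by
  have hW : ∀ a, cW a ∈ S := fun a => by
    unfold cW preW
    split_ifs
    · exact hY
    · rw [map_pow]; exact S.pow_mem hX _
  have h : c = ∑ j, ∑ i, cE j * c * cE i := by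
    simp_rw [← Finset.mul_sum, ← Finset.sum_mul, sum_cE, one_mul, mul_one]
  rw [h]
  refine S.sum_mem fun j _ => S.sum_mem fun i _ => ?_
  obtain ⟨p, hp'⟩ := exists_cE_mul_mul_cE c i j
  rw [hp']
  exact S.mul_mem (hp p) (S.mul_mem (hE j) (hW _))

/-- The module `M_{01}`. Any module `M_I` would do: it detects power series in `t` in `C_{2,6}`
through their action. -/
abbrev testModule : Type :=
  RankOne 2 ({0, 1} : Finset (ZMod 6)) (by decide) ⟨by decide, by decide⟩

lemma ofPowerSeries_injective : Function.Injective ofPowerSeries := fun p q h => by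
  have h1 := congrArg (fun c => coords (c • (coords.symm 1 : testModule)) 0) h
  simpa [coords_ofPowerSeries_smul] using h1

/-- The centre of `C_{2,6}` consists of the power series in `t`. -/
lemma exists_ofPowerSeries_eq {z : CAlg 2 6} (hz : ∀ c, c * z = z * c) :
    ∃ p, ofPowerSeries p = z := by
  choose p hp using fun i => exists_cE_mul_mul_cE z i i
  have h0 : cW 0 = 1 := by
    unfold cW
    rw [show preW 0 = 1 from pow_zero preX, map_one]
  have hp' : ∀ i, cE i * z = ofPowerSeries (p i) * cE i := fun i => by
    have h := hp i
    rwa [mul_assoc, ← hz (cE i), ← mul_assoc, cE_mul_self, sub_self, h0, mul_one] at h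
  have hstep : ∀ i, p (i + 1) = p i := fun i => by
    have h1 : ofPowerSeries (p (i + 1)) * (cX * cE i) = ofPowerSeries (p i) * (cX * cE i) := by
      have h2 : cE (i + 1) * z * cX = cX * (cE i * z) := by
        rw [← mul_assoc, cX_mul_cE, mul_assoc, ← hz, mul_assoc]
      rw [hp', hp', ← mul_assoc cX, ← (commute_ofPowerSeries _ cX).eq, mul_assoc, ← cX_mul_cE,
        mul_assoc] at h2
      exact h2
    have h3 := congrArg (fun c => coords (c • (coords.symm 1 : testModule)) (i + 1)) h1
    simp only [mul_smul, coords_ofPowerSeries_smul, coords_cX_smul, coords_cE_smul] at h3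
    refine mul_right_cancel₀ ?_ h3
    split_ifs <;> simp [X_ne_zero]
  have hconst : ∀ i, p i = p 0 := by
    have h1 := hstep 0
    have h2 := hstep 1
    have h3 := hstep 2
    have h4 := hstep 3
    have h5 := hstep 4
    intro i
    fin_cases i
    · rfl
    · exact h1
    · exact h2.trans h1
    · exact h3.trans (h2.trans h1)
    · exact h4.trans (h3.trans (h2.trans h1))
    · exact h5.trans (h4.trans (h3.trans (h2.trans h1)))
  refine ⟨p 0, ?_⟩
  rw [← one_mul z, ← sum_cE, Finset.sum_mul, ← mul_one (ofPowerSeries (p 0)), ← sum_cE,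
    Finset.mul_sum]
  exact Finset.sum_congr rfl fun i _ => by rw [hp', hconst i]

/-- The isomorphism of `ℂ⟦t⟧` with the centre of `C_{2,6}`. -/
def centerEquiv : ℂ⟦X⟧ ≃+* Subalgebra.center ℂ (CAlg 2 6) :=
  RingEquiv.ofBijective
    (ofPowerSeries.codRestrict (Subalgebra.center ℂ (CAlg 2 6)) fun p =>
      Subalgebra.mem_center_iff.mpr fun c => (commute_ofPowerSeries p c).eq.symm)
    ⟨fun _ _ h => ofPowerSeries_injective (congrArg Subtype.val h), fun z => by
      obtain ⟨p, hp⟩ := exists_ofPowerSeries_eq (Subalgebra.mem_center_iff.mp z.2)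
      exact ⟨p, Subtype.ext hp⟩⟩

/-- Every `C_{2,6}`-module is a module over `ℂ⟦t⟧`. -/
instance powerSeriesModule (M : ModuleCat.{0} (CAlg 2 6)) : Module ℂ⟦X⟧ M :=
  Module.compHom M ofPowerSeries

lemma powerSeries_smul_def {M : ModuleCat.{0} (CAlg 2 6)} (p : ℂ⟦X⟧) (m : M) :
    p • m = ofPowerSeries p • m := rfl

/-! ### Maximal Cohen–Macaulay modules and homomorphisms -/

attribute [local instance] RingHomInvPair.of_ringEquiv in
/-- A `C_{2,6}`-module is maximal Cohen–Macaulay if and only if it is finite and torsion-free over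
`ℂ⟦t⟧`. -/
lemma CM_iff (M : ModuleCat.{0} (CAlg 2 6)) :
    CM 2 6 M ↔ Module.Finite ℂ⟦X⟧ M ∧ Module.IsTorsionFree ℂ⟦X⟧ M := by
  let e : M ≃ₛₗ[(centerEquiv : ℂ⟦X⟧ →+* Subalgebra.center ℂ (CAlg 2 6))] M :=
    { AddEquiv.refl M with map_smul' := fun _ _ => rfl }
  have h1 : Module.Free ℂ⟦X⟧ M ↔ Module.Free (Subalgebra.center ℂ (CAlg 2 6)) M :=
    Module.Free.iff_of_equiv e
  constructor
  · rintro ⟨h, h'⟩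
    have := h1.mpr h'
    exact ⟨Module.Finite.of_surjective e.symm.toLinearMap e.symm.surjective, inferInstance⟩
  · rintro ⟨h, h'⟩
    exact ⟨Module.Finite.of_surjective e.toLinearMap e.surjective, h1.mp inferInstance⟩

lemma hom_powerSeries_smul {M N : ModuleCat.{0} (CAlg 2 6)} (f : M ⟶ N) (p : ℂ⟦X⟧) (m : M) :
    f.hom (p • m) = p • f.hom m := f.hom.map_smul (ofPowerSeries p) m

lemma CAlg_smul_comm {M : ModuleCat.{0} (CAlg 2 6)} (c : CAlg 2 6) (p : ℂ⟦X⟧) (m : M) :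
    c • p • m = p • c • m := by
  rw [powerSeries_smul_def, powerSeries_smul_def, smul_smul, smul_smul,
    (commute_ofPowerSeries p c).eq]

/-- A homomorphism of `C_{2,6}`-modules, as a `ℂ⟦t⟧`-linear map. -/
def powerSeriesLinear {M N : ModuleCat.{0} (CAlg 2 6)} (f : M ⟶ N) : M →ₗ[ℂ⟦X⟧] N where
  toFun := f.hom
  map_add' := f.hom.map_add
  map_smul' := hom_powerSeries_smul f

/-- The action of an element of `C_{2,6}`, as a `ℂ⟦t⟧`-linear map. -/
def smulLinear (M : ModuleCat.{0} (CAlg 2 6)) (c : CAlg 2 6) : M →ₗ[ℂ⟦X⟧] M where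
  toFun m := c • m
  map_add' := smul_add c
  map_smul' p m := CAlg_smul_comm c p m

/-- An additive map commuting with the generators is a homomorphism. -/
def homOfGenerators {M N : ModuleCat.{0} (CAlg 2 6)} (f : M →+ N)
    (hp : ∀ (p : ℂ⟦X⟧) m, f (p • m) = p • f m) (hE : ∀ j m, f (cE j • m) = cE j • f m)
    (hX : ∀ m, f (cX • m) = cX • f m) (hY : ∀ m, f (cY • m) = cY • f m) : M ⟶ N :=
  ModuleCat.ofHom
    { f with
      map_smul' := fun c => by
        let S : Subring (CAlg 2 6) :=
          { carrier := {c | ∀ m, f (c • m) = c • f m}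
            mul_mem' := fun {a b} ha hb m => by rw [mul_smul, ha, hb, mul_smul]
            one_mem' := fun m => by rw [one_smul, one_smul]
            add_mem' := fun {a b} ha hb m => by rw [add_smul, map_add, ha, hb, add_smul]
            zero_mem' := fun m => by rw [zero_smul, zero_smul, map_zero]
            neg_mem' := fun {a} ha m => by rw [neg_smul, map_neg, ha, neg_smul] }
        exact subring_eq_top (S := S) hp hE hX hY c }

/-- The two-element subsets of `ZMod 6`. -/
abbrev Pair : Type := {I : Finset (ZMod 6) // I.card = 2}

/-- The module `M_I`. -/
abbrev rankOneModule (I : Pair) : ModuleCat.{0} (CAlg 2 6) :=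
  rankOne 2 6 ⟨by decide, by decide⟩ I.1 I.2

/-- The coordinates of an element of `M_I`. -/
def coord {I : Pair} : rankOneModule I ≃ₗ[ℂ⟦X⟧] (ZMod 6 → ℂ⟦X⟧) where
  __ := (coords : RankOne 2 I.1 I.2 _ ≃+ _)
  map_smul' p v := funext fun a => coords_ofPowerSeries_smul p v a

/-- The scalar by which `x_a` acts on `M_I`. -/
def xFactor (I : Pair) (a : ZMod 6) : ℂ⟦X⟧ := if a ∈ I.1 then X else 1

/-- The scalar by which `y_a` acts on `M_I`. -/
def yFactor (I : Pair) (a : ZMod 6) : ℂ⟦X⟧ := if a ∈ I.1 then 1 else X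

lemma xFactor_mul_yFactor (I : Pair) (a : ZMod 6) : xFactor I a * yFactor I a = X := by
  unfold xFactor yFactor
  split_ifs <;> simp

lemma xFactor_ne_zero (I : Pair) (a : ZMod 6) : xFactor I a ≠ 0 := by
  unfold xFactor
  split_ifs <;> simp [X_ne_zero]

lemma coord_cE_smul {I : Pair} (j : ZMod 6) (v : rankOneModule I) :
    coord (cE j • v) = Pi.single j (coord v j) := coords_cE_smul j v

lemma coord_cX_smul {I : Pair} (v : rankOneModule I) (a : ZMod 6) :
    coord (cX • v) a = xFactor I a * coord v (a - 1) := coords_cX_smul v a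

lemma coord_cY_smul {I : Pair} (v : rankOneModule I) (a : ZMod 6) :
    coord (cY • v) a = yFactor I (a + 1) * coord v (a + 1) := coords_cY_smul v a

/-- A family of vectors satisfying the relations of the standard basis of `M_I` defines a
homomorphism from `M_I`. -/
def fromRankOne {I : Pair} {M : ModuleCat.{0} (CAlg 2 6)} (u : ZMod 6 → M)
    (hE : ∀ a, cE a • u a = u a) (hX : ∀ a, cX • u (a - 1) = xFactor I a • u a)
    (hY : ∀ a, cY • u a = yFactor I a • u (a - 1)) : rankOneModule I ⟶ M :=
  homOfGenerators
    { toFun := fun v => ∑ a, coord v a • u a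
      map_zero' := by simp
      map_add' := fun v w => by simp [add_smul, Finset.sum_add_distrib] }
    (fun p v => by
      simp only [AddMonoidHom.coe_mk, ZeroHom.coe_mk, map_smul, Pi.smul_apply, smul_assoc,
        Finset.smul_sum])
    (fun j v => by
      simp only [AddMonoidHom.coe_mk, ZeroHom.coe_mk, coord_cE_smul, Finset.smul_sum]
      refine Finset.sum_congr rfl fun a _ => ?_
      rw [CAlg_smul_comm]
      by_cases h : a = j
      · subst h
        rw [Pi.single_eq_same, hE]
      · rw [Pi.single_eq_of_ne h, ← hE a, ← mul_smul (cE j), cE_mul_of_ne (Ne.symm h)]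
        simp)
    (fun v => by
      simp only [AddMonoidHom.coe_mk, ZeroHom.coe_mk, coord_cX_smul, Finset.smul_sum]
      rw [← (Equiv.subRight (1 : ZMod 6)).sum_comp fun a => cX • coord v a • u a]
      refine Finset.sum_congr rfl fun a _ => ?_
      rw [Equiv.subRight_apply, CAlg_smul_comm, hX, smul_smul, mul_comm])
    (fun v => by
      simp only [AddMonoidHom.coe_mk, ZeroHom.coe_mk, coord_cY_smul, Finset.smul_sum]
      rw [← Equiv.sum_comp (Equiv.addRight (1 : ZMod 6)) fun a => cY • coord v a • u a]
      refine Finset.sum_congr rfl fun a _ => ?_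
      rw [Equiv.coe_addRight, CAlg_smul_comm, hY, smul_smul, mul_comm, add_sub_cancel_right])

lemma fromRankOne_apply {I : Pair} {M : ModuleCat.{0} (CAlg 2 6)} (u : ZMod 6 → M)
    (hE : ∀ a, cE a • u a = u a) (hX : ∀ a, cX • u (a - 1) = xFactor I a • u a)
    (hY : ∀ a, cY • u a = yFactor I a • u (a - 1)) (v : rankOneModule I) :
    (fromRankOne u hE hX hY).hom v = ∑ a, coord v a • u a := rfl

/-- A family of functionals satisfying the relations of the coordinates of `M_I` defines a
homomorphism to `M_I`. -/
def toRankOne {I : Pair} {M : ModuleCat.{0} (CAlg 2 6)} (φ : ZMod 6 → M →ₗ[ℂ⟦X⟧] ℂ⟦X⟧)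
    (hE : ∀ a m, φ a (cE a • m) = φ a m)
    (hX : ∀ a m, φ a (cX • m) = xFactor I a * φ (a - 1) m) : M ⟶ rankOneModule I :=
  homOfGenerators
    { toFun := fun m => coord.symm fun a => φ a m
      map_zero' := coord.injective (by ext; simp)
      map_add' := fun v w => coord.injective (by ext; simp) }
    (fun p v => coord.injective (by ext; simp))
    (fun j m => coord.injective (by
      funext a
      rw [coord_cE_smul]
      simp only [AddMonoidHom.coe_mk, ZeroHom.coe_mk, LinearEquiv.apply_symm_apply]
      by_cases h : a = j
      · subst h
        rw [Pi.single_eq_same, hE]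
      · rw [Pi.single_eq_of_ne h, ← hE a, ← mul_smul, cE_mul_of_ne h, zero_smul, map_zero]))
    (fun m => coord.injective (by
      funext a
      rw [coord_cX_smul]
      simp only [AddMonoidHom.coe_mk, ZeroHom.coe_mk, LinearEquiv.apply_symm_apply]
      rw [hX]))
    (fun m => coord.injective (by
      funext a
      rw [coord_cY_smul]
      simp only [AddMonoidHom.coe_mk, ZeroHom.coe_mk, LinearEquiv.apply_symm_apply]
      have h1 : φ (a + 1) (cX • cY • m) = X * φ (a + 1) m := by
        rw [← mul_smul, ← ofPowerSeries_X, ← powerSeries_smul_def, map_smul, smul_eq_mul]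
      rw [hX, add_sub_cancel_right, ← xFactor_mul_yFactor I (a + 1), mul_assoc] at h1
      exact mul_left_cancel₀ (xFactor_ne_zero I _) h1))

lemma CM_rankOneModule (I : Pair) : CM 2 6 (rankOneModule I) :=
  (CM_iff _).mpr ⟨Module.Finite.equiv coord.symm,
    Function.Injective.moduleIsTorsionFree coord coord.injective (by simp)⟩

/-- The standard basis vector of `M_I` at the vertex `a`. -/
def basisVec (I : Pair) (a : ZMod 6) : rankOneModule I := coord.symm (Pi.single a 1)

lemma coord_basisVec (I : Pair) (a : ZMod 6) : coord (basisVec I a) = Pi.single a 1 :=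
  coord.apply_symm_apply _

lemma cE_smul_basisVec (I : Pair) (a : ZMod 6) : cE a • basisVec I a = basisVec I a :=
  coord.injective (by rw [coord_cE_smul, coord_basisVec, Pi.single_eq_same])

lemma cX_smul_basisVec (I : Pair) (a : ZMod 6) :
    cX • basisVec I (a - 1) = xFactor I a • basisVec I a := coord.injective (by
  funext b
  rw [coord_cX_smul, map_smul, Pi.smul_apply, coord_basisVec, coord_basisVec, smul_eq_mul]
  by_cases h : b = a
  · subst h; simp
  · rw [Pi.single_eq_of_ne h, Pi.single_eq_of_ne (by simpa using h), mul_zero, mul_zero])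

lemma cY_smul_basisVec (I : Pair) (a : ZMod 6) :
    cY • basisVec I a = yFactor I a • basisVec I (a - 1) := coord.injective (by
  funext b
  rw [coord_cY_smul, map_smul, Pi.smul_apply, coord_basisVec, coord_basisVec, smul_eq_mul]
  by_cases h : b = a - 1
  · subst h; simp
  · rw [Pi.single_eq_of_ne h, Pi.single_eq_of_ne (by rwa [ne_eq, ← eq_sub_iff_add_eq]), mul_zero,
      mul_zero])

lemma eq_sum_basisVec {I : Pair} (v : rankOneModule I) :
    v = ∑ a, coord v a • basisVec I a := coord.injective (by
  rw [map_sum]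
  simp only [map_smul, coord_basisVec]
  funext b
  simp [Finset.sum_apply, Pi.single_apply])

/-- Homomorphisms from `M_I` are determined on the standard basis. -/
lemma rankOneModule_hom_ext {I : Pair} {M : ModuleCat.{0} (CAlg 2 6)} {f g : rankOneModule I ⟶ M}
    (h : ∀ a, f.hom (basisVec I a) = g.hom (basisVec I a)) : f = g := by
  refine ModuleCat.hom_ext (LinearMap.ext fun v => ?_)
  rw [eq_sum_basisVec v, map_sum, map_sum]
  exact Finset.sum_congr rfl fun a _ => by
    rw [hom_powerSeries_smul, hom_powerSeries_smul, h]

/-- In a `ℂ⟦t⟧`-torsion-free module the action of `y` is determined by that of `x`. -/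
lemma cY_smul_eq_of_cX_smul_eq {M : ModuleCat.{0} (CAlg 2 6)} [Module.IsTorsionFree ℂ⟦X⟧ M]
    {I : Pair} {a : ZMod 6} {u v : M} (h : cX • v = xFactor I a • u) :
    cY • u = yFactor I a • v := by
  have h1 : xFactor I a • cY • u = xFactor I a • yFactor I a • v := by
    rw [smul_smul, xFactor_mul_yFactor, ← CAlg_smul_comm, ← h, ← mul_smul, ← cX_mul_cY,
      ← ofPowerSeries_X, powerSeries_smul_def]
  exact smul_right_injective M (xFactor_ne_zero I a) h1

/-! ### Homomorphisms between rank one modules -/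

/-- The number of elements of `I` among `0, …, a`. -/
def count (I : Pair) (a : ZMod 6) : ℤ :=
  ∑ k ∈ Finset.range (a.val + 1), if (k : ZMod 6) ∈ I.1 then 1 else 0

/-- The largest difference of the counting functions of `I` and `J`: the constant that makes all
exponents of the minimal homomorphism nonnegative. -/
def offset (I J : Pair) : ℤ :=
  Finset.univ.sup' Finset.univ_nonempty fun a : ZMod 6 => count I a - count J a

/-- The minimal homomorphism `M_I → M_J` is multiplication by `t ^ height I J a` at the vertex `a`.
Compatibility with the arrows determines these exponents up to a common constant, which is chosen
as small as possible, so that one of them is `0`. -/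
def height (I J : Pair) (a : ZMod 6) : ℕ := (count J a - count I a + offset I J).toNat

/-- The exponent of `t` in the composite of the minimal homomorphisms `M_I → M_J → M_K`, relative
to the minimal homomorphism `M_I → M_K`. -/
def defect (I J K : Pair) : ℕ := (offset I J + offset J K - offset I K).toNat

lemma sum_range_six (I : Pair) :
    (∑ k ∈ Finset.range 6, if ((k : ℕ) : ZMod 6) ∈ I.1 then (1 : ℤ) else 0) = 2 := by
  have h : (∑ a : ZMod 6, if a ∈ I.1 then (1 : ℤ) else 0) = 2 := by
    rw [Finset.sum_boole, Finset.filter_mem_eq_inter, Finset.univ_inter, I.2]; rfl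
  rw [← h]
  exact Finset.sum_range fun k : ℕ => if (k : ZMod 6) ∈ I.1 then (1 : ℤ) else 0

lemma count_sub (I : Pair) (a : ZMod 6) :
    count I a - count I (a - 1) =
      (if a ∈ I.1 then 1 else 0) - (if a = 0 then 2 else 0) := by
  have h6 := sum_range_six I
  by_cases h : a = 0
  · subst h
    have h0 : count I 0 = if (0 : ZMod 6) ∈ I.1 then 1 else 0 := by
      change ∑ k ∈ Finset.range 1, (if (k : ZMod 6) ∈ I.1 then (1 : ℤ) else 0) = _
      rw [Finset.sum_range_one, Nat.cast_zero]
    have h1 : count I (0 - 1) = 2 := h6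
    rw [h0, h1, if_pos rfl]
  · have h2 : (a - 1).val + 1 = a.val := by revert h; revert a; decide
    rw [count, count, h2, Finset.sum_range_succ, ZMod.natCast_zmod_val, if_neg h]
    ring

lemma coe_height (I J : Pair) (a : ZMod 6) :
    (height I J a : ℤ) = count J a - count I a + offset I J := by
  have h : count I a - count J a ≤ offset I J :=
    Finset.le_sup' (fun a => count I a - count J a) (Finset.mem_univ a)
  rw [height, Int.toNat_of_nonneg (by linarith)]

lemma exists_height_eq_zero (I J : Pair) : ∃ a, height I J a = 0 := by
  obtain ⟨a, -, h⟩ := Finset.exists_mem_eq_sup' (Finset.univ_nonempty (α := ZMod 6))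
    fun a => count I a - count J a
  refine ⟨a, ?_⟩
  rw [← Nat.cast_inj (R := ℤ), coe_height, offset, h]
  simp

lemma coe_defect (I J K : Pair) : (defect I J K : ℤ) = offset I J + offset J K - offset I K := by
  obtain ⟨a, ha⟩ := exists_height_eq_zero I K
  have h := coe_height I K a
  have h1 := coe_height I J a
  have h2 := coe_height J K a
  rw [defect, Int.toNat_of_nonneg]
  omega

lemma height_add_height (I J K : Pair) (a : ZMod 6) :
    height I J a + height J K a = defect I J K + height I K a := by
  have h := coe_height I K a
  have h1 := coe_height I J a
  have h2 := coe_height J K a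
  have h3 := coe_defect I J K
  omega

lemma height_self (I : Pair) (a : ZMod 6) : height I I a = 0 := by
  have h : offset I I = 0 := by
    obtain ⟨a, ha⟩ := exists_height_eq_zero I I
    have := coe_height I I a
    omega
  have := coe_height I I a
  omega

/-- The minimal homomorphism commutes with the arrows `x_a`. -/
lemma height_step (I J : Pair) (a : ZMod 6) :
    (if a ∈ J.1 then 1 else 0) + height I J (a - 1) =
      (if a ∈ I.1 then 1 else 0) + height I J a := by
  have h1 := coe_height I J a
  have h2 := coe_height I J (a - 1)
  have h3 := count_sub I a
  have h4 := count_sub J a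
  split_ifs at * <;> omega

lemma xFactor_eq_pow (I : Pair) (a : ZMod 6) :
    xFactor I a = X ^ (if a ∈ I.1 then 1 else 0) := by
  unfold xFactor
  split_ifs <;> simp

/-- If the minimal homomorphism `M_I → M_J` is bijective, then `I = J`. -/
lemma eq_of_height_eq_zero {I J : Pair} (h : ∀ a, height I J a = 0) : I = J := by
  refine Subtype.ext (Finset.ext fun a => ?_)
  have h1 := height_step I J a
  rw [h, h] at h1
  split_ifs at h1 <;> simp_all

lemma defect_pos {I J : Pair} (h : I ≠ J) : 0 < defect I J I := by
  by_contra h0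
  refine h (eq_of_height_eq_zero fun a => ?_)
  have := height_add_height I J I a
  rw [height_self] at this
  omega

lemma defect_self_left (I J : Pair) : defect I I J = 0 := by
  have := height_add_height I I J 0
  rw [height_self] at this
  omega

/-- The homomorphism `M_I → M_J` that is `p` times the minimal one. -/
def minHom (I J : Pair) (p : ℂ⟦X⟧) : rankOneModule I ⟶ rankOneModule J :=
  toRankOne
    (fun a => (p * X ^ height I J a) •
      (LinearMap.proj a ∘ₗ (coord : _ ≃ₗ[ℂ⟦X⟧] (ZMod 6 → ℂ⟦X⟧)).toLinearMap))
    (fun a m => by simp [coord_cE_smul])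
    (fun a m => by
      simp only [LinearMap.smul_apply, LinearMap.comp_apply, LinearMap.proj_apply,
        LinearEquiv.coe_coe, coord_cX_smul, smul_eq_mul, xFactor_eq_pow]
      have h := congrArg (fun n => (X : ℂ⟦X⟧) ^ n) (height_step I J a)
      simp only [pow_add] at h
      linear_combination (-p * coord m (a - 1)) * h)

lemma coord_minHom {I J : Pair} (p : ℂ⟦X⟧) (v : rankOneModule I) (a : ZMod 6) :
    coord ((minHom I J p).hom v) a = p * X ^ height I J a * coord v a := rfl

lemma coord_apply {I J : Pair} (f : rankOneModule I ⟶ rankOneModule J) (v : rankOneModule I)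
    (a : ZMod 6) : coord (f.hom v) a = coord v a * coord (f.hom (basisVec I a)) a := by
  have h : ∀ m : rankOneModule I, coord (f.hom m) a = coord (f.hom (cE a • m)) a := fun m => by
    rw [map_smul, coord_cE_smul, Pi.single_eq_same]
  have h1 : cE a • v = coord v a • basisVec I a := coord.injective (by
    rw [coord_cE_smul, map_smul, coord_basisVec, ← Pi.single_smul, smul_eq_mul, mul_one])
  rw [h, h1, hom_powerSeries_smul, map_smul, Pi.smul_apply, smul_eq_mul]

lemma minHom_surjective {I J : Pair} : Function.Surjective (minHom I J) := fun f => by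
  set c : ZMod 6 → ℂ⟦X⟧ := fun a => coord (f.hom (basisVec I a)) a with hc
  have hstep : ∀ a, xFactor J a * c (a - 1) = xFactor I a * c a := fun a => by
    rw [hc]
    dsimp only
    rw [← coord_cX_smul, ← map_smul, cX_smul_basisVec, hom_powerSeries_smul, map_smul,
      Pi.smul_apply, smul_eq_mul]
  have hratio : ∀ a, c a * X ^ height I J (a - 1) = c (a - 1) * X ^ height I J a := fun a => by
    refine mul_left_cancel₀ (xFactor_ne_zero I a) ?_
    have h := congrArg (fun n => (X : ℂ⟦X⟧) ^ n) (height_step I J a)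
    simp only [pow_add, ← xFactor_eq_pow] at h
    linear_combination (-X ^ height I J (a - 1)) * hstep a + c (a - 1) * h
  have hX : ∀ n : ℕ, (X : ℂ⟦X⟧) ^ n ≠ 0 := fun n => pow_ne_zero n X_ne_zero
  have hratio0 : ∀ n : ℕ, c n * X ^ height I J 0 = c 0 * X ^ height I J n := fun n => by
    induction n with
    | zero => simp
    | succ n ih =>
      have h := hratio (n + 1)
      rw [add_sub_cancel_right] at h
      push_cast
      refine mul_left_cancel₀ (hX (height I J n)) ?_
      linear_combination X ^ height I J 0 * h + X ^ height I J (n + 1 : ZMod 6) * ih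
  obtain ⟨b, hb⟩ := exists_height_eq_zero I J
  have h1 : ∀ a, c a = c b * X ^ height I J a := fun a => by
    have h2 := hratio0 a.val
    have h3 := hratio0 b.val
    rw [ZMod.natCast_zmod_val] at h2 h3
    rw [hb, pow_zero, mul_one] at h3
    refine mul_right_cancel₀ (hX (height I J 0)) ?_
    linear_combination h2 - X ^ height I J a * h3
  refine ⟨c b, rankOneModule_hom_ext fun a => coord.injective (funext fun a' => ?_)⟩
  rw [coord_minHom, coord_apply f, ← h1]
  exact mul_comm _ _

lemma minHom_injective {I J : Pair} : Function.Injective (minHom I J) := fun p q h => by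
  have h1 := congrArg (fun f => coord (f.hom (basisVec I 0)) 0) h
  simp only [coord_minHom, coord_basisVec, Pi.single_eq_same, mul_one] at h1
  exact mul_right_cancel₀ (pow_ne_zero _ X_ne_zero) h1

lemma minHom_add {I J : Pair} (p q : ℂ⟦X⟧) : minHom I J (p + q) = minHom I J p + minHom I J q :=
  ModuleCat.hom_ext (LinearMap.ext fun v => coord.injective (funext fun a => by
    rw [ModuleCat.hom_add, LinearMap.add_apply, map_add, Pi.add_apply]
    simp only [coord_minHom]
    ring))

lemma minHom_comp {I J K : Pair} (p q : ℂ⟦X⟧) :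
    minHom I J p ≫ minHom J K q = minHom I K (p * q * X ^ defect I J K) :=
  ModuleCat.hom_ext (LinearMap.ext fun v => coord.injective (funext fun a => by
    rw [ModuleCat.hom_comp, LinearMap.comp_apply]
    simp only [coord_minHom]
    have h := congrArg (fun n => (X : ℂ⟦X⟧) ^ n) (height_add_height I J K a)
    simp only [pow_add] at h
    linear_combination (p * q * coord v a) * h))

lemma minHom_one (I : Pair) : minHom I I 1 = 𝟙 _ :=
  ModuleCat.hom_ext (LinearMap.ext fun v => coord.injective (funext fun a => by
    rw [coord_minHom, height_self]
    simp))

lemma algebraMap_eq_ofPowerSeries (z : ℂ) :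
    algebraMap ℂ (CAlg 2 6) z = ofPowerSeries (PowerSeries.C z) := CAlg.ext fun m => by
  rw [ofPowerSeries_apply (f := Polynomial.C z), Polynomial.aeval_C]
  · rfl
  · intro d _
    rw [coeff_C, Polynomial.coeff_C]

lemma minHom_smul {I J : Pair} (z : ℂ) (p : ℂ⟦X⟧) : minHom I J (z • p) = z • minHom I J p :=
  ModuleCat.hom_ext (LinearMap.ext fun v => coord.injective (funext fun a => by
    have h : (z • minHom I J p).hom v = algebraMap ℂ (CAlg 2 6) z • (minHom I J p).hom v := rfl
    rw [h, algebraMap_eq_ofPowerSeries, ← powerSeries_smul_def, map_smul, Pi.smul_apply]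
    simp only [coord_minHom]
    rw [smul_eq_C_mul, smul_eq_mul]
    ring))

/-- The homomorphisms `M_I → M_J` are the multiples of the minimal one. -/
def minHomEquiv (I J : Pair) : ℂ⟦X⟧ ≃ₗ[ℂ] (rankOneModule I ⟶ rankOneModule J) :=
  LinearEquiv.ofBijective
    { toFun := minHom I J, map_add' := minHom_add, map_smul' := minHom_smul }
    ⟨minHom_injective, minHom_surjective⟩

/-! ### Short exact sequences with rank one end terms -/

/-- The square of minimal homomorphisms from `M_J` through `M_K` and `M_L` to `M_I` commutes, and at
each vertex one of the two maps out of `M_J` and one of the two maps into `M_I` is the identity.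
Then `M_J → M_K ⊕ M_L → M_I` is a short exact sequence. -/
def IsExactSquare (J K L I : Pair) : Prop :=
  ∀ a, (height J K a = 0 ∨ height J L a = 0) ∧ (height K I a = 0 ∨ height L I a = 0) ∧
    height J K a + height K I a = height J L a + height L I a

lemma IsExactSquare.defect_eq {J K L I : Pair} (h : IsExactSquare J K L I) :
    defect J K I = defect J L I := by
  have h1 := height_add_height J K I 0
  have h2 := height_add_height J L I 0
  have h3 := (h 0).2.2
  omega

/-- The homomorphism `M_J → M_K ⊕ M_L` of a square. -/
def squareLift (J K L : Pair) : rankOneModule J ⟶ rankOneModule K ⊞ rankOneModule L :=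
  biprod.lift (minHom J K 1) (minHom J L 1)

/-- The homomorphism `M_K ⊕ M_L → M_I` of a square, with a sign to make the square a complex. -/
def squareDesc (K L I : Pair) : rankOneModule K ⊞ rankOneModule L ⟶ rankOneModule I :=
  biprod.desc (minHom K I 1) (minHom L I (-1))

lemma squareLift_comp_squareDesc {J K L I : Pair} (h : IsExactSquare J K L I) :
    squareLift J K L ≫ squareDesc K L I = 0 := by
  rw [squareLift, squareDesc, biprod.lift_desc, minHom_comp, minHom_comp, h.defect_eq, ← minHom_add]
  simp only [mul_one, one_mul, neg_mul, add_neg_cancel]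
  exact map_zero (minHomEquiv J I)

/-- The complex `M_J → M_K ⊕ M_L → M_I` of an exact square. -/
abbrev squareComplex {J K L I : Pair} (h : IsExactSquare J K L I) :
    ShortComplex (ModuleCat.{0} (CAlg 2 6)) :=
  ShortComplex.mk (squareLift J K L) (squareDesc K L I) (squareLift_comp_squareDesc h)

lemma biprod_total_apply {M N : ModuleCat.{0} (CAlg 2 6)} (x : (M ⊞ N : ModuleCat.{0} (CAlg 2 6))) :
    (biprod.inl : M ⟶ M ⊞ N).hom ((biprod.fst : M ⊞ N ⟶ M).hom x) +
      (biprod.inr : N ⟶ M ⊞ N).hom ((biprod.snd : M ⊞ N ⟶ N).hom x) = x :=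
  congrArg (fun f => f.hom x) (biprod.total (X := M) (Y := N))

lemma mono_minHom (I J : Pair) : Mono (minHom I J 1) :=
  (ModuleCat.mono_iff_injective _).mpr fun v w h => coord.injective (funext fun a => by
    have h1 := congrArg (fun m => coord m a) h
    simp only [coord_minHom, one_mul] at h1
    exact mul_left_cancel₀ (pow_ne_zero _ X_ne_zero) h1)

lemma squareComplex_shortExact {J K L I : Pair} (h : IsExactSquare J K L I) :
    (squareComplex h).ShortExact := by
  let inl : rankOneModule K ⟶ rankOneModule K ⊞ rankOneModule L := biprod.inl
  let inr : rankOneModule L ⟶ rankOneModule K ⊞ rankOneModule L := biprod.inr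
  have hinl : ∀ u, (squareDesc K L I).hom (inl.hom u) = (minHom K I 1).hom u := fun u =>
    congrArg (fun f => f.hom u) (biprod.inl_desc (minHom K I 1) (minHom L I (-1)))
  have hinr : ∀ u, (squareDesc K L I).hom (inr.hom u) = (minHom L I (-1)).hom u := fun u =>
    congrArg (fun f => f.hom u) (biprod.inr_desc (minHom K I 1) (minHom L I (-1)))
  have hlift : ∀ w, (squareLift J K L).hom w =
      inl.hom ((minHom J K 1).hom w) + inr.hom ((minHom J L 1).hom w) := fun w => by
    rw [← biprod_total_apply ((squareLift J K L).hom w)]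
    congr 2
    · exact congrArg (fun f => f.hom w) (biprod.lift_fst (minHom J K 1) (minHom J L 1))
    · exact congrArg (fun f => f.hom w) (biprod.lift_snd (minHom J K 1) (minHom J L 1))
  refine { exact := ?_, mono_f := ?_, epi_g := ?_ }
  · rw [ShortComplex.moduleCat_exact_iff]
    intro (x : (rankOneModule K ⊞ rankOneModule L : ModuleCat.{0} (CAlg 2 6)))
      (hx : (squareDesc K L I).hom x = 0)
    obtain ⟨u, v, rfl⟩ : ∃ u v, inl.hom u + inr.hom v = x :=
      ⟨_, _, biprod_total_apply x⟩
    rw [map_add, hinl, hinr] at hx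
    have huv : ∀ a, X ^ height K I a * coord u a = X ^ height L I a * coord v a := fun a => by
      have := congrArg (fun m => coord m a) hx
      simp only [map_add, Pi.add_apply, coord_minHom, one_mul, neg_mul, map_zero,
        Pi.zero_apply] at this
      rwa [add_neg_eq_zero] at this
    have hw : ∀ a, ∃ w, X ^ height J K a * w = coord u a ∧ X ^ height J L a * w = coord v a := by
      intro a
      obtain ⟨h1, h2, h3⟩ := h a
      have h4 := huv a
      rcases h2 with h2 | h2
      · refine ⟨coord v a, ?_, ?_⟩
        · rw [h2, pow_zero, one_mul] at h4
          rw [h4]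
          congr 2
          omega
        · rw [show height J L a = 0 by omega, pow_zero, one_mul]
      · refine ⟨coord u a, ?_, ?_⟩
        · rw [show height J K a = 0 by omega, pow_zero, one_mul]
        · rw [h2, pow_zero, one_mul] at h4
          rw [← h4]
          congr 2
          omega
    choose w hw1 hw2 using hw
    refine ⟨coord.symm w, (hlift _).trans ?_⟩
    congr 2
    · refine coord.injective (funext fun a => ?_)
      rw [coord_minHom, one_mul, LinearEquiv.apply_symm_apply, hw1]
    · refine coord.injective (funext fun a => ?_)
      rw [coord_minHom, one_mul, LinearEquiv.apply_symm_apply, hw2]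
  · have := mono_minHom J K
    exact mono_of_mono_fac (biprod.lift_fst (minHom J K 1) (minHom J L 1))
  · rw [ModuleCat.epi_iff_surjective]
    intro (v : rankOneModule I)
    refine ⟨inl.hom
      (coord.symm fun a => if height K I a = 0 then coord v a else 0) +
      inr.hom
      (coord.symm fun a => if height K I a = 0 then 0 else -coord v a), ?_⟩
    refine ((squareDesc K L I).hom.map_add _ _).trans ?_
    rw [hinl, hinr]
    refine coord.injective (funext fun a => ?_)
    rw [map_add, Pi.add_apply, coord_minHom, coord_minHom, LinearEquiv.apply_symm_apply,
      LinearEquiv.apply_symm_apply]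
    by_cases h3 : height K I a = 0
    · simp [h3]
    · have h4 := (h a).2.1.resolve_left h3
      simp [h3, h4]

/-! ### Projective modules -/

/-- The two-element subset `{i - 1, i}`. -/
def consecutive (i : ZMod 6) : Pair :=
  ⟨{i - 1, i}, Finset.card_pair (by revert i; decide)⟩

lemma add_mem_consecutive (i c : ZMod 6) : i + c ∈ (consecutive i).1 ↔ c = 5 ∨ c = 0 := by
  unfold consecutive
  revert c i
  decide

/-- The module `M_{i-1,i}` is generated by its basis vector at `i`. -/
lemma cW_smul_basisVec (i c : ZMod 6) :
    cW c • basisVec (consecutive i) i = basisVec (consecutive i) (i + c) := by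
  by_cases hc : c = 5
  · subst hc
    have h : cY • basisVec (consecutive i) i = _ := cY_smul_basisVec _ i
    rw [yFactor, if_pos (by simpa using add_mem_consecutive i 0), one_smul] at h
    exact h.trans (congrArg _ (by rw [sub_eq_add_neg]; rfl))
  · have key : ∀ n : ℕ, n < 5 →
        cX ^ n • basisVec (consecutive i) i = basisVec (consecutive i) (i + n) := fun n hn => by
      induction n with
      | zero => simp
      | succ n ih =>
        have h := cX_smul_basisVec (consecutive i) (i + (n + 1 : ℕ))
        have h1 : i + ((n + 1 : ℕ) : ZMod 6) - 1 = i + n := by push_cast; ring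
        rw [xFactor, if_neg, one_smul, h1] at h
        · rw [pow_succ', mul_smul, ih (by omega), h]
        · rw [add_mem_consecutive]
          have hn' : n < 4 := by omega
          interval_cases n <;> decide
    have h := key c.val (by
      have := ZMod.val_lt c
      have : c.val ≠ 5 := fun h => hc (by rw [← ZMod.natCast_zmod_val c, h]; rfl)
      omega)
    rw [ZMod.natCast_zmod_val] at h
    rw [← h, cW, preW, if_neg hc, map_pow]
    rfl

/-- The module `M_{i-1,i}` is the projective module `C_{2,6} e_i`. -/
instance projective_consecutive (i : ZMod 6) : Projective (rankOneModule (consecutive i)) where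
  factors {E Z} f π hπ := by
    obtain ⟨u', hu'⟩ := (ModuleCat.epi_iff_surjective π).mp hπ (f.hom (basisVec _ i))
    set u := cE i • u' with hu
    have hπu : π.hom u = f.hom (basisVec _ i) := by
      rw [hu, map_smul]
      refine (congrArg (fun z => cE i • z) hu').trans ?_
      rw [← map_smul, cE_smul_basisVec]
    -- The vector at the vertex `a` is obtained from `u` along the shortest path from `i` to `a`.
    let w : ZMod 6 → E := fun a => cW (a - i) • u
    have hE : ∀ a, cE a • w a = w a := fun a => by
      simp only [w, hu, smul_smul]
      rw [cW_mul_cE, add_sub_cancel, ← mul_assoc, cE_mul_self]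
    have hX : ∀ a, cX • w (a - 1) = xFactor (consecutive i) a • w a := fun a => by
      obtain ⟨c, rfl⟩ : ∃ c, a = i + c := ⟨a - i, by ring⟩
      have h1 : i + c - 1 - i = c - 1 := by ring
      have h2 : (c - 1 = 4 ∨ c - 1 = 5) ↔ (c = 5 ∨ c = 0) := by
        clear h1; revert c; decide
      simp only [w, h1, smul_smul, cX_mul_cW, xFactor, add_mem_consecutive, h2,
        sub_add_cancel, add_sub_cancel_left]
      split_ifs
      · rw [mul_smul, powerSeries_smul_def]
      · rw [one_smul]
    have hY : ∀ a, cY • w a = yFactor (consecutive i) a • w (a - 1) := fun a => by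
      obtain ⟨c, rfl⟩ : ∃ c, a = i + c := ⟨a - i, by ring⟩
      have h1 : i + c - 1 - i = c - 1 := by ring
      simp only [w, h1, smul_smul, cY_mul_cW, yFactor, add_mem_consecutive, add_sub_cancel_left]
      split_ifs
      · rw [one_smul]
      · rw [mul_smul, powerSeries_smul_def]
    refine ⟨fromRankOne w hE hX hY, rankOneModule_hom_ext fun a => ?_⟩
    have h : (fromRankOne w hE hX hY).hom (basisVec (consecutive i) a) = w a := by
      rw [fromRankOne_apply, coord_basisVec, Finset.sum_eq_single a]
      · rw [Pi.single_eq_same, one_smul]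
      · intro b _ hb
        rw [Pi.single_eq_of_ne hb, zero_smul]
      · simp
    refine (congrArg π.hom h).trans ?_
    rw [map_smul, hπu, ← map_smul, cW_smul_basisVec, add_sub_cancel]

end

end GrassmannianCluster

/-! ### Extension groups and lifting -/

namespace ARTheory

universe w v u

variable {A : Type u} [Category.{v} A] [Abelian A]

/-- A retract of an object of an abelian category is a direct summand. -/
lemma exists_iso_biprod_of_retract {X Y : A} (r : Retract X Y) :
    ∃ Z : A, Nonempty (Y ≅ X ⊞ Z) := by
  have : IsSplitEpi r.r := ⟨⟨r.splitEpi⟩⟩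
  have hS : (ShortComplex.mk (kernel.ι r.r) r.r (kernel.condition _)).Exact :=
    ShortComplex.exact_kernel r.r
  let s := ShortComplex.Splitting.ofExactOfSection _ hS r.i r.retract inferInstance
  exact ⟨kernel r.r, ⟨s.isoBinaryBiproduct ≪≫ biprod.braiding _ _⟩⟩

section

variable [HasExt.{w} A]

open Abelian

/-- If `Ext¹(W, S.X₁) = 0`, then every morphism `W ⟶ S.X₃` lifts to `S.X₂`. -/
lemma exists_lift_of_subsingleton_ext {S : ShortComplex A} (hS : S.ShortExact) {W : A}
    (h : Subsingleton (Ext.{w} W S.X₁ 1)) (f : W ⟶ S.X₃) : ∃ g : W ⟶ S.X₂, g ≫ S.g = f := by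
  obtain ⟨g, hg⟩ := Ext.covariant_sequence_exact₃ W hS (Ext.mk₀ f) (zero_add 1)
    (Subsingleton.elim _ _)
  obtain ⟨g, rfl⟩ := (Ext.mk₀_bijective W S.X₂).2 g
  rw [Ext.mk₀_comp_mk₀] at hg
  exact ⟨g, (Ext.mk₀_bijective W S.X₃).1 hg⟩

/-- If `Ext¹(S.X₃, W) = 0`, then every morphism `S.X₁ ⟶ W` extends to `S.X₂`. -/
lemma exists_extension_of_subsingleton_ext {S : ShortComplex A} (hS : S.ShortExact) {W : A}
    (h : Subsingleton (Ext.{w} S.X₃ W 1)) (f : S.X₁ ⟶ W) : ∃ g : S.X₂ ⟶ W, S.f ≫ g = f := by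
  obtain ⟨g, hg⟩ := Ext.contravariant_sequence_exact₁ hS W (Ext.mk₀ f) (add_zero 1)
    (Subsingleton.elim _ _)
  obtain ⟨g, rfl⟩ := (Ext.mk₀_bijective S.X₂ W).2 g
  rw [Ext.mk₀_comp_mk₀] at hg
  exact ⟨g, (Ext.mk₀_bijective S.X₁ W).1 hg⟩

/-- A short exact sequence with `Ext¹(S.X₃, S.X₁) = 0` splits. -/
lemma nonempty_splitting_of_subsingleton_ext {S : ShortComplex A} (hS : S.ShortExact)
    (h : Subsingleton (Ext.{w} S.X₃ S.X₁ 1)) : Nonempty S.Splitting := by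
  obtain ⟨s, hs⟩ := exists_lift_of_subsingleton_ext hS h (𝟙 _)
  exact ⟨ShortComplex.Splitting.ofExactOfSection S hS.exact s hs hS.mono_f⟩

/-- `Ext¹(S.X₃, W) = 0` if `S.X₂` is projective and every morphism `S.X₁ ⟶ W` extends to
`S.X₂`. -/
lemma subsingleton_ext_of_projective {S : ShortComplex A} (hS : S.ShortExact) [Projective S.X₂]
    {W : A} (h : ∀ f : S.X₁ ⟶ W, ∃ g : S.X₂ ⟶ W, S.f ≫ g = f) :
    Subsingleton (Ext.{w} S.X₃ W 1) := by
  refine subsingleton_of_forall_eq 0 fun x => ?_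
  obtain ⟨f, rfl⟩ := Ext.contravariant_sequence_exact₃ hS W x (Ext.eq_zero_of_projective _)
    (add_zero 1)
  obtain ⟨f, rfl⟩ := (Ext.mk₀_bijective S.X₁ W).2 f
  obtain ⟨g, rfl⟩ := h f
  rw [← Ext.mk₀_comp_mk₀, hS.extClass_comp_assoc]

lemma subsingleton_ext_of_retract_left {X X' Y : A} (r : Retract X X')
    (h : Subsingleton (Ext.{w} X' Y 1)) : Subsingleton (Ext.{w} X Y 1) := by
  refine subsingleton_of_forall_eq 0 fun x => ?_
  rw [← Ext.mk₀_id_comp x, ← r.retract, ← Ext.mk₀_comp_mk₀_assoc,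
    Subsingleton.elim ((Ext.mk₀ r.r).comp x (zero_add 1)) 0, Ext.comp_zero]

lemma subsingleton_ext_of_retract_right {X Y Y' : A} (r : Retract Y Y')
    (h : Subsingleton (Ext.{w} X Y' 1)) : Subsingleton (Ext.{w} X Y 1) := by
  refine subsingleton_of_forall_eq 0 fun x => ?_
  rw [← Ext.comp_mk₀_id x, ← r.retract, ← Ext.mk₀_comp_mk₀,
    ← Ext.comp_assoc_of_third_deg_zero,
    Subsingleton.elim (x.comp (Ext.mk₀ r.i) (add_zero 1)) 0, Ext.zero_comp]

attribute [local instance] Abelian.hasFiniteBiproducts in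
/-- Membership in `M^{⊥₁}` can be tested on `M`. -/
lemma rightPerp_iff (P : ObjectProperty A) (M Y : A) :
    rightPerp.{u, v, w} P M Y ↔ P Y ∧ Subsingleton (Ext.{w} M Y 1) := by
  constructor
  · rintro ⟨h, h'⟩
    exact ⟨h, h' M ⟨1, ⟨⟨biproduct.ι (fun _ : Fin 1 => M) 0, biproduct.π _ 0, by simp⟩⟩⟩⟩
  · rintro ⟨h, h'⟩
    refine ⟨h, fun X ⟨m, ⟨r⟩⟩ => subsingleton_ext_of_retract_left r ?_⟩
    exact (Ext.biproductAddEquiv (biproduct.isBilimit fun _ : Fin m => M) Y 1).subsingleton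

end

end ARTheory

namespace GrassmannianCluster

noncomputable section

/-! ### Rank one direct summands of Cohen–Macaulay modules -/

section Summand

variable {M : ModuleCat.{0} (CAlg 2 6)}

lemma cX_pow_six_smul (m : M) : cX ^ 6 • m = (X : ℂ⟦X⟧) • (X : ℂ⟦X⟧) • m := by
  have h : cX ^ 6 = ofPowerSeries X * ofPowerSeries X := by
    have h1 : Commute cX cY := cX_mul_cY
    rw [ofPowerSeries_X, ← sq, h1.mul_pow, cY_sq, ← pow_add]
  rw [h, mul_smul, powerSeries_smul_def, powerSeries_smul_def]

lemma cX_pow_five_smul (m : M) : cX ^ 5 • m = (X : ℂ⟦X⟧) • cY • m := by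
  have h : cX ^ 5 = ofPowerSeries X * cY := by
    rw [ofPowerSeries_X, mul_assoc, ← sq, cY_sq, ← pow_succ']
  rw [h, mul_smul, powerSeries_smul_def]

/-- In a finite torsion-free module, a vector that is not divisible by `t` has value `1` under
some functional. -/
lemma exists_functional [Module.Finite ℂ⟦X⟧ M] [Module.IsTorsionFree ℂ⟦X⟧ M] {m : M}
    (hm : ∀ m', m ≠ (X : ℂ⟦X⟧) • m') : ∃ φ : M →ₗ[ℂ⟦X⟧] ℂ⟦X⟧, φ m = 1 := by
  let b := Module.Free.chooseBasis ℂ⟦X⟧ M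
  have h : ∃ j, ¬ (X : ℂ⟦X⟧) ∣ b.repr m j := by
    by_contra! h
    choose c hc using h
    refine hm (∑ j, c j • b j) ?_
    rw [Finset.smul_sum, ← b.sum_repr m]
    exact Finset.sum_congr rfl fun j _ => by rw [smul_smul, ← hc]
  obtain ⟨j, hj⟩ := h
  have hu : IsUnit (b.repr m j) := by
    rw [isUnit_iff_constantCoeff, isUnit_iff_ne_zero]
    rwa [X_dvd_iff] at hj
  obtain ⟨v, hv⟩ := hu.exists_left_inv
  exact ⟨v • b.coord j, by simpa using hv⟩

/-- Division by `t` of an endomorphism with image in `tM`. -/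
lemma exists_linear_div_X [Module.IsTorsionFree ℂ⟦X⟧ M] (f : M →ₗ[ℂ⟦X⟧] M)
    (h : ∀ m, ∃ m', f m = (X : ℂ⟦X⟧) • m') :
    ∃ g : M →ₗ[ℂ⟦X⟧] M, ∀ m, (X : ℂ⟦X⟧) • g m = f m := by
  choose g hg using h
  have hinj := smul_right_injective M (X_ne_zero (R := ℂ))
  exact ⟨{ toFun := g
           map_add' := fun m n => hinj (by simp only [smul_add, ← hg, map_add])
           map_smul' := fun p m => hinj (by
            simp only [RingHom.id_apply]
            rw [smul_comm, ← hg, ← hg, map_smul]) }, fun m => (hg m).symm⟩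

lemma cE_smul_cX_pow_smul (s : ℕ) (a : ZMod 6) (m : M) :
    cX ^ s • cE a • m = cE (a + s) • cX ^ s • m := by
  induction s generalizing a m with
  | zero => simp
  | succ s ih =>
    rw [pow_succ, mul_smul, mul_smul, ← mul_smul cX, cX_mul_cE, mul_smul, ih]
    push_cast
    rw [add_assoc, add_comm 1 (s : ZMod 6)]

/-- The power `x ^ s` maps `M` to `tM`. -/
def IsDivisible (M : ModuleCat.{0} (CAlg 2 6)) (s : ℕ) : Prop :=
  ∀ m : M, ∃ m', cX ^ s • m = (X : ℂ⟦X⟧) • m'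

lemma IsDivisible.mono {s s' : ℕ} (h : IsDivisible M s) (hs : s ≤ s') : IsDivisible M s' :=
  fun m => by
    obtain ⟨m', hm'⟩ := h (cX ^ (s' - s) • m)
    exact ⟨m', by rw [← hm', ← mul_smul, ← pow_add, Nat.add_sub_cancel' hs]⟩

lemma isDivisible_five : IsDivisible M 5 := fun m => ⟨_, cX_pow_five_smul m⟩

/-- Since `x ^ 6 = t ^ 2`, the square of `x` is not divisible by `t` on a nonzero module. -/
lemma not_isDivisible_two [Module.Finite ℂ⟦X⟧ M] [Module.IsTorsionFree ℂ⟦X⟧ M] [Nontrivial M] :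
    ¬ IsDivisible M 2 := fun h => by
  have hdiv : ∀ m : M, ∃ m', m = (X : ℂ⟦X⟧) • m' := fun m => by
    obtain ⟨m1, h1⟩ := h m
    obtain ⟨m2, h2⟩ := h m1
    obtain ⟨m3, h3⟩ := h m2
    have h6 : cX ^ 6 • m = (X : ℂ⟦X⟧) • (X : ℂ⟦X⟧) • (X : ℂ⟦X⟧) • m3 := by
      have h7 : cX ^ 6 = cX ^ 2 * (cX ^ 2 * cX ^ 2) := by rw [← pow_add, ← pow_add]
      rw [h7, mul_smul, mul_smul, h1, CAlg_smul_comm,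
        h2, CAlg_smul_comm, CAlg_smul_comm, h3]
    rw [cX_pow_six_smul] at h6
    have hinj := smul_right_injective M (X_ne_zero (R := ℂ))
    exact ⟨m3, hinj (hinj h6)⟩
  let b := Module.Free.chooseBasis ℂ⟦X⟧ M
  obtain ⟨j⟩ := b.index_nonempty
  obtain ⟨m', hm'⟩ := hdiv (b j)
  have h1 := congrArg (fun m => b.repr m j) hm'
  simp only [Module.Basis.repr_self, Finsupp.single_eq_same, map_smul, Finsupp.smul_apply,
    smul_eq_mul] at h1
  exact X_prime.not_isUnit (IsUnit.of_mul_eq_one _ h1.symm)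

/-- A nonzero Cohen–Macaulay module has a direct summand of the form `M_I`. If `k` is the largest
exponent for which `x ^ k` is not divisible by `t`, and `u` is a vector at the vertex `i` for which
`x ^ k u` is not divisible by `t`, then `u` generates a direct summand `M_{i,i+k+1}`. -/
theorem exists_retract_rankOneModule [Module.Finite ℂ⟦X⟧ M] [Module.IsTorsionFree ℂ⟦X⟧ M]
    [Nontrivial M] : ∃ I : Pair, Nonempty (Retract (rankOneModule I) M) := by
  obtain ⟨k, hk4, hk, hk1⟩ : ∃ k ≤ 4, ¬ IsDivisible M k ∧ IsDivisible M (k + 1) := by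
    by_cases h4 : IsDivisible M 4
    · by_cases h3 : IsDivisible M 3
      · exact ⟨2, by omega, not_isDivisible_two, h3⟩
      · exact ⟨3, by omega, h3, h4⟩
    · exact ⟨4, by omega, h4, isDivisible_five⟩
  have hinj := smul_right_injective M (X_ne_zero (R := ℂ))
  obtain ⟨i, u, hu, hdiv⟩ : ∃ (i : ZMod 6) (u : M), cE i • u = u ∧
      ∀ m', cX ^ k • u ≠ (X : ℂ⟦X⟧) • m' := by
    by_contra! h
    refine hk fun m => ?_
    choose g hg using fun i => h i (cE i • m) (by rw [← mul_smul, cE_mul_self])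
    refine ⟨∑ i, g i, ?_⟩
    rw [Finset.smul_sum, ← Finset.sum_congr rfl fun i _ => hg i, ← Finset.smul_sum,
      ← Finset.sum_smul, sum_cE, one_smul]
  obtain ⟨φ, hφ⟩ := exists_functional hdiv
  -- The endomorphism `x ^ s`, divided by `t` if this is possible.
  have hD : ∀ s, ∃ D : M →ₗ[ℂ⟦X⟧] M,
      ∀ m, (if s ≤ k then (1 : ℂ⟦X⟧) else X) • D m = cX ^ s • m := fun s => by
    by_cases hs : s ≤ k
    · exact ⟨smulLinear M (cX ^ s), fun m => by rw [if_pos hs, one_smul]; rfl⟩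
    · obtain ⟨D, hD⟩ := exists_linear_div_X (smulLinear M (cX ^ s)) (hk1.mono (by omega))
      exact ⟨D, fun m => by rw [if_neg hs, hD]; rfl⟩
  choose D' hD' using hD
  let D : ZMod 6 → M →ₗ[ℂ⟦X⟧] M := fun c => D' c.val
  have hfac : ∀ s, Function.Injective
      fun m : M => (if s ≤ k then (1 : ℂ⟦X⟧) else X) • m := fun s => by
    refine smul_right_injective M ?_
    split_ifs <;> simp [X_ne_zero]
  have hD0 : ∀ m, D 0 m = m := fun m => by
    have := hD' 0 m
    rwa [if_pos (by omega), one_smul, pow_zero, one_smul] at this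
  have hDk : ∀ m, D k m = cX ^ k • m := fun m => by
    have hv : (k : ZMod 6).val = k := ZMod.val_cast_of_lt (by omega)
    have := hD' k m
    rw [if_pos le_rfl, one_smul] at this
    change D' (k : ZMod 6).val m = _
    rw [hv, this]
  have hDX : ∀ c m, D c (cX • m) = cX • D c m := fun c m => hfac c.val (by
    dsimp only
    rw [hD', ← CAlg_smul_comm, hD', ← mul_smul, ← mul_smul, ← pow_succ, ← pow_succ'])
  have hDE : ∀ c a m, D c (cE a • m) = cE (a + c) • D c m := fun c a m => hfac c.val (by
    dsimp only
    rw [hD', ← CAlg_smul_comm, hD', cE_smul_cX_pow_smul, ZMod.natCast_zmod_val])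
  -- Passing from `x ^ c` to `x ^ (c + 1)` produces a factor `t` when the division by `t` sets in,
  -- and when `x ^ 6 / t` is replaced by `t = t x ^ 0`.
  have hstep : ∀ c m, D c (cX • m) = (if c = k ∨ c = 5 then (X : ℂ⟦X⟧) else 1) • D (c + 1) m := by
    intro c m
    have hck : c = k ↔ c.val = k := by
      constructor
      · rintro rfl; exact ZMod.val_cast_of_lt (by omega)
      · intro h; rw [← h, ZMod.natCast_zmod_val]
    refine hfac c.val ?_
    dsimp only
    rw [hD', ← mul_smul, ← pow_succ]
    by_cases hc : c = 5
    · subst hc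
      have h5 : (5 : ZMod 6).val = 5 := rfl
      rw [if_pos (Or.inr rfl), show (5 : ZMod 6) + 1 = 0 from rfl, hD0, h5, if_neg (by omega),
        cX_pow_six_smul]
    · have hv : (c + 1).val = c.val + 1 := by revert hc; clear hck; revert c; decide
      change _ = _ • _ • D' (c + 1).val m
      rw [hv, ← hD', smul_smul]
      congr 1
      simp only [hck, hc, or_false]
      by_cases h1 : c.val + 1 ≤ k
      · rw [if_pos h1, if_pos (by omega), if_neg (by omega), one_mul]
      · by_cases h2 : c.val = k
        · rw [if_neg h1, if_pos h2.le, if_pos h2, one_mul]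
        · rw [if_neg h1, if_neg (by omega), if_neg h2, mul_one]
  have hne : i ≠ i + k + 1 := fun h => by
    have h1 : ((k + 1 : ℕ) : ZMod 6) = 0 := by
      push_cast
      rwa [add_assoc, left_eq_add] at h
    have := congrArg ZMod.val h1
    rw [ZMod.val_cast_of_lt (by omega)] at this
    simp at this
  let I : Pair := ⟨{i, i + k + 1}, Finset.card_pair hne⟩
  have hmem : ∀ a, a ∈ I.1 ↔ a = i ∨ a = i + k + 1 := fun a => by simp [I]
  have hX : ∀ a, cX • D (a - 1 - i) u = xFactor I a • D (a - i) u := fun a => by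
    have h1 : (a - 1 - i = k ∨ a - 1 - i = 5) ↔ a ∈ I.1 := by
      rw [hmem, or_comm, sub_sub, sub_eq_iff_eq_add, sub_eq_iff_eq_add]
      refine or_congr ?_ ?_
      · rw [← add_assoc, show (5 : ZMod 6) + 1 = 0 from rfl, zero_add]
      · rw [← add_assoc, add_comm i (k : ZMod 6), add_right_comm]
    rw [← hDX, hstep, show a - 1 - i + 1 = a - i by ring]
    simp only [h1, xFactor]
  -- The basis vector at `a` is sent to the image of `u` under the shortest path from `i` to `a`.
  let f : rankOneModule I ⟶ M := fromRankOne (fun a => D (a - i) u)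
    (fun a => by
      conv_rhs => rw [← hu, hDE, add_sub_cancel])
    hX (fun a => cY_smul_eq_of_cX_smul_eq (hX a))
  -- The coordinate at `a` is `φ` after the shortest path from `a` to `i + k`, the vertex of
  -- `x ^ k u`.
  let g : M ⟶ rankOneModule I := toRankOne
    (fun a => φ ∘ₗ D (i + k - a) ∘ₗ smulLinear M (cE a))
    (fun a m => by
      simp only [LinearMap.comp_apply]
      congr 2
      change cE a • cE a • m = cE a • m
      rw [← mul_smul, cE_mul_self])
    (fun a m => by
      have h1 : (i + k - a = k ∨ i + k - a = 5) ↔ a ∈ I.1 := by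
        rw [hmem]
        refine or_congr ?_ ?_
        · rw [sub_eq_iff_eq_add, add_comm, add_right_inj, eq_comm]
        · rw [sub_eq_iff_eq_add, ← sub_eq_iff_eq_add', eq_comm, sub_eq_add_neg]
          rfl
      simp only [LinearMap.comp_apply]
      change φ (D _ (cE a • cX • m)) = _ * φ (D _ (cE (a - 1) • m))
      have h2 : cE a • cX • m = cX • cE (a - 1) • m := by
        rw [← mul_smul, ← mul_smul, cX_mul_cE, sub_add_cancel]
      rw [h2, hstep, map_smul, smul_eq_mul, show i + k - a + 1 = i + k - (a - 1) by ring]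
      simp only [h1, xFactor])
  obtain ⟨p, hp⟩ := minHom_surjective (f ≫ g)
  have hp1 : p = 1 := by
    have h1 := congrArg (fun h => coord (h.hom (basisVec I i)) i) hp
    simp only [coord_minHom, height_self, pow_zero, mul_one, coord_basisVec,
      Pi.single_eq_same] at h1
    rw [h1]
    have h2 : f.hom (basisVec I i) = u := by
      refine (fromRankOne_apply _ _ _ _ _).trans ?_
      rw [coord_basisVec, Finset.sum_eq_single i]
      · rw [Pi.single_eq_same, one_smul, sub_self, hD0]
      · intro b _ hb
        rw [Pi.single_eq_of_ne hb, zero_smul]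
      · simp
    change φ (D (i + k - i) (cE i • f.hom (basisVec I i))) = 1
    rw [h2, hu, add_sub_cancel_left, hDk, hφ]
  refine ⟨I, ⟨⟨f, g, ?_⟩⟩⟩
  rw [← hp, hp1, minHom_one]

end Summand

/-! ### Combinatorics of the vertices -/

namespace Vertex

/-- The list of all vertices. -/
def all : List Vertex := [m12, m13, m14, m15, m16, m23, m24, m34, m45, m46, m56]

/-- The position of a vertex in the list of all vertices. -/
def index : Vertex → Fin 11
  | m12 => 0 | m13 => 1 | m14 => 2 | m15 => 3 | m16 => 4 | m23 => 5
  | m24 => 6 | m34 => 7 | m45 => 8 | m46 => 9 | m56 => 10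

/-- The vertices are enumerated by `Fin 11`. -/
def equivFin : Vertex ≃ Fin 11 where
  toFun := index
  invFun a := all.get a
  left_inv v := by cases v <;> rfl
  right_inv a := by fin_cases a <;> rfl

instance : DecidableEq Vertex := equivFin.injective.decidableEq

instance : Fintype Vertex := Fintype.ofEquiv _ equivFin.symm

/-- The smaller element of the subset attached to a vertex, in `{1, …, 6}`. -/
def fst : Vertex → ZMod 6
  | m12 => 1 | m13 => 1 | m14 => 1 | m15 => 1 | m16 => 1 | m23 => 2
  | m24 => 2 | m34 => 3 | m45 => 4 | m46 => 4 | m56 => 5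

/-- The larger element of the subset attached to a vertex, in `{1, …, 6}`. -/
def snd : Vertex → ZMod 6
  | m12 => 2 | m13 => 3 | m14 => 4 | m15 => 5 | m16 => 6 | m23 => 3
  | m24 => 4 | m34 => 4 | m45 => 5 | m46 => 6 | m56 => 6

lemma fst_ne_snd (v : Vertex) : v.fst ≠ v.snd := by cases v <;> decide

/-- The subset attached to a vertex. -/
def pair (v : Vertex) : Pair := ⟨{v.fst, v.snd}, Finset.card_pair v.fst_ne_snd⟩

/-- The subset attached to a vertex, shifted by one. -/
def shift (v : Vertex) : Pair :=
  ⟨{v.fst - 1, v.snd - 1}, Finset.card_pair (by cases v <;> decide)⟩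

lemma module_eq (v : Vertex) : v.module = rankOneModule v.pair := by cases v <;> rfl

end Vertex

instance (J K L I : Pair) : Decidable (IsExactSquare J K L I) := by
  unfold IsExactSquare; infer_instance

/-- The projective presentation of the module attached to a vertex. -/
lemma isExactSquare_shift : ∀ v : Vertex,
    IsExactSquare v.shift (consecutive v.fst) (consecutive v.snd) v.pair := by
  decide +kernel

instance : DecidableRel Translate := fun i j =>
  decidable_of_iff ((i = .m46 ∧ j = .m15) ∨ (i = .m15 ∧ j = .m46) ∨ (i = .m13 ∧ j = .m24) ∨
    (i = .m24 ∧ j = .m13)) (by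
      constructor
      · rintro (⟨rfl, rfl⟩ | ⟨rfl, rfl⟩ | ⟨rfl, rfl⟩ | ⟨rfl, rfl⟩) <;> constructor
      · rintro (_ | _ | _ | _) <;> simp)

/-- Homomorphisms from the first term of the presentation of `M_I` to `M_J` extend to one of the two
projective summands, unless `I` and `J` cross. -/
lemma defect_shift_eq_zero : ∀ v w : Vertex, ¬ Translate v w →
    defect v.shift (consecutive v.fst) w.pair = 0 ∨
      defect v.shift (consecutive v.snd) w.pair = 0 := by
  decide +kernel

/-- Every two-element subset either belongs to a vertex, or is the first term of a non-split exact
square ending in `{1, 4}`. -/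
lemma exists_pair_eq_or_isExactSquare : ∀ (a b : ZMod 6) (h : a ≠ b),
    (∃ v : Vertex, v.pair.1 = {a, b}) ∨ ∃ K L : Vertex, K.pair ≠ Vertex.m14.pair ∧
      L.pair ≠ Vertex.m14.pair ∧
      IsExactSquare ⟨{a, b}, Finset.card_pair h⟩ K.pair L.pair Vertex.m14.pair := by
  decide +kernel

/-- The radical of `Hom(M_I, M_J)` consists of the multiples of `t ^ radExp I J` times the minimal
homomorphism. -/
def radExp (I J : Pair) : ℕ := if I = J then 1 else 0

lemma pair_injective : Function.Injective Vertex.pair := by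
  unfold Function.Injective
  decide +kernel

namespace Vertex

/-- The targets of the arrows of the quiver starting in a vertex. -/
def succ : Vertex → List Vertex
  | m12 => [m24, m16] | m13 => [m12, m34] | m14 => [m46, m13] | m15 => [m56, m14]
  | m16 => [m15] | m23 => [m13] | m24 => [m14, m23] | m34 => [m24] | m45 => [m15, m34]
  | m46 => [m16, m45] | m56 => [m46]

end Vertex

lemma nonempty_hom_iff (i j : Vertex) : Nonempty (i ⟶ j) ↔ j ∈ i.succ := by
  constructor
  · rintro ⟨a⟩
    change Arrow i j at a
    cases a <;> decide
  · intro h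
    cases i <;> fin_cases h <;> exact ⟨by constructor⟩

instance (i j : Vertex) : Subsingleton (i ⟶ j) :=
  ⟨fun a b => by
    change Arrow i j at a b
    cases a <;> cases b <;> rfl⟩

/-- Along an arrow, a composite of two radical homomorphisms through a vertex is divisible
by `t`. -/
lemma one_le_of_mem_succ : ∀ i j : Vertex, j ∈ i.succ → ∀ v : Vertex,
    1 ≤ radExp i.pair v.pair + radExp v.pair j.pair + defect i.pair v.pair j.pair := by
  decide +kernel

lemma ne_of_mem_succ : ∀ i j : Vertex, j ∈ i.succ → i ≠ j := by decide

/-- If there is no arrow, some vertex is such that the composites of two radical homomorphisms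
through it exhaust the radical. -/
lemma exists_eq_of_notMem_succ : ∀ i j : Vertex, j ∉ i.succ → ∃ v : Vertex,
    radExp i.pair v.pair + radExp v.pair j.pair + defect i.pair v.pair j.pair =
      radExp i.pair j.pair := by
  decide +kernel

namespace Vertex

/-- One of the two summands of the middle term of the Auslander–Reiten sequence ending in one of
the four vertices that have a translate; irrelevant for the other vertices. -/
def mesh₁ : Vertex → Vertex
  | m15 => m16 | m24 => m12 | _ => m14

/-- The other summand of the middle term of the Auslander–Reiten sequence. -/
def mesh₂ : Vertex → Vertex
  | m46 => m56 | m15 => m45 | m13 => m23 | _ => m34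

end Vertex

lemma isExactSquare_mesh : ∀ i j, Translate i j →
    IsExactSquare j.pair i.mesh₁.pair i.mesh₂.pair i.pair := by
  decide +kernel

lemma mesh_ne : ∀ i j, Translate i j → i.mesh₁.pair ≠ i.pair ∧ i.mesh₂.pair ≠ i.pair := by
  decide +kernel

/-- A radical homomorphism to the right-hand end of the Auslander–Reiten sequence factors through
one of the two middle summands. -/
lemma defect_mesh_right : ∀ i j, Translate i j → ∀ v : Vertex,
    defect v.pair i.mesh₁.pair i.pair ≤ radExp v.pair i.pair ∨
      defect v.pair i.mesh₂.pair i.pair ≤ radExp v.pair i.pair := by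
  decide +kernel

/-- A radical homomorphism from the left-hand end of the Auslander–Reiten sequence factors through
one of the two middle summands. -/
lemma defect_mesh_left : ∀ i j, Translate i j → ∀ v : Vertex,
    defect j.pair i.mesh₁.pair v.pair ≤ radExp j.pair v.pair ∨
      defect j.pair i.mesh₂.pair v.pair ≤ radExp j.pair v.pair := by
  decide +kernel

lemma boxed_iff (i : Vertex) : Boxed i ↔ ∀ j, ¬ Translate i j := by
  constructor
  · rintro (_ | _) j ⟨⟩
  · intro h
    cases i
    case m13 => exact (h _ .t13).elim
    case m15 => exact (h _ .t15).elim
    case m24 => exact (h _ .t24).elim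
    case m46 => exact (h _ .t46).elim
    all_goals constructor

lemma Translate.symm {i j : Vertex} (h : Translate i j) : Translate j i := by
  cases h <;> constructor

instance (i : Vertex) : Decidable (Boxed i) := decidable_of_iff _ (boxed_iff i).symm

lemma card_boxed : Fintype.card {i : Vertex // Boxed i} = 7 := by decide +kernel

end

end GrassmannianCluster

/-! ### The radical and isomorphism classes -/

namespace ARTheory

universe w v u

section

variable {A : Type u} [Category.{v} A]

/-- The isomorphism classes of a property are counted by a set of representatives. -/
lemma card_isoClasses {Q : ObjectProperty A} {V : Type} (rep : V → A) (hrep : ∀ i, Q (rep i))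
    (hQ : ∀ X, Q X → ∃ i, Nonempty (X ≅ rep i))
    (hinj : ∀ i j, Nonempty (rep i ≅ rep j) → i = j) : Nat.card (IsoClasses Q) = Nat.card V := by
  refine (Nat.card_eq_of_bijective
    (fun i : V => (Quotient.mk (isIsomorphicSetoid Q.FullSubcategory) ⟨rep i, hrep i⟩ :
      IsoClasses Q)) ⟨fun i j hij => ?_, fun c => ?_⟩).symm
  · obtain ⟨e⟩ := Quotient.exact hij
    exact hinj i j ⟨Q.ι.mapIso e⟩
  · induction c using Quotient.inductionOn with
    | h X =>
      obtain ⟨i, ⟨e⟩⟩ := hQ X.obj X.property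
      exact ⟨i, Quotient.sound ⟨Q.isoMk e.symm⟩⟩

end

section

variable {A : Type u} [Category.{v} A] [Abelian A]

lemma isIso_one_sub_comp_swap {X Y : A} (f : X ⟶ Y) (g : Y ⟶ X) (h : IsIso (𝟙 X - f ≫ g)) :
    IsIso (𝟙 Y - g ≫ f) := by
  set r := inv (𝟙 X - f ≫ g) with hr
  have h1 : r - f ≫ g ≫ r = 𝟙 X := by
    rw [← IsIso.hom_inv_id (𝟙 X - f ≫ g), Preadditive.sub_comp, Category.id_comp, Category.assoc]
  have h2 : r - r ≫ f ≫ g = 𝟙 X := by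
    rw [← IsIso.inv_hom_id (𝟙 X - f ≫ g), Preadditive.comp_sub, Category.comp_id]
  refine ⟨𝟙 Y + g ≫ r ≫ f, ?_, ?_⟩
  · have : g ≫ (r - f ≫ g ≫ r) ≫ f = g ≫ f := by rw [h1, Category.id_comp]
    simp only [Preadditive.sub_comp, Preadditive.comp_sub, Category.assoc, Preadditive.comp_add,
      Category.id_comp, Category.comp_id] at this ⊢
    rw [← this]
    abel
  · have : g ≫ (r - r ≫ f ≫ g) ≫ f = g ≫ f := by rw [h2, Category.id_comp]
    simp only [Preadditive.sub_comp, Preadditive.comp_sub, Category.assoc, Preadditive.add_comp,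
      Category.id_comp, Category.comp_id] at this ⊢
    rw [sub_eq_iff_eq_add] at this
    rw [this]
    abel

/-- An object without extensions by objects of `P` is projective in the exact category `P`. -/
lemma projectives_of_subsingleton_ext [HasExt.{w} A] {P : ObjectProperty A} {X : A} (hX : P X)
    (h : ∀ K, P K → Subsingleton (Abelian.Ext.{w} X K 1)) : projectives P X :=
  ⟨hX, fun _ _ _ ⟨K, _, _, hS⟩ f => exists_lift_of_subsingleton_ext hS.1 (h K hS.2.1) f⟩

/-- An object without extensions of objects of `P` by it is injective in the exact category `P`. -/
lemma injectives_of_subsingleton_ext [HasExt.{w} A] {P : ObjectProperty A} {X : A} (hX : P X)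
    (h : ∀ K, P K → Subsingleton (Abelian.Ext.{w} K X 1)) : injectives P X :=
  ⟨hX, fun _ _ _ ⟨K, _, _, hS⟩ f =>
    exists_extension_of_subsingleton_ext hS.1 (h K hS.2.2.2) f⟩

lemma not_projectives_of_isARSequence {P : ObjectProperty A} {S : ShortComplex A}
    (hS : IsARSequence P S) : ¬ projectives P S.X₃ := fun h => by
  obtain ⟨s, hs⟩ := h.2 S.g ⟨_, _, S.zero, hS.conflation⟩ (𝟙 _)
  exact hS.not_split.false (ShortComplex.Splitting.ofExactOfSection S hS.conflation.1.exact s hs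
    hS.conflation.1.mono_f)

lemma not_injectives_of_isARSequence {P : ObjectProperty A} {S : ShortComplex A}
    (hS : IsARSequence P S) : ¬ injectives P S.X₁ := fun h => by
  obtain ⟨r, hr⟩ := h.2 S.f ⟨_, _, S.zero, hS.conflation⟩ (𝟙 _)
  exact hS.not_split.false (ShortComplex.Splitting.ofExactOfRetraction S hS.conflation.1.exact r hr
    hS.conflation.1.epi_g)

lemma projectives_of_iso {P : ObjectProperty A} [P.IsClosedUnderIsomorphisms] {X Y : A} (e : X ≅ Y)
    (h : projectives P X) : projectives P Y :=
  ⟨P.prop_of_iso e h.1, fun _ _ p hp f => by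
    obtain ⟨g, hg⟩ := h.2 p hp (e.hom ≫ f)
    exact ⟨e.inv ≫ g, by rw [Category.assoc, hg, Iso.inv_hom_id_assoc]⟩⟩

end

section

variable {𝕜 : Type w} [Field 𝕜] {A : Type u} [Category.{v} A] [Abelian A] [Linear 𝕜 A]

lemma comp_mem_radical {X Y Z : A} {f : X ⟶ Y} (hf : f ∈ radical 𝕜 X Y) (g : Y ⟶ Z) :
    f ≫ g ∈ radical 𝕜 X Z := fun h => by
  rw [Category.assoc]
  exact hf _

lemma comp_mem_radical' {X Y Z : A} (f : X ⟶ Y) {g : Y ⟶ Z} (hg : g ∈ radical 𝕜 Y Z) :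
    f ≫ g ∈ radical 𝕜 X Z := fun h => by
  rw [Category.assoc]
  refine isIso_one_sub_comp_swap (g ≫ h) f ?_
  rw [Category.assoc]
  exact hg _

/-- A split monomorphism in the radical starts in a zero object. -/
lemma isZero_of_mem_radical_of_isSplitMono {X Y : A} {f : X ⟶ Y} (hf : f ∈ radical 𝕜 X Y)
    (h : IsSplitMono f) : IsZero X := by
  have := hf (retraction f)
  rw [IsSplitMono.id, sub_self] at this
  exact (IsZero.iff_id_eq_zero X).mpr (by rw [← IsIso.hom_inv_id (0 : X ⟶ X), zero_comp])

lemma isZero_of_mem_radical_of_isSplitEpi {X Y : A} {f : X ⟶ Y} (hf : f ∈ radical 𝕜 X Y)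
    (h : IsSplitEpi f) : IsZero Y := by
  have := isIso_one_sub_comp_swap _ _ (hf (section_ f))
  rw [IsSplitEpi.id, sub_self] at this
  exact (IsZero.iff_id_eq_zero Y).mpr (by rw [← IsIso.hom_inv_id (0 : Y ⟶ Y), zero_comp])

end

end ARTheory

namespace GrassmannianCluster

open ARTheory

noncomputable section

/-! ### The category `M_{14}^{⊥₁}` -/

lemma CM_of_retract {M N : ModuleCat.{0} (CAlg 2 6)} (r : Retract M N) (h : CM 2 6 N) :
    CM 2 6 M := by
  obtain ⟨h1, h2⟩ := (CM_iff N).mp h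
  have hri : ∀ m, r.r.hom (r.i.hom m) = m := fun m => congrArg (fun f => f.hom m) r.retract
  refine (CM_iff M).mpr ⟨?_, ?_⟩
  · exact Module.Finite.of_surjective (powerSeriesLinear r.r) fun m => ⟨r.i.hom m, hri m⟩
  · exact Function.Injective.moduleIsTorsionFree (powerSeriesLinear r.i)
      (Function.LeftInverse.injective hri) (map_smul _)

/-- The underlying `ℂ⟦t⟧`-module of a biproduct. -/
def biprodEquiv (M N : ModuleCat.{0} (CAlg 2 6)) :
    (M ⊞ N : ModuleCat.{0} (CAlg 2 6)) ≃ₗ[ℂ⟦X⟧] M × N where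
  __ := (powerSeriesLinear (biprod.fst : M ⊞ N ⟶ M)).prod (powerSeriesLinear biprod.snd)
  invFun x := (biprod.inl : M ⟶ M ⊞ N).hom x.1 + (biprod.inr : N ⟶ M ⊞ N).hom x.2
  left_inv x := biprod_total_apply x
  right_inv x := by
    have h1 : ∀ m, (biprod.fst : M ⊞ N ⟶ M).hom ((biprod.inl : M ⟶ M ⊞ N).hom m) = m :=
      fun m => congrArg (fun f : M ⟶ M => f.hom m) biprod.inl_fst
    have h2 : ∀ m, (biprod.snd : M ⊞ N ⟶ N).hom ((biprod.inl : M ⟶ M ⊞ N).hom m) = 0 :=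
      fun m => congrArg (fun f : M ⟶ N => f.hom m) biprod.inl_snd
    have h3 : ∀ m, (biprod.fst : M ⊞ N ⟶ M).hom ((biprod.inr : N ⟶ M ⊞ N).hom m) = 0 :=
      fun m => congrArg (fun f : N ⟶ M => f.hom m) biprod.inr_fst
    have h4 : ∀ m, (biprod.snd : M ⊞ N ⟶ N).hom ((biprod.inr : N ⟶ M ⊞ N).hom m) = m :=
      fun m => congrArg (fun f : N ⟶ N => f.hom m) biprod.inr_snd
    refine Prod.ext ?_ ?_
    · change (biprod.fst : M ⊞ N ⟶ M).hom (_ + _) = _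
      rw [map_add, h1, h3, add_zero]
    · change (biprod.snd : M ⊞ N ⟶ N).hom (_ + _) = _
      rw [map_add, h2, h4, zero_add]

lemma CM_biprod {M N : ModuleCat.{0} (CAlg 2 6)} (hM : CM 2 6 M) (hN : CM 2 6 N) :
    CM 2 6 (M ⊞ N) := by
  obtain ⟨h1, h2⟩ := (CM_iff M).mp hM
  obtain ⟨h3, h4⟩ := (CM_iff N).mp hN
  exact (CM_iff _).mpr ⟨Module.Finite.equiv (biprodEquiv M N).symm,
    Function.Injective.moduleIsTorsionFree (biprodEquiv M N) (biprodEquiv M N).injective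
      (map_smul _)⟩

lemma M14Perp_iff (M : ModuleCat.{0} (CAlg 2 6)) : M14Perp M ↔
    CM 2 6 M ∧ Subsingleton (Abelian.Ext (rankOneModule Vertex.m14.pair) M 1) :=
  rightPerp_iff _ _ _

lemma M14Perp_of_retract {M N : ModuleCat.{0} (CAlg 2 6)} (r : Retract M N) (h : M14Perp N) :
    M14Perp M := by
  rw [M14Perp_iff] at h ⊢
  exact ⟨CM_of_retract r h.1, subsingleton_ext_of_retract_right r h.2⟩

instance : M14Perp.IsClosedUnderIsomorphisms := ⟨fun e h => M14Perp_of_retract (.ofIso e.symm) h⟩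

lemma M14Perp_biprod {M N : ModuleCat.{0} (CAlg 2 6)} (hM : M14Perp M) (hN : M14Perp N) :
    M14Perp (M ⊞ N) := by
  rw [M14Perp_iff] at hM hN ⊢
  have := hM.2
  have := hN.2
  exact ⟨CM_biprod hM.1 hN.1, Abelian.Ext.addEquivBiprod.subsingleton⟩

lemma minHom_mul {I K J : Pair} {d : ℕ} (h : defect I K J = d) (p q : ℂ⟦X⟧) :
    minHom I K p ≫ minHom K J q = minHom I J (X ^ d * (p * q)) := by
  rw [minHom_comp, h, mul_comm]

/-- The group `Ext¹(M_I, M_J)` vanishes, unless `(I, J)` is one of the four crossing pairs. -/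
lemma subsingleton_ext_of_not_translate {v w : Vertex} (h : ¬ Translate v w) :
    Subsingleton (Abelian.Ext (rankOneModule v.pair) (rankOneModule w.pair) 1) := by
  have hS := squareComplex_shortExact (isExactSquare_shift v)
  have : Projective (squareComplex (isExactSquare_shift v)).X₂ :=
    inferInstanceAs (Projective (rankOneModule (consecutive v.fst) ⊞
      rankOneModule (consecutive v.snd)))
  refine subsingleton_ext_of_projective hS fun (f : rankOneModule _ ⟶ rankOneModule _) => ?_
  obtain ⟨p, rfl⟩ := minHom_surjective f
  rcases defect_shift_eq_zero v w h with h | h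
  · refine ⟨biprod.desc (minHom _ _ p) 0, biprod.lift_desc.trans ?_⟩
    rw [minHom_mul h, comp_zero, add_zero, pow_zero, one_mul,
      one_mul]
  · refine ⟨biprod.desc 0 (minHom _ _ p), biprod.lift_desc.trans ?_⟩
    rw [minHom_mul h, comp_zero, zero_add, pow_zero, one_mul,
      one_mul]

lemma M14Perp_vertex (v : Vertex) : M14Perp (rankOneModule v.pair) :=
  (M14Perp_iff _).mpr
    ⟨CM_rankOneModule _, subsingleton_ext_of_not_translate (by cases v <;> decide)⟩

lemma isEmpty_splitting_squareComplex {J K L I : Pair} (h : IsExactSquare J K L I) (hK : K ≠ I)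
    (hL : L ≠ I) : IsEmpty (squareComplex h).Splitting := ⟨fun s => by
  obtain ⟨p, hp⟩ := minHom_surjective (s.s ≫ biprod.fst : rankOneModule I ⟶ rankOneModule K)
  obtain ⟨q, hq⟩ := minHom_surjective (s.s ≫ biprod.snd : rankOneModule I ⟶ rankOneModule L)
  have h1 : s.s ≫ squareDesc K L I = 𝟙 (rankOneModule I) := s.s_g
  rw [squareDesc, biprod.desc_eq, Preadditive.comp_add, ← Category.assoc, ← Category.assoc, ← hp,
    ← hq, minHom_comp, minHom_comp, ← minHom_add, ← minHom_one] at h1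
  have h2 := congrArg constantCoeff (minHom_injective h1)
  have h3 := (defect_pos hK.symm).ne'
  have h4 := (defect_pos hL.symm).ne'
  simp [h3, h4] at h2⟩

/-- A rank one module in `M_{14}^{⊥₁}` is attached to a vertex: otherwise its subset crosses
`{1, 4}`, and there is a non-split extension of `M_{14}` by it. -/
lemma exists_vertex_of_M14Perp {I : Pair} (h : M14Perp (rankOneModule I)) :
    ∃ v : Vertex, v.pair = I := by
  obtain ⟨I, hI⟩ := I
  obtain ⟨a, b, hab, rfl⟩ := Finset.card_eq_two.mp hI
  rcases exists_pair_eq_or_isExactSquare a b hab with ⟨v, hv⟩ | ⟨K, L, hK, hL, hS⟩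
  · exact ⟨v, Subtype.ext hv⟩
  · obtain ⟨s⟩ := nonempty_splitting_of_subsingleton_ext (squareComplex_shortExact hS)
      ((M14Perp_iff _).mp h).2
    exact ((isEmpty_splitting_squareComplex hS hK hL).false s).elim

/-- A nonzero object of `M_{14}^{⊥₁}` has a direct summand attached to a vertex. -/
lemma exists_iso_biprod_of_M14Perp {M : ModuleCat.{0} (CAlg 2 6)} (h : M14Perp M)
    (h0 : ¬ IsZero M) : ∃ (v : Vertex) (Z : ModuleCat.{0} (CAlg 2 6)), M14Perp Z ∧
      Nonempty (M ≅ rankOneModule v.pair ⊞ Z) := by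
  obtain ⟨h1, h2⟩ := (CM_iff M).mp ((M14Perp_iff M).mp h).1
  have : Nontrivial M := by
    by_contra h3
    rw [not_nontrivial_iff_subsingleton] at h3
    exact h0 (ModuleCat.isZero_of_subsingleton M)
  obtain ⟨I, ⟨r⟩⟩ := exists_retract_rankOneModule (M := M)
  obtain ⟨v, rfl⟩ := exists_vertex_of_M14Perp (M14Perp_of_retract r h)
  obtain ⟨Z, ⟨e⟩⟩ := exists_iso_biprod_of_retract r
  refine ⟨v, Z, M14Perp_of_retract ?_ h, ⟨e⟩⟩
  exact ⟨biprod.inr ≫ e.inv, e.hom ≫ biprod.snd, by simp⟩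

/-- Every object of `M_{14}^{⊥₁}` is a finite direct sum of modules attached to vertices, stated as
an induction principle. -/
theorem M14Perp_induction {Φ : ModuleCat.{0} (CAlg 2 6) → Prop}
    (iso : ∀ {M N}, (M ≅ N) → Φ N → Φ M) (zero : ∀ M, IsZero M → Φ M)
    (summand : ∀ (v : Vertex) (Z), Φ Z → Φ (rankOneModule v.pair ⊞ Z))
    {M : ModuleCat.{0} (CAlg 2 6)} (h : M14Perp M) : Φ M := by
  induction hn : Module.finrank ℂ⟦X⟧ M using Nat.strong_induction_on generalizing M with
  | _ n ih =>
    by_cases h0 : IsZero M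
    · exact zero M h0
    obtain ⟨v, Z, hZ, ⟨e⟩⟩ := exists_iso_biprod_of_M14Perp h h0
    refine iso e (summand v Z (ih _ ?_ hZ rfl))
    obtain ⟨h1, h2⟩ := (CM_iff Z).mp ((M14Perp_iff Z).mp hZ).1
    have e' : M ≃ₗ[ℂ⟦X⟧] (rankOneModule v.pair ⊞ Z : ModuleCat.{0} (CAlg 2 6)) :=
      { powerSeriesLinear e.hom with
        invFun := e.inv.hom
        left_inv := fun m => congrArg (fun f => f.hom m) e.hom_inv_id
        right_inv := fun m => congrArg (fun f => f.hom m) e.inv_hom_id }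
    have h3 := (e'.trans (biprodEquiv _ _)).finrank_eq
    have e6 := (coord (I := v.pair))
    have := Module.Finite.equiv e6.symm
    have := Module.Free.of_equiv e6.symm
    rw [Module.finrank_prod, e6.finrank_eq, Module.finrank_pi, ZMod.card] at h3
    omega

/-! ### Radical and irreducible morphisms -/

lemma isIso_minHom {I : Pair} {p : ℂ⟦X⟧} (hp : IsUnit p) : IsIso (minHom I I p) := by
  obtain ⟨q, hq⟩ := hp.exists_right_inv
  refine ⟨minHom I I q, ?_, ?_⟩
  · rw [minHom_mul (defect_self_left I I), hq, pow_zero, one_mul, minHom_one]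
  · rw [minHom_mul (defect_self_left I I), mul_comm q, hq, pow_zero, one_mul, minHom_one]

lemma isUnit_iff_not_X_dvd {p : ℂ⟦X⟧} : IsUnit p ↔ ¬ X ∣ p := by
  rw [isUnit_iff_constantCoeff, isUnit_iff_ne_zero, X_dvd_iff]

lemma minHom_zero {I J : Pair} : minHom I J 0 = 0 := map_zero (minHomEquiv I J)

lemma minHom_sub {I J : Pair} (p q : ℂ⟦X⟧) : minHom I J (p - q) = minHom I J p - minHom I J q :=
  map_sub (minHomEquiv I J) p q

lemma isIso_id_sub_minHom {I : Pair} {p : ℂ⟦X⟧} (hp : X ∣ p) : IsIso (𝟙 _ - minHom I I p) := by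
  have h : 𝟙 _ - minHom I I p = minHom I I (1 - p) := by
    rw [← minHom_one, minHom_sub]
  rw [h]
  refine isIso_minHom ?_
  rw [isUnit_iff_not_X_dvd]
  intro h1
  exact X_prime.not_dvd_one ((dvd_sub_left hp).mp h1)

lemma not_isZero_rankOneModule (I : Pair) : ¬ IsZero (rankOneModule I) := fun h => by
  have h1 : minHom I I 1 = minHom I I 0 := h.eq_of_src _ _
  exact one_ne_zero (minHom_injective h1)

/-- A homomorphism from `M_I` that is not a split monomorphism is in the radical. -/
lemma mem_radical_of_not_isSplitMono {I : Pair} {W : ModuleCat.{0} (CAlg 2 6)}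
    {f : rankOneModule I ⟶ W} (hf : ¬ IsSplitMono f) : f ∈ radical ℂ (rankOneModule I) W :=
  fun g => by
    obtain ⟨p, hp⟩ := minHom_surjective (f ≫ g)
    rw [← hp]
    refine isIso_id_sub_minHom ?_
    by_contra h
    have := isIso_minHom (I := I) (isUnit_iff_not_X_dvd.mpr h)
    rw [hp] at this
    exact hf ⟨⟨g ≫ inv (f ≫ g), by rw [← Category.assoc, IsIso.hom_inv_id]⟩⟩

/-- A homomorphism to `M_I` that is not a split epimorphism is in the radical. -/
lemma mem_radical_of_not_isSplitEpi {I : Pair} {W : ModuleCat.{0} (CAlg 2 6)}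
    {f : W ⟶ rankOneModule I} (hf : ¬ IsSplitEpi f) : f ∈ radical ℂ W (rankOneModule I) :=
  fun g => by
    refine isIso_one_sub_comp_swap g f ?_
    obtain ⟨p, hp⟩ := minHom_surjective (g ≫ f)
    rw [← hp]
    refine isIso_id_sub_minHom ?_
    by_contra h
    have := isIso_minHom (I := I) (isUnit_iff_not_X_dvd.mpr h)
    rw [hp] at this
    exact hf ⟨⟨inv (g ≫ f) ≫ g, by rw [Category.assoc, IsIso.inv_hom_id]⟩⟩

lemma minHom_mem_radical_iff {I J : Pair} {p : ℂ⟦X⟧} :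
    minHom I J p ∈ radical ℂ (rankOneModule I) (rankOneModule J) ↔ X ^ radExp I J ∣ p := by
  unfold radExp
  split_ifs with h
  · subst h
    rw [pow_one]
    constructor
    · intro h1
      by_contra h2
      have := isIso_minHom (I := I) (isUnit_iff_not_X_dvd.mpr h2)
      exact not_isZero_rankOneModule I (isZero_of_mem_radical_of_isSplitMono h1 inferInstance)
    · intro h1 g
      obtain ⟨q, rfl⟩ := minHom_surjective g
      rw [minHom_comp]
      exact isIso_id_sub_minHom ((h1.mul_right q).mul_right _)
  · simp only [pow_zero, one_dvd, iff_true]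
    intro g
    obtain ⟨q, rfl⟩ := minHom_surjective g
    rw [minHom_comp]
    exact isIso_id_sub_minHom ((dvd_pow_self X (defect_pos h).ne').mul_left _)

/-- Lifting of homomorphisms `p` times the minimal one through a third rank one module. -/
lemma exists_comp_minHom {I K J : Pair} {p : ℂ⟦X⟧} (h : X ^ defect I K J ∣ p) {u : ℂ⟦X⟧}
    (hu : u * u = 1) : (∃ g, g ≫ minHom K J u = minHom I J p) ∧
      ∃ g, minHom I K u ≫ g = minHom I J p := by
  obtain ⟨q, rfl⟩ := h
  refine ⟨⟨minHom I K (q * u), ?_⟩, ⟨minHom K J (q * u), ?_⟩⟩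
  · rw [minHom_mul rfl, mul_assoc q, hu, mul_one]
  · rw [minHom_mul rfl, mul_left_comm u, hu, mul_one]

/-- Along an arrow of the quiver, the square of the radical consists of homomorphisms that are
divisible by `t`. -/
lemma X_dvd_of_mem_radicalSq {i j : Vertex} (hij : j ∈ i.succ) {p : ℂ⟦X⟧}
    (hp : minHom i.pair j.pair p ∈
      radicalSq ℂ M14Perp (rankOneModule i.pair) (rankOneModule j.pair)) : X ∣ p := by
  -- By additivity, only composites through the modules attached to vertices matter.
  have key : ∀ {W : ModuleCat.{0} (CAlg 2 6)}, M14Perp W →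
      ∀ f ∈ radical ℂ (rankOneModule i.pair) W, ∀ g ∈ radical ℂ W (rankOneModule j.pair),
        ∃ q, X ∣ q ∧ minHom i.pair j.pair q = f ≫ g := fun {W} hW => by
    refine M14Perp_induction (Φ := fun W => ∀ f ∈ radical ℂ (rankOneModule i.pair) W,
      ∀ g ∈ radical ℂ W (rankOneModule j.pair), ∃ q, X ∣ q ∧ minHom i.pair j.pair q = f ≫ g)
      ?_ ?_ ?_ hW
    · intro M N e h f hf g hg
      obtain ⟨q, hq, hq'⟩ := h (f ≫ e.hom) (comp_mem_radical hf _) (e.inv ≫ g)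
        (comp_mem_radical' _ hg)
      exact ⟨q, hq, by rw [hq', Category.assoc, Iso.hom_inv_id_assoc]⟩
    · intro M hM f _ g _
      refine ⟨0, dvd_zero X, ?_⟩
      rw [hM.eq_of_tgt f 0, zero_comp]
      exact minHom_zero
    · intro v Z hZ f hf g hg
      obtain ⟨q, hq, hq'⟩ := hZ (f ≫ biprod.snd) (comp_mem_radical hf _) (biprod.inr ≫ g)
        (comp_mem_radical' _ hg)
      have h1 := comp_mem_radical hf (biprod.fst : rankOneModule v.pair ⊞ Z ⟶ _)
      have h2 := comp_mem_radical' (biprod.inl : _ ⟶ rankOneModule v.pair ⊞ Z) hg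
      obtain ⟨a, ha⟩ := minHom_surjective (f ≫ (biprod.fst : rankOneModule v.pair ⊞ Z ⟶ _))
      obtain ⟨b, hb⟩ := minHom_surjective ((biprod.inl : _ ⟶ rankOneModule v.pair ⊞ Z) ≫ g)
      rw [← ha, minHom_mem_radical_iff] at h1
      rw [← hb, minHom_mem_radical_iff] at h2
      refine ⟨a * b * X ^ defect i.pair v.pair j.pair + q, dvd_add ?_ hq, ?_⟩
      · refine dvd_trans ?_ (mul_dvd_mul_right (mul_dvd_mul h1 h2) _)
        rw [← pow_add, ← pow_add]
        exact dvd_pow_self X (Nat.one_le_iff_ne_zero.mp (one_le_of_mem_succ i j hij v))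
      · rw [minHom_add, ← minHom_comp, ha, hb, hq']
        have h3 : f ≫ g = f ≫ (biprod.fst ≫ biprod.inl + biprod.snd ≫ biprod.inr) ≫ g := by
          rw [biprod.total, Category.id_comp]
        rw [h3, Preadditive.add_comp, Preadditive.comp_add]
        simp only [Category.assoc]
  have hspan : ∀ f ∈ radicalSq ℂ M14Perp (rankOneModule i.pair) (rankOneModule j.pair),
      ∃ q, X ∣ q ∧ minHom i.pair j.pair q = f := fun f hf => by
    induction hf using Submodule.span_induction with
    | mem h hh =>
      obtain ⟨W, f, g, hW, hf, hg, rfl⟩ := hh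
      exact key hW f hf g hg
    | zero => exact ⟨0, dvd_zero X, minHom_zero⟩
    | add f g _ _ hf hg =>
      obtain ⟨a, ha, rfl⟩ := hf
      obtain ⟨b, hb, rfl⟩ := hg
      exact ⟨a + b, dvd_add ha hb, minHom_add a b⟩
    | smul z f _ hf =>
      obtain ⟨a, ha, rfl⟩ := hf
      exact ⟨z • a, by rw [smul_eq_C_mul]; exact ha.mul_left _, minHom_smul z a⟩
  obtain ⟨q, hq, hq'⟩ := hspan _ hp
  rwa [minHom_injective hq'] at hq

/-- If there is no arrow from `i` to `j`, every radical homomorphism is a composite of two radical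
homomorphisms. -/
lemma exists_comp_of_notMem_succ {i j : Vertex} (hij : j ∉ i.succ)
    {f : rankOneModule i.pair ⟶ rankOneModule j.pair}
    (hf : f ∈ radical ℂ (rankOneModule i.pair) (rankOneModule j.pair)) :
    ∃ (v : Vertex) (g : rankOneModule i.pair ⟶ rankOneModule v.pair)
      (h : rankOneModule v.pair ⟶ rankOneModule j.pair),
      g ∈ radical ℂ (rankOneModule i.pair) (rankOneModule v.pair) ∧
      h ∈ radical ℂ (rankOneModule v.pair) (rankOneModule j.pair) ∧ g ≫ h = f := by
  obtain ⟨v, hv⟩ := exists_eq_of_notMem_succ i j hij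
  obtain ⟨p, rfl⟩ := minHom_surjective f
  rw [minHom_mem_radical_iff] at hf
  obtain ⟨q, rfl⟩ := hf
  refine ⟨v, minHom _ _ (X ^ radExp i.pair v.pair * q), minHom _ _ (X ^ radExp v.pair j.pair),
    minHom_mem_radical_iff.mpr (dvd_mul_right _ _), minHom_mem_radical_iff.mpr dvd_rfl, ?_⟩
  rw [minHom_comp, ← hv]
  exact congrArg (minHom _ _) (by ring)

/-- There is an irreducible morphism if and only if there is an arrow. -/
lemma exists_isIrreducible_iff (i j : Vertex) :
    (∃ f : rankOneModule i.pair ⟶ rankOneModule j.pair, IsIrreducible M14Perp f) ↔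
      j ∈ i.succ := by
  constructor
  · rintro ⟨f, -, -, h1, -, h3⟩
    by_contra hij
    obtain ⟨v, g, h, hg, hh, hgh⟩ := exists_comp_of_notMem_succ hij
      (mem_radical_of_not_isSplitMono h1)
    rcases h3 _ g h (M14Perp_vertex v) hgh with h4 | h4
    · exact not_isZero_rankOneModule _ (isZero_of_mem_radical_of_isSplitMono hg h4)
    · exact not_isZero_rankOneModule _ (isZero_of_mem_radical_of_isSplitEpi hh h4)
  · intro hij
    have hne : i.pair ≠ j.pair := fun h => ne_of_mem_succ i j hij (pair_injective h)
    have hrad : minHom i.pair j.pair 1 ∈ radical ℂ _ _ := by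
      rw [minHom_mem_radical_iff, radExp, if_neg hne, pow_zero]
    refine ⟨minHom i.pair j.pair 1, M14Perp_vertex i, M14Perp_vertex j, fun h => ?_, fun h => ?_,
      fun W g h hW hgh => ?_⟩
    · exact not_isZero_rankOneModule _ (isZero_of_mem_radical_of_isSplitMono hrad h)
    · exact not_isZero_rankOneModule _ (isZero_of_mem_radical_of_isSplitEpi hrad h)
    · by_contra! hc
      have hmem : minHom i.pair j.pair 1 ∈ radicalSq ℂ M14Perp _ _ :=
        Submodule.subset_span ⟨W, g, h, hW, mem_radical_of_not_isSplitMono hc.1,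
          mem_radical_of_not_isSplitEpi hc.2, hgh⟩
      exact X_prime.not_dvd_one (X_dvd_of_mem_radicalSq hij hmem)

/-- The space of irreducible maps has a basis indexed by the arrows. -/
lemma nonempty_basis_irr (i j : Vertex) : Nonempty (Module.Basis (i ⟶ j) ℂ
    (Irr ℂ M14Perp (rankOneModule i.pair) (rankOneModule j.pair))) := by
  by_cases hij : j ∈ i.succ
  · obtain ⟨a⟩ := (nonempty_hom_iff i j).mpr hij
    have : Unique (i ⟶ j) := uniqueOfSubsingleton a
    have hne : i.pair ≠ j.pair := fun h => ne_of_mem_succ i j hij (pair_injective h)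
    have hrad : ∀ p, minHom i.pair j.pair p ∈ radical ℂ _ _ := fun p => by
      rw [minHom_mem_radical_iff, radExp, if_neg hne, pow_zero]
      exact one_dvd p
    refine ⟨Module.basisUnique _ (finrank_eq_one (Submodule.Quotient.mk ⟨_, hrad 1⟩) ?_ ?_)⟩
    · rw [ne_eq, Submodule.Quotient.mk_eq_zero]
      intro h
      exact X_prime.not_dvd_one (X_dvd_of_mem_radicalSq hij h)
    · intro w
      obtain ⟨⟨f, hf⟩, rfl⟩ := Submodule.Quotient.mk_surjective _ w
      obtain ⟨p, rfl⟩ := minHom_surjective f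
      refine ⟨constantCoeff p, ?_⟩
      rw [← Submodule.Quotient.mk_smul, Submodule.Quotient.eq]
      change constantCoeff p • minHom i.pair j.pair 1 - minHom i.pair j.pair p ∈ radicalSq ℂ _ _ _
      obtain ⟨q, hq⟩ : X ∣ constantCoeff p • (1 : ℂ⟦X⟧) - p := by
        rw [X_dvd_iff, map_sub, smul_eq_C_mul, mul_one, constantCoeff_C, sub_self]
      have h1 : constantCoeff p • minHom i.pair j.pair 1 - minHom i.pair j.pair p =
          minHom i.pair i.pair X ≫ minHom i.pair j.pair q := by
        rw [minHom_mul (defect_self_left _ _), pow_zero, one_mul, ← hq, ← minHom_smul]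
        exact (minHom_sub _ _).symm
      rw [h1]
      refine Submodule.subset_span ⟨_, _, _, M14Perp_vertex i, ?_, hrad q, rfl⟩
      rw [minHom_mem_radical_iff, radExp, if_pos rfl, pow_one]
  · have : IsEmpty (i ⟶ j) := not_nonempty_iff.mp fun h => hij ((nonempty_hom_iff i j).mp h)
    have : Subsingleton (Irr ℂ M14Perp (rankOneModule i.pair) (rankOneModule j.pair)) := by
      rw [Submodule.Quotient.subsingleton_iff, eq_top_iff]
      rintro ⟨f, hf⟩ -
      obtain ⟨v, g, h, hg, hh, rfl⟩ := exists_comp_of_notMem_succ hij hf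
      exact Submodule.subset_span ⟨_, g, h, M14Perp_vertex v, hg, hh, rfl⟩
    exact ⟨Module.Basis.empty _⟩

/-! ### Indecomposable objects -/

/-- The only idempotent endomorphisms of a rank one module are `0` and the identity. -/
lemma indecomposables_rankOneModule (v : Vertex) :
    indecomposables M14Perp (rankOneModule v.pair) := by
  refine ⟨M14Perp_vertex v, not_isZero_rankOneModule _, fun Y Z _ _ e => ?_⟩
  obtain ⟨p, hp⟩ := minHom_surjective (e.hom ≫ biprod.fst ≫ biprod.inl ≫ e.inv)
  have hidem : p * p = p := by
    refine minHom_injective (?_ : minHom v.pair v.pair _ = minHom v.pair v.pair _)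
    have h := minHom_mul (defect_self_left v.pair v.pair) p p
    rw [pow_zero, one_mul] at h
    rw [← h, hp]
    simp
  rcases IsIdempotentElem.iff_eq_zero_or_one.mp hidem with rfl | rfl
  · left
    rw [minHom_zero] at hp
    have h : 𝟙 Y = biprod.inl ≫ e.inv ≫ (e.hom ≫ biprod.fst ≫ biprod.inl ≫ e.inv) ≫ e.hom ≫
        biprod.fst := by simp
    rw [IsZero.iff_id_eq_zero, h, ← hp]
    simp
  · right
    rw [minHom_one] at hp
    have h : 𝟙 Z = biprod.inr ≫ e.inv ≫ 𝟙 _ ≫ e.hom ≫ biprod.snd := by simp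
    rw [IsZero.iff_id_eq_zero, h, hp]
    simp

lemma eq_of_iso_rankOneModule {i j : Vertex}
    (h : Nonempty (rankOneModule i.pair ≅ rankOneModule j.pair)) : i = j := by
  obtain ⟨e⟩ := h
  by_contra hij
  obtain ⟨p, hp⟩ := minHom_surjective e.hom
  have hrad : e.hom ∈ radical ℂ (rankOneModule i.pair) (rankOneModule j.pair) := by
    rw [← hp, minHom_mem_radical_iff, radExp, if_neg (pair_injective.ne hij), pow_zero]
    exact one_dvd p
  exact not_isZero_rankOneModule _ (isZero_of_mem_radical_of_isSplitMono hrad inferInstance)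

lemma exists_iso_of_indecomposables {M : ModuleCat.{0} (CAlg 2 6)}
    (h : indecomposables M14Perp M) : ∃ v : Vertex, Nonempty (M ≅ rankOneModule v.pair) := by
  obtain ⟨v, Z, hZ, ⟨e⟩⟩ := exists_iso_biprod_of_M14Perp h.1 h.2.1
  rcases h.2.2 _ _ (M14Perp_vertex v) hZ e with h0 | h0
  · exact (not_isZero_rankOneModule _ h0).elim
  · exact ⟨v, ⟨e ≪≫ (isoBiprodZero h0).symm⟩⟩

/-! ### Auslander–Reiten sequences -/

/-- Radical homomorphisms to `M_I` lift along the right-hand map of a square, if those from the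
modules attached to vertices do. -/
lemma exists_comp_squareDesc {K L I : Pair}
    (h : ∀ v : Vertex, defect v.pair K I ≤ radExp v.pair I ∨ defect v.pair L I ≤ radExp v.pair I)
    {W : ModuleCat.{0} (CAlg 2 6)} (hW : M14Perp W) :
    ∀ f ∈ radical ℂ W (rankOneModule I), ∃ g, g ≫ squareDesc K L I = f := by
  refine M14Perp_induction
    (Φ := fun W => ∀ f ∈ radical ℂ W (rankOneModule I), ∃ g, g ≫ squareDesc K L I = f) ?_ ?_ ?_ hW
  · intro M N e hN f hf
    obtain ⟨g, hg⟩ := hN (e.inv ≫ f) (comp_mem_radical' _ hf)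
    exact ⟨e.hom ≫ g, by rw [Category.assoc, hg, Iso.hom_inv_id_assoc]⟩
  · intro M hM f _
    exact ⟨0, hM.eq_of_src _ _⟩
  · intro v Z hZ f hf
    obtain ⟨g, hg⟩ := hZ (biprod.inr ≫ f) (comp_mem_radical' _ hf)
    obtain ⟨p, hp⟩ := minHom_surjective (biprod.inl ≫ f)
    have hp' := comp_mem_radical' (biprod.inl : _ ⟶ rankOneModule v.pair ⊞ Z) hf
    rw [← hp, minHom_mem_radical_iff] at hp'
    obtain ⟨g', hg'⟩ : ∃ g', g' ≫ squareDesc K L I = minHom v.pair I p := by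
      rcases h v with h | h
      · obtain ⟨g', hg'⟩ := (exists_comp_minHom ((pow_dvd_pow X h).trans hp') (one_mul 1)).1
        exact ⟨g' ≫ biprod.inl, by rw [squareDesc, Category.assoc, biprod.inl_desc, hg']⟩
      · obtain ⟨g', hg'⟩ := (exists_comp_minHom ((pow_dvd_pow X h).trans hp')
          (by ring : (-1 : ℂ⟦X⟧) * -1 = 1)).1
        exact ⟨g' ≫ biprod.inr, by rw [squareDesc, Category.assoc, biprod.inr_desc, hg']⟩
    refine ⟨biprod.desc g' g, biprod.hom_ext' _ _ ?_ ?_⟩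
    · rw [biprod.inl_desc_assoc, hg', hp]
    · rw [biprod.inr_desc_assoc, hg]

/-- Radical homomorphisms from `M_J` extend along the left-hand map of a square, if those to the
modules attached to vertices do. -/
lemma exists_squareLift_comp {J K L : Pair}
    (h : ∀ v : Vertex, defect J K v.pair ≤ radExp J v.pair ∨ defect J L v.pair ≤ radExp J v.pair)
    {W : ModuleCat.{0} (CAlg 2 6)} (hW : M14Perp W) :
    ∀ f ∈ radical ℂ (rankOneModule J) W, ∃ g, squareLift J K L ≫ g = f := by
  refine M14Perp_induction
    (Φ := fun W => ∀ f ∈ radical ℂ (rankOneModule J) W, ∃ g, squareLift J K L ≫ g = f) ?_ ?_ ?_ hW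
  · intro M N e hN f hf
    obtain ⟨g, hg⟩ := hN (f ≫ e.hom) (comp_mem_radical hf _)
    exact ⟨g ≫ e.inv, by
      rw [← Category.assoc, hg, Category.assoc, Iso.hom_inv_id, Category.comp_id]⟩
  · intro M hM f _
    exact ⟨0, hM.eq_of_tgt _ _⟩
  · intro v Z hZ f hf
    obtain ⟨g, hg⟩ := hZ (f ≫ biprod.snd) (comp_mem_radical hf _)
    obtain ⟨p, hp⟩ := minHom_surjective (f ≫ (biprod.fst : rankOneModule v.pair ⊞ Z ⟶ _))
    have hp' := comp_mem_radical hf (biprod.fst : rankOneModule v.pair ⊞ Z ⟶ _)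
    rw [← hp, minHom_mem_radical_iff] at hp'
    obtain ⟨g', hg'⟩ : ∃ g', squareLift J K L ≫ g' = minHom J v.pair p := by
      rcases h v with h | h
      · obtain ⟨g', hg'⟩ := (exists_comp_minHom ((pow_dvd_pow X h).trans hp') (one_mul 1)).2
        exact ⟨biprod.fst ≫ g', by rw [squareLift, biprod.lift_fst_assoc, hg']⟩
      · obtain ⟨g', hg'⟩ := (exists_comp_minHom ((pow_dvd_pow X h).trans hp') (one_mul 1)).2
        exact ⟨biprod.snd ≫ g', by rw [squareLift, biprod.lift_snd_assoc, hg']⟩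
    refine ⟨biprod.lift g' g, biprod.hom_ext _ _ ?_ ?_⟩
    · rw [Category.assoc, biprod.lift_fst, hg', hp]
    · rw [Category.assoc, biprod.lift_snd, hg]

lemma isARSequence_squareComplex {i j : Vertex} (h : Translate i j) :
    IsARSequence M14Perp (squareComplex (isExactSquare_mesh i j h)) where
  conflation := ⟨squareComplex_shortExact _, M14Perp_vertex j,
    M14Perp_biprod (M14Perp_vertex _) (M14Perp_vertex _), M14Perp_vertex i⟩
  indec_left := indecomposables_rankOneModule j
  indec_right := indecomposables_rankOneModule i
  not_split := isEmpty_splitting_squareComplex _ (mesh_ne i j h).1 (mesh_ne i j h).2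
  left_almost_split _ _ hW hf :=
    exists_squareLift_comp (defect_mesh_left i j h) hW _ (mem_radical_of_not_isSplitMono hf)
  right_almost_split _ _ hW hf :=
    exists_comp_squareDesc (defect_mesh_right i j h) hW _ (mem_radical_of_not_isSplitEpi hf)

lemma translate_iff (i j : Vertex) : Translate i j ↔
    ∃ S : ShortComplex (ModuleCat.{0} (CAlg 2 6)), IsARSequence M14Perp S ∧
      Nonempty (S.X₁ ≅ rankOneModule j.pair) ∧ Nonempty (S.X₃ ≅ rankOneModule i.pair) := by
  constructor
  · exact fun h => ⟨_, isARSequence_squareComplex h, ⟨Iso.refl _⟩, ⟨Iso.refl _⟩⟩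
  · rintro ⟨S, hS, ⟨e₁⟩, ⟨e₃⟩⟩
    by_contra h
    obtain ⟨s⟩ := nonempty_splitting_of_subsingleton_ext hS.conflation.1
      (subsingleton_ext_of_retract_left (.ofIso e₃)
        (subsingleton_ext_of_retract_right (.ofIso e₁) (subsingleton_ext_of_not_translate h)))
    exact hS.not_split.false s

/-! ### Projective and injective objects -/

lemma projectives_iff_boxed (i : Vertex) :
    projectives M14Perp (rankOneModule i.pair) ↔ Boxed i := by
  rw [boxed_iff]
  refine ⟨fun h j hij => not_projectives_of_isARSequence (isARSequence_squareComplex hij) h,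
    fun h => projectives_of_subsingleton_ext (M14Perp_vertex i) fun K hK => ?_⟩
  refine M14Perp_induction
    (Φ := fun K => Subsingleton (Abelian.Ext (rankOneModule i.pair) K 1)) ?_ ?_ ?_ hK
  · exact fun e hN => subsingleton_ext_of_retract_right (.ofIso e) hN
  · intro M hM
    refine subsingleton_of_forall_eq 0 fun x => ?_
    rw [← Abelian.Ext.comp_mk₀_id x, hM.eq_of_src (𝟙 M) 0, Abelian.Ext.mk₀_zero,
      Abelian.Ext.comp_zero]
  · intro v Z hZ
    have := subsingleton_ext_of_not_translate (h v)
    exact Abelian.Ext.addEquivBiprod.subsingleton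

lemma injectives_iff_boxed (i : Vertex) :
    injectives M14Perp (rankOneModule i.pair) ↔ Boxed i := by
  rw [boxed_iff]
  refine ⟨fun h j hij => not_injectives_of_isARSequence (isARSequence_squareComplex hij.symm) h,
    fun h => injectives_of_subsingleton_ext (M14Perp_vertex i) fun K hK => ?_⟩
  refine M14Perp_induction
    (Φ := fun K => Subsingleton (Abelian.Ext K (rankOneModule i.pair) 1)) ?_ ?_ ?_ hK
  · exact fun e hN => subsingleton_ext_of_retract_left (.ofIso e) hN
  · intro M hM
    refine subsingleton_of_forall_eq 0 fun x => ?_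
    rw [← Abelian.Ext.mk₀_id_comp x, hM.eq_of_src (𝟙 M) 0, Abelian.Ext.mk₀_zero,
      Abelian.Ext.zero_comp]
  · intro v Z hZ
    have := subsingleton_ext_of_not_translate fun hv => h v (Translate.symm hv)
    exact Abelian.Ext.biprodAddEquiv.subsingleton

lemma exists_isIrreducible_boxed_iff : ∀ i j : Vertex, Boxed i → Boxed j →
    (j ∈ i.succ ↔ (i = .m45 ∧ j = .m34) ∨ (i = .m12 ∧ j = .m16)) := by
  decide

/-! ### The Auslander–Reiten quiver -/

lemma isARQuiver_M14Perp :
    IsARQuiver ℂ M14Perp Vertex Translate fun v => rankOneModule v.pair where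
  indec := indecomposables_rankOneModule
  complete _ hM := by
    obtain ⟨v, ⟨e⟩⟩ := exists_iso_of_indecomposables hM
    exact ⟨v, ⟨e⟩, fun w ⟨e'⟩ => eq_of_iso_rankOneModule ⟨e'.symm ≪≫ e⟩⟩
  arrows := nonempty_basis_irr
  translate := translate_iff

lemma card_indecomposables : Nat.card (IsoClasses (indecomposables M14Perp)) = 11 := by
  rw [card_isoClasses (fun v : Vertex => rankOneModule v.pair) indecomposables_rankOneModule
    (fun _ => exists_iso_of_indecomposables) fun _ _ => eq_of_iso_rankOneModule,
    Nat.card_congr Vertex.equivFin, Nat.card_fin]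

lemma card_projectives_injectives : Nat.card (IsoClasses
    (indecomposables M14Perp ⊓ projectives M14Perp ⊓ injectives M14Perp)) = 7 := by
  rw [card_isoClasses (fun v : {i : Vertex // Boxed i} => rankOneModule v.1.pair)
    (fun v => ⟨⟨indecomposables_rankOneModule _, (projectives_iff_boxed _).mpr v.2⟩,
      (injectives_iff_boxed _).mpr v.2⟩) ?_ fun i j h => Subtype.ext (eq_of_iso_rankOneModule h),
    Nat.card_eq_fintype_card, card_boxed]
  rintro X ⟨⟨h1, h2⟩, -⟩
  obtain ⟨v, ⟨e⟩⟩ := exists_iso_of_indecomposables h1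
  exact ⟨⟨v, (projectives_iff_boxed v).mp (projectives_of_iso e h2)⟩, ⟨e⟩⟩

end

end GrassmannianCluster

theorem mainTheorem12 :
    ARTheory.IsARQuiver ℂ GrassmannianCluster.M14Perp GrassmannianCluster.Vertex
        GrassmannianCluster.Translate GrassmannianCluster.Vertex.module ∧
      Nat.card (ARTheory.IsoClasses
        (ARTheory.indecomposables GrassmannianCluster.M14Perp)) = 11 ∧
      Nat.card (ARTheory.IsoClasses
        (ARTheory.indecomposables GrassmannianCluster.M14Perp ⊓
          ARTheory.projectives GrassmannianCluster.M14Perp ⊓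
          ARTheory.injectives GrassmannianCluster.M14Perp)) = 7 ∧
      (∀ i : GrassmannianCluster.Vertex,
        (ARTheory.projectives GrassmannianCluster.M14Perp i.module ↔
            GrassmannianCluster.Boxed i) ∧
          (ARTheory.injectives GrassmannianCluster.M14Perp i.module ↔
            GrassmannianCluster.Boxed i)) ∧
      (∀ i j : GrassmannianCluster.Vertex,
        (∃ f : i.module ⟶ j.module,
            ARTheory.IsIrreducible GrassmannianCluster.M14Perp f) ↔
          Nonempty (i ⟶ j)) ∧
      (∀ i j : GrassmannianCluster.Vertex,
        GrassmannianCluster.Boxed i → GrassmannianCluster.Boxed j →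
          ((∃ f : i.module ⟶ j.module,
              ARTheory.IsIrreducible GrassmannianCluster.M14Perp f) ↔
            (i = .m45 ∧ j = .m34) ∨ (i = .m12 ∧ j = .m16))) := by
  open GrassmannianCluster in
  rw [show Vertex.module = fun v => rankOneModule v.pair from funext Vertex.module_eq]
  refine ⟨isARQuiver_M14Perp, card_indecomposables, card_projectives_injectives,
    fun i => ⟨projectives_iff_boxed i, injectives_iff_boxed i⟩, fun i j => ?_,
    fun i j hi hj => ?_⟩
  · exact (exists_isIrreducible_iff i j).trans (nonempty_hom_iff i j).symm
  · exact (exists_isIrreducible_iff i j).trans (exists_isIrreducible_boxed_iff i j hi hj)
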